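/- Let $p,q$ be coprime positive integers with $\frac12<\frac pq<\frac{\sqrt2}{2}$. For $a\in(0,\frac\pi4)$ put $$\Omega(a)=\sin a\cos a\int_a^{\pi/2-a}\frac{d\nu}{\cos\nu\sqrt{\sin^2\nu\cos^2\nu-\sin^2a\cos^2a}},$$ and let $a$ satisfy $\Omega(a)=\frac pq\pi$. Let $t\mapsto(\nu(t),\lambda(t))$, $t\in\mathbb R$, with $0<\nu<\frac\pi2$, be a unit speed geodesic of the metric $4\pi^2\sin^2\nu\,(d\nu^2+\cos^2\nu\,d\lambda^2)$ with $\min_t\nu(t)=\nu(0)=a$. The Otsuki torus $O_{p/q}$ is the surface in $\mathbb S^3$ parametrized by $$I(\alpha,t)=(\cos\alpha\sin\nu(t),\ \sin\alpha\sin\nu(t),\ \cos\nu(t)\cos\lambda(t),\ \cos\nu(t)\sin\lambda(t)).$$ Let $I^*$ be a continuous field of unit vectors tangent to $\mathbb S^3$ and normal to $O_{p/q}$. The bipolar surface $\tilde O_{p/q}$ is the surface parametrized by $I\wedge I^*:\mathbb R^2\to\Lambda^2\mathbb R^4=\mathbb R^6$; that is, $\tilde O_{p/q}$ is the quotient of the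 $(\alpha,t)$-plane by the group of all translations that leave $I\wedge I^*$ invariant, equipped with the Riemannian metric induced by $I\wedge I^*$. For a closed surface $M$ with metric $g$, let $0=\lambda_0<\lambda_1\le\lambda_2\le\cdots$ be the eigenvalues of the Laplace–Beltrami operator, written with multiplicities, and let $\Lambda_k(M,g)=\lambda_k(M,g)\,\mathrm{Area}(M,g)$. Let $b\in(0,\frac\pi2)$ be defined by $\cos^4b=4\sin^2a\cos^2a$, and let $$I_2(b)=\int_{-b}^{b}\frac{\cos^3\varphi}{\sqrt{\cos^4\varphi-\cos^4b}}\,d\varphi .$$ If $q$ is odd, then $\Lambda_{2q+4p-2}(\tilde O_{p/q})=8q\pi I_2(b)<4\sqrt2\,q\pi^2$. If $q$ is even, then $\Lambda_{q+2p-2}(\tilde O_{p/q})=4q\pi I_2(b)<2\sqrt2\,q\pi^2$. -/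

import Mathlib

open Real Set MeasureTheory
open scoped ContDiff

noncomputable section

/-! Local Riemannian geometry on the coordinate plane `Fin 2 → ℝ`. -/

/-- The partial derivative `∂ f / ∂ xⁱ` of a function on the coordinate plane. -/
def partialDeriv {E : Type*} [NormedAddCommGroup E] [NormedSpace ℝ E] (i : Fin 2)
    (f : (Fin 2 → ℝ) → E) (x : Fin 2 → ℝ) : E :=
  fderiv ℝ f x (Pi.single i 1)

/-- Christoffel symbols `Γᵏᵢⱼ` of the metric with coefficient matrix `g`. -/
def christoffel (g : (Fin 2 → ℝ) → Matrix (Fin 2) (Fin 2) ℝ) (k i j : Fin 2)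
    (x : Fin 2 → ℝ) : ℝ :=
  (1 / 2) * ∑ l, (g x)⁻¹ k l *
    (partialDeriv i (fun y => g y j l) x + partialDeriv j (fun y => g y i l) x
      - partialDeriv l (fun y => g y i j) x)

/-- `c : ℝ → plane` is a smooth geodesic of the metric `g`, parametrized by arc length. -/
structure IsUnitSpeedGeodesic (g : (Fin 2 → ℝ) → Matrix (Fin 2) (Fin 2) ℝ)
    (c : ℝ → Fin 2 → ℝ) : Prop where
  smooth : ContDiff ℝ ∞ c
  geodesic_eq : ∀ t k, deriv (deriv fun s => c s k) t +
    ∑ i, ∑ j, christoffel g k i j (c t) * deriv (fun s => c s i) t * deriv (fun s => c s j) t = 0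
  unit_speed : ∀ t,
    ∑ i, ∑ j, g (c t) i j * deriv (fun s => c s i) t * deriv (fun s => c s j) t = 1

section Immersion

variable {ι : Type*} [Fintype ι]

/-- The metric induced on the coordinate plane by a map `X` into Euclidean space. -/
def inducedMetric (X : (Fin 2 → ℝ) → EuclideanSpace ℝ ι) (x : Fin 2 → ℝ) :
    Matrix (Fin 2) (Fin 2) ℝ :=
  Matrix.of fun i j => inner ℝ (partialDeriv i X x) (partialDeriv j X x)

/-- The group of all translations of the coordinate plane under which `X` is invariant. -/
def periodGroup (X : (Fin 2 → ℝ) → EuclideanSpace ℝ ι) : AddSubgroup (Fin 2 → ℝ) where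
  carrier := {γ | ∀ x, X (γ + x) = X x}
  zero_mem' := fun x => by simp
  add_mem' := fun {γ δ} hγ hδ x => by rw [add_assoc, hγ, hδ]
  neg_mem' := fun {γ} hγ x => by rw [← hγ (-γ + x), add_neg_cancel_left]

end Immersion

/-! Laplace spectrum and area of the quotient of the coordinate plane, with a metric `g` that is
invariant under a group `Γ` of translations, by `Γ` (a flat-coordinates model of a torus when `Γ` is
a lattice).  Functions on the quotient are `Γ`-periodic functions on the plane. -/

/-- The Laplace-Beltrami operator
`Δ f = - (det g)^(-1/2) ∑ᵢⱼ ∂ᵢ ((det g)^(1/2) gⁱʲ ∂ⱼ f)`. -/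
def laplaceBeltrami (g : (Fin 2 → ℝ) → Matrix (Fin 2) (Fin 2) ℝ) (f : (Fin 2 → ℝ) → ℝ)
    (x : Fin 2 → ℝ) : ℝ :=
  -(1 / √(g x).det) * ∑ i, partialDeriv i
    (fun y => √(g y).det * ∑ j, (g y)⁻¹ i j * partialDeriv j f y) x

/-- `f` is a smooth `Γ`-periodic solution of `Δ f = μ f` (the zero function is allowed). -/
def IsLaplaceSolution (Γ : AddSubgroup (Fin 2 → ℝ))
    (g : (Fin 2 → ℝ) → Matrix (Fin 2) (Fin 2) ℝ) (μ : ℝ) (f : (Fin 2 → ℝ) → ℝ) : Prop :=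
  ContDiff ℝ ∞ f ∧ (∀ γ ∈ Γ, ∀ x, f (γ + x) = f x) ∧ ∀ x, laplaceBeltrami g f x = μ * f x

/-- The number, with multiplicities, of Laplace eigenvalues `≤ x` on the quotient by `Γ`:
the dimension of the span of all eigenfunctions with eigenvalue `≤ x`. -/
def eigenvalueCount (Γ : AddSubgroup (Fin 2 → ℝ))
    (g : (Fin 2 → ℝ) → Matrix (Fin 2) (Fin 2) ℝ) (x : ℝ) : Cardinal :=
  Module.rank ℝ (Submodule.span ℝ {f | ∃ μ ≤ x, IsLaplaceSolution Γ g μ f})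

/-- The eigenvalue `λₖ`, where `λ₀ ≤ λ₁ ≤ λ₂ ≤ ⋯` are all the eigenvalues written with
multiplicities: the least `x` such that more than `k` eigenvalues are `≤ x`. -/
def laplaceEigenvalue (Γ : AddSubgroup (Fin 2 → ℝ))
    (g : (Fin 2 → ℝ) → Matrix (Fin 2) (Fin 2) ℝ) (k : ℕ) : ℝ :=
  sInf {x : ℝ | (k : Cardinal) < eigenvalueCount Γ g x}

/-- The Riemannian area of the quotient by `Γ`: the measure with density `(det g)^(1/2)` of a
fundamental domain of `Γ`. -/
def riemannianArea (Γ : AddSubgroup (Fin 2 → ℝ))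
    (g : (Fin 2 → ℝ) → Matrix (Fin 2) (Fin 2) ℝ) : ℝ :=
  (addCovolume Γ (Fin 2 → ℝ)
    (volume.withDensity fun x => ENNReal.ofReal √(g x).det)).toReal

/-- The functional `Λₖ = λₖ · Area` of the surface parametrized by `X`, i.e. of the quotient of the
coordinate plane by all translations that leave `X` invariant, with the metric induced by `X`. -/
def eigenvalueFunctional {ι : Type*} [Fintype ι] (X : (Fin 2 → ℝ) → EuclideanSpace ℝ ι) (k : ℕ) :
    ℝ :=
  laplaceEigenvalue (periodGroup X) (inducedMetric X) k *
    riemannianArea (periodGroup X) (inducedMetric X)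

/-! Otsuki tori and their bipolar surfaces. -/

/-- The metric `4π² sin² ν (dν² + cos² ν dλ²)` on the space of principal orbits of the action of
`SO(2)` on the three-sphere, in the coordinates `x 0 = ν`, `x 1 = λ`. -/
def orbitMetric (x : Fin 2 → ℝ) : Matrix (Fin 2) (Fin 2) ℝ :=
  !![4 * π ^ 2 * sin (x 0) ^ 2, 0; 0, 4 * π ^ 2 * sin (x 0) ^ 2 * cos (x 0) ^ 2]

/-- The increment of `λ` along a geodesic of `orbitMetric` between consecutive points with `ν = a`
(the minimum of `ν`) and `ν = π / 2 - a` (the maximum of `ν`). -/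
def otsukiOmega (a : ℝ) : ℝ :=
  sin a * cos a * ∫ ν in a..(π / 2 - a),
    1 / (cos ν * √(sin ν ^ 2 * cos ν ^ 2 - sin a ^ 2 * cos a ^ 2))

/-- `c = (ν, λ)` is a unit speed geodesic in the space of orbits on which `ν` has minimal value `a`,
attained at `0`, and which closes up with rotation number `p / q`: this is the profile curve of the
Otsuki torus `O_{p/q}`. -/
structure IsOtsukiGeodesic (p q : ℕ) (a : ℝ) (c : ℝ → Fin 2 → ℝ) : Prop where
  geodesic : IsUnitSpeedGeodesic orbitMetric c
  mem_chart : ∀ t, c t 0 ∈ Ioo 0 (π / 2)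
  a_mem : a ∈ Ioo 0 (π / 4)
  start : c 0 0 = a
  le_apply : ∀ t, a ≤ c t 0
  closing : otsukiOmega a = (p : ℝ) / q * π

/-- The immersion `(α, t) ↦ (cos α sin ν, sin α sin ν, cos ν cos λ, cos ν sin λ)` into the unit
sphere of `ℝ⁴`, with `ν = ν(t)`, `λ = λ(t)`, `x 0 = α` and `x 1 = t`. -/
def otsukiImmersion (c : ℝ → Fin 2 → ℝ) (x : Fin 2 → ℝ) : EuclideanSpace ℝ (Fin 4) :=
  !₂[cos (x 0) * sin (c (x 1) 0), sin (x 0) * sin (c (x 1) 0),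
    cos (c (x 1) 0) * cos (c (x 1) 1), cos (c (x 1) 0) * sin (c (x 1) 1)]

/-- `N` is a continuous field of unit vectors tangent to the unit sphere of `ℝ⁴` and normal to the
surface parametrized by `X`. -/
structure IsUnitNormal (X N : (Fin 2 → ℝ) → EuclideanSpace ℝ (Fin 4)) : Prop where
  continuous : Continuous N
  norm_eq_one : ∀ x, ‖N x‖ = 1
  inner_position : ∀ x, inner ℝ (X x) (N x) = 0
  inner_tangent : ∀ x i, inner ℝ (partialDeriv i X x) (N x) = 0

/-- The exterior product of two vectors of `ℝ⁴`, in the orthonormal basis `eᵢ ∧ eⱼ`, `i < j`, of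
`Λ²ℝ⁴ = ℝ⁶`. -/
def wedge (v w : EuclideanSpace ℝ (Fin 4)) :
    EuclideanSpace ℝ {ij : Fin 4 × Fin 4 // ij.1 < ij.2} :=
  WithLp.toLp 2 fun ij => v ij.1.1 * w ij.1.2 - v ij.1.2 * w ij.1.1

/-- The bipolar surface `X ∧ N` of a surface `X` in the three-sphere with unit normal field `N`. -/
def bipolar (X N : (Fin 2 → ℝ) → EuclideanSpace ℝ (Fin 4)) (x : Fin 2 → ℝ) :
    EuclideanSpace ℝ {ij : Fin 4 × Fin 4 // ij.1 < ij.2} :=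
  wedge (X x) (N x)

/-- `I₂(b) = ∫_{-b}^{b} cos³ φ / √(cos⁴ φ - cos⁴ b) dφ`. -/
def integralI2 (b : ℝ) : ℝ :=
  ∫ φ in (-b)..b, cos φ ^ 3 / √(cos φ ^ 4 - cos b ^ 4)

end

noncomputable section

/-! Put A = sin a cos a, w = 1/(2π sin² ν), ρ = sin² ν + A²/sin² ν. Clairaut's integral and unit
speed turn the geodesic equation into a first order system (`IsProfile`). In the coordinates (α, t)
the bipolar surface is (e^{iα} ⊗ (Y, Z), F), with induced metric ρ (dα² + w² dt²). Its periods form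
the lattice generated by (2π, 0) and (επ, 2X), where X = mT, T is half the period of ν, and (m, ε)
is (q, 0) for odd q and (q/2, 1) for even q.

The coordinates Y, Z, F give eigenfunctions for the eigenvalue 2, and the point is to find its
position in the spectrum. The Fourier coefficients in α of order n of an eigenfunction solve (h'/w)'
= w (n² - μρ) h. Since ρ ≤ 1 (`IsProfile.rho_le`), for μ ≤ 2 and n ≥ 2 every periodic solution
vanishes. There remain n = 0 and n = 1, the latter twice because of cos α and sin α. The
coefficients are even about 0 and about X, so parity splits these equations into problems on [0, X]
with Dirichlet or Neumann conditions. Their eigenvalues up to 2 are counted by the value at X of the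
Prüfer angle for μ = 2 (`IsSLWeight.exists_linearIndependent`, `IsSLWeight.exists_spanning`).

These angles come from explicit solutions. For n = 0 the odd solution F turns by mπ. For n = 1 the
solutions Y, Z turn by Λ(X) = mpπ/q. The even problem for n = 0 is squeezed between F and a solution
g of the equation with n² replaced by 1 - 2A. Adding the counts leaves exactly K eigenvalues as the
upper bound below 2 and K + 5 as the lower bound up to 2, K being the index in the statement; hence
λ_K = 2.

The vector (g, f), with f = v cot ν, moves on a circle. Its phase makes ν explicit, gives the
symmetries of ν, and turns the area into 4πm I₂(b) by the substitution sin φ = sin b sin x. The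
upper bound for I₂(b) is a tangent line (Jensen) estimate. -/

/-! ### Global solutions of differential equations and Prüfer angles. -/

open Filter Topology in
theorem exists_forall_hasDerivAt_of_lipschitz {f : ℝ → ℝ → ℝ} {K L : NNReal}
    (hlip : ∀ t, LipschitzWith K (f t)) (hcont : ∀ x, Continuous fun t => f t x)
    (hbound : ∀ t x, |f t x| ≤ L) (x₀ : ℝ) :
    ∃ φ : ℝ → ℝ, φ 0 = x₀ ∧ ∀ t, HasDerivAt φ (f t (φ t)) t := by
  have key : ∀ n : ℕ, ∃ φ : ℝ → ℝ, φ 0 = x₀ ∧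
      ∀ t ∈ Ioo (-(n + 1 : ℝ)) (n + 1), HasDerivAt φ (f t (φ t)) t := by
    intro n
    have h0 : (0 : ℝ) ∈ Icc (-(n + 1 : ℝ)) (n + 1) := ⟨by linarith [n.cast_nonneg (α := ℝ)],
      by linarith [n.cast_nonneg (α := ℝ)]⟩
    -- The radius L (n + 1) is the distance that a field bounded by L can cover in time n + 1, so
    -- solutions exist on the whole interval.
    have hpl : IsPicardLindelof f (⟨0, h0⟩ : Icc (-(n + 1 : ℝ)) (n + 1)) x₀
        (L * (n + 1 : ℕ)) 0 L K :=
      { lipschitzOnWith := fun t _ => (hlip t).lipschitzOnWith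
        continuousOn := fun x _ => (hcont x).continuousOn
        norm_le := fun t _ x _ => hbound t x
        mul_max_le := by simp }
    obtain ⟨φ, h1, h2⟩ := hpl.exists_eq_forall_mem_Icc_hasDerivWithinAt₀
    exact ⟨φ, h1, fun t ht => (h2 t (Ioo_subset_Icc_self ht)).hasDerivAt (Icc_mem_nhds ht.1 ht.2)⟩
  choose φ hφ0 hφ using key
  have huniq : ∀ m n : ℕ, m ≤ n → EqOn (φ m) (φ n) (Ioo (-(m + 1 : ℝ)) (m + 1)) := by
    intro m n hmn
    have hmn' : (m : ℝ) ≤ n := by exact_mod_cast hmn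
    have hm : (0 : ℝ) ≤ m := m.cast_nonneg
    refine ODE_solution_unique_of_mem_Ioo (s := fun _ => univ) (t₀ := 0) (v := f) (K := K)
      (fun t _ => (hlip t).lipschitzOnWith) ⟨by linarith, by linarith⟩
      (fun t ht => ⟨hφ m t ht, trivial⟩)
      (fun t ht => ⟨hφ n t ⟨by linarith [ht.1], by linarith [ht.2]⟩, trivial⟩) ?_
    rw [hφ0, hφ0]
  have hval : ∀ (n : ℕ) (t : ℝ), |t| < n + 1 → φ ⌈|t|⌉₊ t = φ n t := by
    intro n t ht
    have h1 : |t| < (⌈|t|⌉₊ : ℝ) + 1 := lt_of_le_of_lt (Nat.le_ceil _) (by linarith)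
    rcases le_total ⌈|t|⌉₊ n with h | h
    · exact huniq _ _ h ⟨(abs_lt.1 h1).1, (abs_lt.1 h1).2⟩
    · exact (huniq _ _ h ⟨(abs_lt.1 ht).1, (abs_lt.1 ht).2⟩).symm
  -- The index ⌈|t|⌉₊ jumps with t, but near a given t all admissible indices give the same values.
  refine ⟨fun t => φ ⌈|t|⌉₊ t, by simp [hφ0], fun t => ?_⟩
  set n := ⌈|t|⌉₊
  have h1 : |t| < (n : ℝ) + 1 := lt_of_le_of_lt (Nat.le_ceil _) (by linarith)
  refine (hφ n t ⟨(abs_lt.1 h1).1, (abs_lt.1 h1).2⟩).congr_of_eventuallyEq ?_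
  filter_upwards [(isOpen_lt continuous_abs continuous_const).mem_nhds h1] with r hr
  exact hval n r hr

/-- The angle `θ` of a solution `(h, k) = R (sin θ, cos θ)` of `h' = w k`, `k' = - w Q h`. -/
def IsPruferAngle (w Q θ : ℝ → ℝ) : Prop :=
  ∀ t, HasDerivAt θ (w t * (cos (θ t) ^ 2 + Q t * sin (θ t) ^ 2)) t

/-- `(h, k)` solves the Sturm-Liouville system `h' = w k`, `k' = - w Q h`. -/
structure IsSLSolution (w Q h k : ℝ → ℝ) : Prop where
  deriv_fst : ∀ t, HasDerivAt h (w t * k t) t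
  deriv_snd : ∀ t, HasDerivAt k (-(w t * Q t * h t)) t

/-- The cofactor of x - y is continuous also where x = y. This makes the difference of two Prüfer
angles the solution of a linear equation with continuous coefficients. -/
theorem sin_sq_sub_sin_sq_eq_sinc (x y : ℝ) :
    sin x ^ 2 - sin y ^ 2 = (x - y) * (sinc (x - y) * sin (x + y)) := by
  have h : (x - y) * sinc (x - y) = sin (x - y) := by
    rcases eq_or_ne (x - y) 0 with h | h
    · simp [h]
    · rw [sinc_of_ne_zero h]; field_simp
  rw [← mul_assoc, h, sin_sub, sin_add]
  nlinarith [sin_sq_add_cos_sq x, sin_sq_add_cos_sq y]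

/-- Comparison of functions `θ₁`, `θ₂` by their defects in the Prüfer equation. -/
theorem prufer_comparison {w Q θ₁ θ₂ d₁ d₂ : ℝ → ℝ} (hw : Continuous w) (hQ : Continuous Q)
    (h₁ : ∀ t, HasDerivAt θ₁ (d₁ t) t) (h₂ : ∀ t, HasDerivAt θ₂ (d₂ t) t)
    {t₀ X : ℝ} (hX : t₀ ≤ X) (h0 : θ₁ t₀ ≤ θ₂ t₀)
    (hd : ∀ t ∈ Ioo t₀ X, d₁ t - w t * (cos (θ₁ t) ^ 2 + Q t * sin (θ₁ t) ^ 2) ≤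
      d₂ t - w t * (cos (θ₂ t) ^ 2 + Q t * sin (θ₂ t) ^ 2)) :
    θ₁ X ≤ θ₂ X ∧ (θ₁ X = θ₂ X →
      ∀ t ∈ Ioo t₀ X, d₁ t - w t * (cos (θ₁ t) ^ 2 + Q t * sin (θ₁ t) ^ 2) =
      d₂ t - w t * (cos (θ₂ t) ^ 2 + Q t * sin (θ₂ t) ^ 2) ∧ θ₁ t = θ₂ t) := by
  have c₁ : Continuous θ₁ := continuous_iff_continuousAt.2 fun t => (h₁ t).continuousAt
  have c₂ : Continuous θ₂ := continuous_iff_continuousAt.2 fun t => (h₂ t).continuousAt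
  -- With b the difference of the defects, (θ₂ - θ₁)' = κ (θ₂ - θ₁) + b. The integrating factor E
  -- makes D = (θ₂ - θ₁) E nondecreasing, so D ≥ 0; and if D vanishes at X it vanishes on the whole
  -- interval, whence b = 0 there.
  set κ : ℝ → ℝ := fun t => w t * (Q t - 1) *
    (sinc (θ₂ t - θ₁ t) * sin (θ₂ t + θ₁ t)) with hκ
  have cκ : Continuous κ := by
    have := continuous_sinc
    fun_prop
  set E : ℝ → ℝ := fun t => exp (-∫ r in t₀..t, κ r) with hE
  have dE : ∀ t, HasDerivAt E (E t * -κ t) t := fun t =>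
    ((intervalIntegral.integral_hasDerivAt_right (cκ.intervalIntegrable _ _)
      (cκ.stronglyMeasurableAtFilter _ _) cκ.continuousAt).neg).exp
  set D : ℝ → ℝ := fun t => (θ₂ t - θ₁ t) * E t with hD
  set b : ℝ → ℝ := fun t => (d₂ t - w t * (cos (θ₂ t) ^ 2 + Q t * sin (θ₂ t) ^ 2)) -
    (d₁ t - w t * (cos (θ₁ t) ^ 2 + Q t * sin (θ₁ t) ^ 2)) with hb
  have dD : ∀ t, HasDerivAt D (b t * E t) t := by
    intro t
    refine (((h₂ t).sub (h₁ t)).mul (dE t)).congr_deriv ?_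
    have h3 := sin_sq_sub_sin_sq_eq_sinc (θ₂ t) (θ₁ t)
    simp only [hb, hκ, Pi.sub_apply, cos_sq']
    linear_combination (E t * w t * (Q t - 1)) * h3
  have mono : MonotoneOn D (Icc t₀ X) := by
    refine monotoneOn_of_deriv_nonneg (convex_Icc _ _)
      (fun t _ => (dD t).continuousAt.continuousWithinAt)
      (fun t _ => (dD t).differentiableAt.differentiableWithinAt) fun t ht => ?_
    rw [interior_Icc] at ht
    rw [(dD t).deriv]
    exact mul_nonneg (by simpa [hb] using hd t ht) (exp_pos _).le
  have hD0 : 0 ≤ D t₀ := mul_nonneg (by linarith) (exp_pos _).le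
  have hDX := mono (left_mem_Icc.2 hX) (right_mem_Icc.2 hX) hX
  refine ⟨?_, fun heq t ht => ?_⟩
  · have : 0 ≤ D X := hD0.trans hDX
    have := nonneg_of_mul_nonneg_left this (exp_pos _)
    linarith
  · have hz : D X = 0 := by simp [hD, heq]
    have hz' : ∀ r ∈ Ioo t₀ X, D r = 0 := by
      intro r hr
      have h1 := mono (left_mem_Icc.2 hX) (Ioo_subset_Icc_self hr) hr.1.le
      have h2 := mono (Ioo_subset_Icc_self hr) (right_mem_Icc.2 hX) hr.2.le
      linarith
    have hev : D =ᶠ[nhds t] fun _ => 0 := by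
      filter_upwards [Ioo_mem_nhds ht.1 ht.2] with r hr using hz' r hr
    have hbt : b t * E t = 0 := (dD t).unique ((hasDerivAt_const t (0 : ℝ)).congr_of_eventuallyEq hev)
    have hEt : E t ≠ 0 := (exp_pos _).ne'
    have hbt' : b t = 0 := by simpa [hEt] using hbt
    have hDt : (θ₂ t - θ₁ t) * E t = 0 := hz' t ht
    have hDt' : θ₂ t - θ₁ t = 0 := by simpa [hEt] using hDt
    constructor <;> [skip; linarith]
    simp only [hb] at hbt'
    linarith

namespace IsPruferAngle

variable {w Q θ θ' : ℝ → ℝ}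

theorem continuous (h : IsPruferAngle w Q θ) : Continuous θ :=
  continuous_iff_continuousAt.2 fun t => (h t).continuousAt

theorem lipschitz {M N : ℝ} (hM : ∀ t, |w t| ≤ M) (hN : ∀ t, |Q t| ≤ N) (t : ℝ) :
    LipschitzWith (M * (1 + N) * 2).toNNReal fun x => w t * (cos x ^ 2 + Q t * sin x ^ 2) := by
  have hM0 : 0 ≤ M := (abs_nonneg _).trans (hM 0)
  have hN0 : 0 ≤ N := (abs_nonneg _).trans (hN 0)
  refine LipschitzWith.of_dist_le_mul fun x y => ?_
  rw [coe_toNNReal _ (by positivity), dist_eq, dist_eq]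
  have h1 : w t * (cos x ^ 2 + Q t * sin x ^ 2) - w t * (cos y ^ 2 + Q t * sin y ^ 2) =
      (w t * (Q t - 1)) * ((x - y) * (sinc (x - y) * sin (x + y))) := by
    rw [← sin_sq_sub_sin_sq_eq_sinc, cos_sq', cos_sq']; ring
  rw [h1, abs_mul, abs_mul, abs_mul, abs_mul]
  have h2 : |Q t - 1| ≤ 1 + N := (abs_sub _ _).trans (by simpa [add_comm] using hN t)
  have h3 : |sinc (x - y)| * |sin (x + y)| ≤ 1 * 1 :=
    mul_le_mul (abs_sinc_le_one _) (abs_sin_le_one _) (abs_nonneg _) zero_le_one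
  calc _ ≤ (M * (1 + N)) * (|x - y| * (1 * 1)) := by
        gcongr
        exact hM t
    _ ≤ _ := by nlinarith [abs_nonneg (x - y), mul_nonneg hM0 (add_nonneg zero_le_one hN0),
                  mul_nonneg (mul_nonneg hM0 (add_nonneg zero_le_one hN0)) (abs_nonneg (x - y))]

theorem exists_eq (hw : Continuous w) (hQ : Continuous Q) {M N : ℝ} (hM : ∀ t, |w t| ≤ M)
    (hN : ∀ t, |Q t| ≤ N) (x₀ : ℝ) : ∃ θ, θ 0 = x₀ ∧ IsPruferAngle w Q θ := by
  have hM0 : 0 ≤ M := (abs_nonneg _).trans (hM 0)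
  have hN0 : 0 ≤ N := (abs_nonneg _).trans (hN 0)
  refine exists_forall_hasDerivAt_of_lipschitz (L := (M * (1 + N)).toNNReal) (lipschitz hM hN)
    (fun x => by fun_prop) (fun t x => ?_) x₀
  rw [coe_toNNReal _ (by positivity), abs_mul]
  have h2 : |cos x ^ 2 + Q t * sin x ^ 2| ≤ 1 + N := by
    refine (abs_add_le _ _).trans (add_le_add ?_ ?_)
    · rw [abs_of_nonneg (sq_nonneg _)]; exact cos_sq_le_one x
    · rw [abs_mul, abs_of_nonneg (sq_nonneg (sin x))]
      calc |Q t| * sin x ^ 2 ≤ N * 1 := by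
            gcongr
            · exact hN t
            · exact sin_sq_le_one x
        _ = N := mul_one N
  gcongr
  exact hM t

/-- The constant 0 is a strict subsolution: where sin θ = 0 the angle moves with speed w > 0. -/
theorem pos (hw : Continuous w) (hw0 : ∀ t, 0 < w t) (hQ : Continuous Q)
    (h : IsPruferAngle w Q θ) (h0 : 0 ≤ θ 0) {X : ℝ} (hX : 0 < X) : 0 < θ X := by
  have key := prufer_comparison (θ₁ := fun _ => 0) (d₁ := fun _ => 0) hw hQ
    (fun t => hasDerivAt_const t 0) h hX.le h0 (fun t _ => by simp [(hw0 t).le])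
  refine lt_of_le_of_ne key.1 fun heq => ?_
  have := (key.2 heq (X / 2) ⟨by linarith, by linarith⟩).1
  simp [(hw0 _).ne'] at this

theorem le_of_le (hw : Continuous w) (hQ : Continuous Q)
    (h : IsPruferAngle w Q θ) (h' : IsPruferAngle w Q θ') (h0 : θ 0 ≤ θ' 0) {X : ℝ} (hX : 0 ≤ X) :
    θ X ≤ θ' X :=
  (prufer_comparison hw hQ h h' hX h0 (fun t _ => by simp)).1

/-- Strict Sturm comparison. Relative to Q the angle θ' has the defect w (Q' - Q) sin² θ' ≥ 0.
Equality at X would force sin θ = 0 on an interval, but at such points θ has the nonzero derivative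
w. -/
theorem lt_of_lt {Q' : ℝ → ℝ} (hw : Continuous w) (hw0 : ∀ t, 0 < w t) (hQ : Continuous Q)
    (h : IsPruferAngle w Q θ) (h' : IsPruferAngle w Q' θ') (hQQ' : ∀ t, Q t < Q' t)
    (h0 : θ 0 ≤ θ' 0) {X : ℝ} (hX : 0 < X) : θ X < θ' X := by
  have key := prufer_comparison hw hQ h h' hX.le h0 (fun t _ => by
    nlinarith [mul_nonneg (hw0 t).le (mul_nonneg (sub_nonneg.2 (hQQ' t).le)
      (sq_nonneg (sin (θ' t))))])
  refine lt_of_le_of_ne key.1 fun heq => ?_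
  have hs : ∀ t ∈ Ioo 0 X, sin (θ t) = 0 := by
    intro t ht
    obtain ⟨h1, h2⟩ := key.2 heq t ht
    rw [← h2] at h1
    have h3 : w t * ((Q' t - Q t) * sin (θ t) ^ 2) = 0 := by linarith
    simpa [(hw0 t).ne', (sub_pos.2 (hQQ' t)).ne'] using h3
  have hev : (fun t => sin (θ t)) =ᶠ[nhds (X / 2)] fun _ => 0 := by
    filter_upwards [Ioo_mem_nhds (show 0 < X / 2 by linarith) (show X / 2 < X by linarith)]
      with r hr using hs r hr
  have h4 := ((h (X / 2)).sin).unique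
    ((hasDerivAt_const (X / 2) (0 : ℝ)).congr_of_eventuallyEq hev)
  have h5 := hs (X / 2) ⟨by linarith, by linarith⟩
  have h6 : cos (θ (X / 2)) ≠ 0 := by
    intro h7
    have := sin_sq_add_cos_sq (θ (X / 2))
    rw [h5, h7] at this
    norm_num at this
  simp [h5, h6, (hw0 _).ne'] at h4

/-- For negative Q the constant π/2 is a strict supersolution, the speed there being w Q < 0. -/
theorem lt_pi_div_two (hw : Continuous w) (hw0 : ∀ t, 0 < w t) (hQ : Continuous Q)
    (hQneg : ∀ t, Q t < 0) (h : IsPruferAngle w Q θ) (h0 : θ 0 ≤ π / 2) {X : ℝ} (hX : 0 < X) :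
    θ X < π / 2 := by
  have key := prufer_comparison (θ₂ := fun _ => π / 2) (d₂ := fun _ => 0) hw hQ h
    (fun t => hasDerivAt_const t _) hX.le h0
    (fun t _ => by
      simp only [sub_self, cos_pi_div_two, sin_pi_div_two]
      nlinarith [hw0 t, hQneg t])
  refine lt_of_le_of_ne key.1 fun heq => ?_
  have := (key.2 heq (X / 2) ⟨by linarith, by linarith⟩).1
  simp [(hw0 _).ne', (hQneg _).ne] at this

/-- The solution of the Sturm-Liouville system belonging to a Prüfer angle. -/
theorem exists_solution (hw : Continuous w) (hQ : Continuous Q) (h : IsPruferAngle w Q θ) :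
    ∃ R : ℝ → ℝ, R 0 = 1 ∧ (∀ t, 0 < R t) ∧
      IsSLSolution w Q (fun t => R t * sin (θ t)) (fun t => R t * cos (θ t)) := by
  have hθ := h.continuous
  -- κ is the logarithmic derivative that the radius must have for R (sin θ, cos θ) to solve the
  -- system.
  set κ : ℝ → ℝ := fun t => w t * (1 - Q t) * (sin (θ t) * cos (θ t)) with hκ
  have cκ : Continuous κ := by fun_prop
  have dR : ∀ t, HasDerivAt (fun t => exp (∫ r in (0 : ℝ)..t, κ r))
      (exp (∫ r in (0 : ℝ)..t, κ r) * κ t) t := fun t =>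
    (intervalIntegral.integral_hasDerivAt_right (cκ.intervalIntegrable _ _)
      (cκ.stronglyMeasurableAtFilter _ _) cκ.continuousAt).exp
  refine ⟨fun t => exp (∫ r in (0 : ℝ)..t, κ r), by simp, fun t => exp_pos _, fun t => ?_,
    fun t => ?_⟩
  · refine ((dR t).mul ((h t).sin)).congr_deriv ?_
    simp only [hκ]
    linear_combination (w t * exp (∫ r in (0 : ℝ)..t, κ r) * cos (θ t)) *
      (sin_sq_add_cos_sq (θ t))
  · refine ((dR t).mul ((h t).cos)).congr_deriv ?_
    simp only [hκ]
    linear_combination (-w t * Q t * exp (∫ r in (0 : ℝ)..t, κ r) * sin (θ t)) *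
      (sin_sq_add_cos_sq (θ t))

end IsPruferAngle

/-! ### Solutions of the Sturm-Liouville system: symmetries, uniqueness, smoothness. -/

namespace IsSLSolution

variable {w Q h k h' k' : ℝ → ℝ}

theorem continuous_fst (H : IsSLSolution w Q h k) : Continuous h :=
  continuous_iff_continuousAt.2 fun t => (H.deriv_fst t).continuousAt

theorem continuous_snd (H : IsSLSolution w Q h k) : Continuous k :=
  continuous_iff_continuousAt.2 fun t => (H.deriv_snd t).continuousAt

theorem const_mul (H : IsSLSolution w Q h k) (c : ℝ) :
    IsSLSolution w Q (fun t => c * h t) (fun t => c * k t) where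
  deriv_fst t := ((H.deriv_fst t).const_mul c).congr_deriv (by ring)
  deriv_snd t := ((H.deriv_snd t).const_mul c).congr_deriv (by ring)

theorem sub (H : IsSLSolution w Q h k) (H' : IsSLSolution w Q h' k') :
    IsSLSolution w Q (fun t => h t - h' t) (fun t => k t - k' t) where
  deriv_fst t := ((H.deriv_fst t).sub (H'.deriv_fst t)).congr_deriv (by ring)
  deriv_snd t := ((H.deriv_snd t).sub (H'.deriv_snd t)).congr_deriv (by ring)

theorem reflect (H : IsSLSolution w Q h k) {c : ℝ} (hw : ∀ t, w (c - t) = w t)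
    (hQ : ∀ t, Q (c - t) = Q t) : IsSLSolution w Q (fun t => h (c - t)) (fun t => -k (c - t)) where
  deriv_fst t := ((H.deriv_fst (c - t)).comp_const_sub c t).congr_deriv (by rw [hw]; ring)
  deriv_snd t := ((H.deriv_snd (c - t)).comp_const_sub c t).neg.congr_deriv (by rw [hw, hQ]; ring)

/-- The function e = h² + k² satisfies |e'| ≤ |w (1 - Q)| e. Multiplied by the exponential of the
matching integral it is monotone on each side of `t₀`, so it cannot leave 0. -/
theorem eq_zero_of_eq_zero (hw : Continuous w) (hQ : Continuous Q) (H : IsSLSolution w Q h k)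
    {t₀ : ℝ} (h0 : h t₀ = 0) (k0 : k t₀ = 0) (t : ℝ) : h t = 0 ∧ k t = 0 := by
  set a : ℝ → ℝ := fun t => |w t * (1 - Q t)| with ha
  have ca : Continuous a := by fun_prop
  set e : ℝ → ℝ := fun t => h t ^ 2 + k t ^ 2 with he
  have de : ∀ t, HasDerivAt e (2 * (w t * (1 - Q t)) * (h t * k t)) t := fun t =>
    (((H.deriv_fst t).pow 2).add ((H.deriv_snd t).pow 2)).congr_deriv (by ring)
  have dA : ∀ t, HasDerivAt (fun t => ∫ r in t₀..t, a r) (a t) t := fun t =>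
    intervalIntegral.integral_hasDerivAt_right (ca.intervalIntegrable _ _)
      (ca.stronglyMeasurableAtFilter _ _) ca.continuousAt
  have bound : ∀ t, |2 * (w t * (1 - Q t)) * (h t * k t)| ≤ a t * e t := by
    intro t
    have h1 : |2 * (w t * (1 - Q t)) * (h t * k t)| = a t * |2 * (h t * k t)| := by
      simp only [ha, abs_mul]; ring
    rw [h1]
    refine mul_le_mul_of_nonneg_left (abs_le.2 ⟨?_, ?_⟩) (abs_nonneg _)
    · simp only [he]; nlinarith [sq_nonneg (h t + k t)]
    · simp only [he]; nlinarith [sq_nonneg (h t - k t)]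
  have e0 : e t₀ = 0 := by simp [he, h0, k0]
  have hle : e t ≤ 0 := by
    rcases le_total t₀ t with ht | ht
    · have anti : Antitone fun t => e t * exp (-∫ r in t₀..t, a r) := by
        refine antitone_of_hasDerivAt_nonpos (fun t => (de t).mul (dA t).neg.exp) fun t => ?_
        have := (abs_le.1 (bound t)).2
        have hE := exp_pos (-∫ r in t₀..t, a r)
        change _ + e t * (exp (-∫ r in t₀..t, a r) * -a t) ≤ (0 : ℝ)
        nlinarith
      have := anti ht
      simp only [e0, zero_mul] at this
      exact nonpos_of_mul_nonpos_left this (exp_pos _)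
    · have mono : Monotone fun t => e t * exp (∫ r in t₀..t, a r) := by
        refine monotone_of_hasDerivAt_nonneg (fun t => (de t).mul (dA t).exp) fun t => ?_
        have := (abs_le.1 (bound t)).1
        have hE := exp_pos (∫ r in t₀..t, a r)
        show (0 : ℝ) ≤ _
        nlinarith
      have := mono ht
      simp only [e0, zero_mul] at this
      exact nonpos_of_mul_nonpos_left this (exp_pos _)
  simp only [he] at hle
  constructor <;> nlinarith [sq_nonneg (h t), sq_nonneg (k t)]

theorem eq_of_eq (hw : Continuous w) (hQ : Continuous Q) (H : IsSLSolution w Q h k)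
    (H' : IsSLSolution w Q h' k') {t₀ : ℝ} (h0 : h t₀ = h' t₀) (k0 : k t₀ = k' t₀) (t : ℝ) :
    h t = h' t ∧ k t = k' t := by
  have := (H.sub H').eq_zero_of_eq_zero hw hQ (t₀ := t₀) (by simp [h0]) (by simp [k0]) t
  exact ⟨sub_eq_zero.1 this.1, sub_eq_zero.1 this.2⟩

theorem contDiff (hw : ContDiff ℝ ∞ w) (hQ : ContDiff ℝ ∞ Q) (H : IsSLSolution w Q h k) :
    ContDiff ℝ ∞ h ∧ ContDiff ℝ ∞ k := by
  have key : ∀ n : ℕ, ContDiff ℝ n h ∧ ContDiff ℝ n k := by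
    intro n
    induction n with
    | zero => exact ⟨contDiff_zero.2 H.continuous_fst, contDiff_zero.2 H.continuous_snd⟩
    | succ n ih =>
      have hw' : ContDiff ℝ n w := hw.of_le (by exact_mod_cast le_top)
      have hQ' : ContDiff ℝ n Q := hQ.of_le (by exact_mod_cast le_top)
      have d1 : deriv h = fun t => w t * k t := funext fun t => (H.deriv_fst t).deriv
      have d2 : deriv k = fun t => -(w t * Q t * h t) := funext fun t => (H.deriv_snd t).deriv
      refine ⟨?_, ?_⟩
      · push_cast
        refine contDiff_succ_iff_deriv.2 ⟨fun t => (H.deriv_fst t).differentiableAt, by simp, ?_⟩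
        rw [d1]; exact hw'.mul ih.2
      · push_cast
        refine contDiff_succ_iff_deriv.2 ⟨fun t => (H.deriv_snd t).differentiableAt, by simp, ?_⟩
        rw [d2]; exact ((hw'.mul hQ').mul ih.1).neg
  exact ⟨contDiff_infty.2 fun n => (key n).1, contDiff_infty.2 fun n => (key n).2⟩

end IsSLSolution

/-! ### Counting the eigenvalues of a symmetric Sturm-Liouville problem. -/

/-- Coefficients of a Sturm-Liouville problem `(h' / w)' = w (l - μ ρ) h` that are symmetric about
`0` and about `X`. -/
structure IsSLWeight (w ρ : ℝ → ℝ) (X : ℝ) : Prop where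
  contDiff_w : ContDiff ℝ ∞ w
  contDiff_rho : ContDiff ℝ ∞ ρ
  w_pos : ∀ t, 0 < w t
  rho_pos : ∀ t, 0 < ρ t
  rho_le : ∀ t, ρ t ≤ 1
  w_bdd : ∃ M, ∀ t, w t ≤ M
  w_even : ∀ t, w (-t) = w t
  rho_even : ∀ t, ρ (-t) = ρ t
  w_per : ∀ t, w (t + 2 * X) = w t
  rho_per : ∀ t, ρ (t + 2 * X) = ρ t
  X_pos : 0 < X

/-- Eigenfunctions with parity `η` and multiplier `δ` under the translation by `2 X`. -/
structure IsSLEigenfunction (w ρ : ℝ → ℝ) (X l η δ μ : ℝ) (h : ℝ → ℝ) : Prop where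
  solution : ∃ k, IsSLSolution w (fun t => μ * ρ t - l) h k
  parity : ∀ t, h (-t) = η * h t
  multiplier : ∀ t, h (t + 2 * X) = δ * h t

/-- The difference starts at 0; if its absolute value reached π, at some point it would equal π. The
two directions would then be opposite, which the sign conditions exclude. -/
theorem abs_sub_lt_pi_of_not_opposite {θ ψ : ℝ → ℝ} (hθ : Continuous θ) (hψ : Continuous ψ)
    (h0 : θ 0 = ψ 0) (h1 : ∀ t, 0 ≤ sin (θ t) * sin (ψ t))
    (h2 : ∀ t, sin (ψ t) = 0 → 0 < cos (θ t) * cos (ψ t)) (t : ℝ) : |θ t - ψ t| < π := by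
  by_contra! hc
  have hcont : Continuous fun r => |θ r - ψ r| := by fun_prop
  obtain ⟨r, hr⟩ : ∃ r, |θ r - ψ r| = π := by
    have := mem_range_of_exists_le_of_exists_ge hcont (c := π)
      ⟨0, by simp [h0, pi_pos.le]⟩ ⟨t, hc⟩
    exact this
  have hs : sin (θ r) = -sin (ψ r) ∧ cos (θ r) = -cos (ψ r) := by
    rcases (abs_eq pi_pos.le).1 hr with h | h
    · have : θ r = ψ r + π := by linarith
      rw [this, sin_add_pi, cos_add_pi]; exact ⟨rfl, rfl⟩
    · have : θ r = ψ r - π := by linarith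
      rw [this, sin_sub_pi, cos_sub_pi]; exact ⟨rfl, rfl⟩
  have h3 := h1 r
  rw [hs.1] at h3
  have h4 : sin (ψ r) = 0 := by nlinarith [sq_nonneg (sin (ψ r))]
  have h5 := h2 r h4
  rw [hs.2] at h5
  nlinarith [sq_nonneg (cos (ψ r))]

/-- A ratio h : k determines an angle only modulo π. This removes the ambiguity, so that an explicit
solution yields the exact Prüfer angle at an end point. -/
theorem eq_of_not_opposite {θ ψ : ℝ → ℝ} (hθ : Continuous θ) (hψ : Continuous ψ)
    (h0 : θ 0 = ψ 0) (h1 : ∀ t, 0 ≤ sin (θ t) * sin (ψ t))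
    (h2 : ∀ t, sin (ψ t) = 0 → 0 < cos (θ t) * cos (ψ t)) {t : ℝ} (ht : sin (θ t - ψ t) = 0) :
    θ t = ψ t := by
  have h3 := abs_lt.1 (abs_sub_lt_pi_of_not_opposite hθ hψ h0 h1 h2 t)
  exact sub_eq_zero.1 ((sin_eq_zero_iff_of_lt_of_lt h3.1 h3.2).1 ht)

theorem linearIndependent_of_integral_mul {n : ℕ} {W : ℝ → ℝ} {h : Fin n → ℝ → ℝ} {X : ℝ}
    (hW : Continuous W) (hc : ∀ i, Continuous (h i))
    (horth : ∀ i j, i ≠ j → ∫ t in (0 : ℝ)..X, W t * (h i t * h j t) = 0)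
    (hpos : ∀ i, ∫ t in (0 : ℝ)..X, W t * (h i t * h i t) ≠ 0) : LinearIndependent ℝ h := by
  rw [Fintype.linearIndependent_iff]
  intro g hg j
  have h1 : ∫ t in (0 : ℝ)..X, ∑ i, g i * (W t * (h i t * h j t)) = 0 := by
    have : ∀ t, ∑ i, g i * (W t * (h i t * h j t)) = 0 := by
      intro t
      have h2 := congrFun hg t
      simp only [Finset.sum_apply, Pi.smul_apply, smul_eq_mul, Pi.zero_apply] at h2
      calc _ = (∑ i, g i * h i t) * (W t * h j t) := by
            rw [Finset.sum_mul]; exact Finset.sum_congr rfl fun i _ => by ring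
        _ = 0 := by rw [h2, zero_mul]
    simp [this]
  rw [intervalIntegral.integral_finsetSum (fun i _ => by
    have := hc i; have := hc j
    exact Continuous.intervalIntegrable (by fun_prop) _ _)] at h1
  rw [Finset.sum_eq_single j (fun i _ hij => by
    rw [intervalIntegral.integral_const_mul, horth i j hij, mul_zero]) (by simp),
    intervalIntegral.integral_const_mul] at h1
  exact (mul_eq_zero.1 h1).resolve_right (hpos j)

namespace IsSLWeight

variable {w ρ : ℝ → ℝ} {X l : ℝ}

theorem continuous_w (D : IsSLWeight w ρ X) : Continuous w := D.contDiff_w.continuous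

theorem continuous_rho (D : IsSLWeight w ρ X) : Continuous ρ := D.contDiff_rho.continuous

theorem continuous_potential (D : IsSLWeight w ρ X) (μ l : ℝ) :
    Continuous fun t => μ * ρ t - l := by
  have := D.continuous_rho
  fun_prop

theorem w_reflect (D : IsSLWeight w ρ X) (t : ℝ) : w (2 * X - t) = w t := by
  rw [show 2 * X - t = -t + 2 * X by ring, D.w_per, D.w_even]

theorem rho_reflect (D : IsSLWeight w ρ X) (t : ℝ) : ρ (2 * X - t) = ρ t := by
  rw [show 2 * X - t = -t + 2 * X by ring, D.rho_per, D.rho_even]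

theorem abs_potential_le (D : IsSLWeight w ρ X) (μ l t : ℝ) : |μ * ρ t - l| ≤ |μ| + |l| := by
  refine (abs_sub _ _).trans (add_le_add_left ?_ _)
  rw [abs_mul, abs_of_pos (D.rho_pos t)]
  exact mul_le_of_le_one_right (abs_nonneg _) (D.rho_le t)

theorem exists_angle (D : IsSLWeight w ρ X) (l s μ : ℝ) :
    ∃ θ, θ 0 = s ∧ IsPruferAngle w (fun t => μ * ρ t - l) θ := by
  obtain ⟨M, hM⟩ := D.w_bdd
  exact IsPruferAngle.exists_eq D.continuous_w (D.continuous_potential μ l)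
    (fun t => by rw [abs_of_pos (D.w_pos t)]; exact hM t) (D.abs_potential_le μ l) s

-- Since 0 < ρ ≤ 1 and w ≤ M, the angle for μ solves the equation for μ₀ up to an error M |μ - μ₀|,
-- and Gronwall's inequality applies.
open Filter Topology in
theorem continuous_angle (D : IsSLWeight w ρ X) {s : ℝ} {θ : ℝ → ℝ → ℝ}
    (h0 : ∀ μ, θ μ 0 = s) (hθ : ∀ μ, IsPruferAngle w (fun t => μ * ρ t - l) (θ μ)) :
    Continuous fun μ => θ μ X := by
  obtain ⟨M, hM⟩ := D.w_bdd
  have hM0 : 0 ≤ M := (D.w_pos 0).le.trans (hM 0)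
  rw [continuous_iff_continuousAt]
  intro μ₀
  set N := |μ₀| + |l|
  have hlip := IsPruferAngle.lipschitz (w := w) (Q := fun t => μ₀ * ρ t - l) (M := M) (N := N)
    (fun t => by rw [abs_of_pos (D.w_pos t)]; exact hM t) (D.abs_potential_le μ₀ l)
  set K := (M * (1 + N) * 2).toNNReal
  have key : ∀ μ, dist (θ μ X) (θ μ₀ X) ≤ gronwallBound 0 K (M * |μ - μ₀| + 0) (X - 0) := by
    intro μ
    refine dist_le_of_approx_trajectories_ODE
      (v := fun t x => w t * (cos x ^ 2 + (μ₀ * ρ t - l) * sin x ^ 2)) hlip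
      (hθ μ).continuous.continuousOn (fun t _ => (hθ μ t).hasDerivWithinAt) ?_
      (hθ μ₀).continuous.continuousOn (fun t _ => (hθ μ₀ t).hasDerivWithinAt) ?_ ?_ X
      ⟨D.X_pos.le, le_rfl⟩
    · intro t _
      rw [dist_eq, show w t * (cos (θ μ t) ^ 2 + (μ * ρ t - l) * sin (θ μ t) ^ 2) -
        w t * (cos (θ μ t) ^ 2 + (μ₀ * ρ t - l) * sin (θ μ t) ^ 2) =
        w t * ((μ - μ₀) * (ρ t * sin (θ μ t) ^ 2)) by ring, abs_mul, abs_mul,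
        abs_of_pos (D.w_pos t), abs_of_nonneg (mul_nonneg (D.rho_pos t).le (sq_nonneg _))]
      have h1 : ρ t * sin (θ μ t) ^ 2 ≤ 1 * 1 :=
        mul_le_mul (D.rho_le t) (sin_sq_le_one _) (sq_nonneg _) zero_le_one
      calc _ ≤ M * (|μ - μ₀| * (1 * 1)) := by
            have := hM t
            have := mul_nonneg (D.rho_pos t).le (sq_nonneg (sin (θ μ t)))
            gcongr
        _ = _ := by ring
    · intro t _; simp
    · simp [h0]
  rw [ContinuousAt, tendsto_iff_dist_tendsto_zero]
  refine squeeze_zero (fun _ => dist_nonneg) key ?_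
  have hc : Continuous fun μ => gronwallBound 0 K (M * |μ - μ₀| + 0) (X - 0) :=
    (gronwallBound_continuous_ε 0 K (X - 0)).comp (by fun_prop)
  have := hc.tendsto μ₀
  simpa [gronwallBound_ε0] using this

theorem angle_strictMono (D : IsSLWeight w ρ X) {s : ℝ} {θ : ℝ → ℝ → ℝ}
    (h0 : ∀ μ, θ μ 0 = s) (hθ : ∀ μ, IsPruferAngle w (fun t => μ * ρ t - l) (θ μ)) :
    StrictMono fun μ => θ μ X := fun μ ν hμν =>
  (hθ μ).lt_of_lt D.continuous_w D.w_pos (D.continuous_potential μ l) (hθ ν)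
    (fun t => by have := mul_lt_mul_of_pos_right hμν (D.rho_pos t); linarith)
    (by rw [h0, h0]) D.X_pos

/-- The eigenfunction of a Prüfer angle which takes the right values at the end points. -/
theorem eigenfunction_of_angle (D : IsSLWeight w ρ X) {s e η η' μ : ℝ} {θ : ℝ → ℝ}
    (hs : s = 0 ∧ η = -1 ∨ s = π / 2 ∧ η = 1) (he : e = π ∧ η' = -1 ∨ e = π / 2 ∧ η' = 1)
    (h0 : θ 0 = s) {i : ℕ}
    (hX : θ X = e + i * π) {R : ℝ → ℝ} (R0 : R 0 = 1)
    (H : IsSLSolution w (fun t => μ * ρ t - l) (fun t => R t * sin (θ t))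
      (fun t => R t * cos (θ t))) :
    IsSLEigenfunction w ρ X l η (η * η') μ fun t => R t * sin (θ t) := by
  -- The reflection about 0 is again a solution, and its data at 0 are η times the original ones.
  -- The same at X gives η', and the two reflections compose to the translation by 2X, whence the
  -- multiplier η η'.
  have even : ∀ t, R (-t) * sin (θ (-t)) = η * (R t * sin (θ t)) := by
    intro t
    have H' := H.reflect (c := 0) (by simpa using D.w_even)
      (by intro t; simp [D.rho_even])
    have := (H'.eq_of_eq D.continuous_w (D.continuous_potential μ l) (H.const_mul η) (t₀ := 0)
      (by rcases hs with ⟨rfl, rfl⟩ | ⟨rfl, rfl⟩ <;> simp [h0])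
      (by rcases hs with ⟨rfl, rfl⟩ | ⟨rfl, rfl⟩ <;> simp [h0, R0]) t).1
    simpa using this
  have refl : ∀ t, R (2 * X - t) * sin (θ (2 * X - t)) = η' * (R t * sin (θ t)) := by
    intro t
    have H' := H.reflect (c := 2 * X) D.w_reflect (by intro t; simp [D.rho_reflect])
    refine (H'.eq_of_eq D.continuous_w (D.continuous_potential μ l) (H.const_mul η') (t₀ := X)
      ?_ ?_ t).1 <;> simp only [show 2 * X - X = X by ring, hX] <;>
      rcases he with ⟨rfl, rfl⟩ | ⟨rfl, rfl⟩ <;>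
      simp [sin_add, cos_add, sin_nat_mul_pi]
  refine ⟨⟨_, H⟩, even, fun t => ?_⟩
  have := refl (-t)
  rw [even, show 2 * X - -t = t + 2 * X by ring] at this
  simp only [this]
  ring

/-- Initial values of an eigenfunction. -/
theorem _root_.IsSLEigenfunction.boundary (D : IsSLWeight w ρ X) {s e η η' μ : ℝ} {h k : ℝ → ℝ}
    (hs : s = 0 ∧ η = -1 ∨ s = π / 2 ∧ η = 1) (he : e = π ∧ η' = -1 ∨ e = π / 2 ∧ η' = 1)
    (E : IsSLEigenfunction w ρ X l η (η * η') μ h)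
    (H : IsSLSolution w (fun t => μ * ρ t - l) h k) :
    h 0 * cos s = k 0 * sin s ∧ h X * cos e = k X * sin e := by
  -- The relation h cos s = k sin s covers both boundary conditions: it reads h = 0 for s = 0 (η =
  -- -1) and k = 0 for s = π/2 (η = 1); likewise at X with e = π or π/2.
  have hη : η * η = 1 := by rcases hs with ⟨-, rfl⟩ | ⟨-, rfl⟩ <;> norm_num
  have refl : ∀ t, h (2 * X - t) = η' * h t := by
    intro t
    rw [show 2 * X - t = -t + 2 * X by ring, E.multiplier, E.parity]
    linear_combination (η' * h t) * hη
  have k0 : -(w 0 * k 0) = η * (w 0 * k 0) := by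
    have h1 : HasDerivAt (fun t => h (0 - t)) (-(w 0 * k 0)) 0 := by
      have := (H.deriv_fst (0 - 0)).comp_const_sub 0 0
      simpa using this
    have h2 : HasDerivAt (fun t => h (0 - t)) (η * (w 0 * k 0)) 0 := by
      have h3 : (fun t => h (0 - t)) = fun t => η * h t := funext fun t => by
        rw [zero_sub, E.parity]
      rw [h3]
      exact (H.deriv_fst 0).const_mul η
    exact h1.unique h2
  have kX : -(w X * k X) = η' * (w X * k X) := by
    have h1 : HasDerivAt (fun t => h (2 * X - t)) (-(w X * k X)) X := by
      have := (H.deriv_fst (2 * X - X)).comp_const_sub (2 * X) X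
      simpa [show 2 * X - X = X by ring] using this
    have h2 : HasDerivAt (fun t => h (2 * X - t)) (η' * (w X * k X)) X := by
      rw [funext refl]
      exact (H.deriv_fst X).const_mul η'
    exact h1.unique h2
  have h0 := E.parity 0
  have hX := refl X
  rw [show 2 * X - X = X by ring] at hX
  rw [neg_zero] at h0
  have w0 := (D.w_pos 0).ne'
  have wX := (D.w_pos X).ne'
  constructor
  · rcases hs with ⟨rfl, rfl⟩ | ⟨rfl, rfl⟩
    · simp; linarith
    · simp
      have : w 0 * k 0 = 0 := by linarith
      simpa [w0, eq_comm] using this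
  · rcases he with ⟨rfl, rfl⟩ | ⟨rfl, rfl⟩
    · simp; linarith
    · simp
      have : w X * k X = 0 := by linarith
      simpa [wX, eq_comm] using this

/-- An eigenvalue is a μ for which the angle at X takes a value e + iπ, i ≥ 0. The angle at X
depends continuously on μ and is below π/2 ≤ e for μ = -1, so each such level up to Θ X is attained
in [-1, M]. Eigenfunctions of different eigenvalues are orthogonal with weight w ρ. -/
theorem exists_linearIndependent (D : IsSLWeight w ρ X) {s e η η' : ℝ}
    (hs : s = 0 ∧ η = -1 ∨ s = π / 2 ∧ η = 1) (he : e = π ∧ η' = -1 ∨ e = π / 2 ∧ η' = 1)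
    (hl : 0 ≤ l) {M : ℝ} (hM : -1 < M) {Θ : ℝ → ℝ} (hΘ0 : Θ 0 = s)
    (hΘ : IsPruferAngle w (fun t => M * ρ t - l) Θ)
    {n : ℕ} (hn : e + n * π ≤ Θ X + π) :
    ∃ h : Fin n → ℝ → ℝ, LinearIndependent ℝ h ∧
      ∀ i, ∃ μ ≤ M, IsSLEigenfunction w ρ X l η (η * η') μ (h i) := by
  choose θ h0 hθ using D.exists_angle l s
  have hΘX : Θ X = θ M X := le_antisymm
    (hΘ.le_of_le D.continuous_w (D.continuous_potential M l) (hθ M) (by rw [h0, hΘ0]) D.X_pos.le)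
    ((hθ M).le_of_le D.continuous_w (D.continuous_potential M l) hΘ (by rw [h0, hΘ0]) D.X_pos.le)
  have smono := D.angle_strictMono h0 hθ
  -- For μ = -1 the potential -ρ - l is negative because l ≥ 0.
  have hlow : θ (-1) X < π / 2 := by
    refine (hθ (-1)).lt_pi_div_two D.continuous_w D.w_pos (D.continuous_potential (-1) l)
      (fun t => by have := D.rho_pos t; linarith) ?_ D.X_pos
    rw [h0]
    rcases hs with ⟨rfl, -⟩ | ⟨rfl, -⟩
    · positivity
    · rfl
  have he' : π / 2 ≤ e := by
    rcases he with ⟨rfl, -⟩ | ⟨rfl, -⟩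
    · linarith [pi_pos]
    · rfl
  have hex : ∀ i : Fin n, ∃ μ, μ ≤ M ∧ θ μ X = e + (i : ℕ) * π := by
    intro i
    have hi : ((i : ℕ) : ℝ) + 1 ≤ n := by exact_mod_cast i.2
    have hip : (0 : ℝ) ≤ ((i : ℕ) : ℝ) * π := by positivity
    have := intermediate_value_Icc hM.le (D.continuous_angle h0 hθ).continuousOn
      (show e + (i : ℕ) * π ∈ Icc (θ (-1) X) (θ M X) from
        ⟨by linarith, by rw [← hΘX]; nlinarith [pi_pos]⟩)
    obtain ⟨μ, hμ, h⟩ := this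
    exact ⟨μ, hμ.2, h⟩
  choose μ hμ hμX using hex
  have hμinj : Function.Injective μ := by
    intro i j hij
    have h1 := hμX i
    rw [hij, hμX j] at h1
    have h2 : ((j : ℕ) : ℝ) * π = (i : ℕ) * π := by linarith
    have h3 := mul_right_cancel₀ pi_pos.ne' h2
    exact (Fin.ext (by exact_mod_cast h3)).symm
  choose R R0 Rpos H using fun i =>
    (hθ (μ i)).exists_solution D.continuous_w (D.continuous_potential (μ i) l)
  have E : ∀ i, IsSLEigenfunction w ρ X l η (η * η') (μ i)
      (fun t => R i t * sin (θ (μ i) t)) := fun i =>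
    D.eigenfunction_of_angle hs he (h0 _) (hμX i) (R0 i) (H i)
  refine ⟨fun i t => R i t * sin (θ (μ i) t), ?_, fun i => ⟨μ i, hμ i, E i⟩⟩
  have cw := D.continuous_w
  have cρ := D.continuous_rho
  refine linearIndependent_of_integral_mul (W := fun t => w t * ρ t) (X := X) (by fun_prop)
    (fun i => (H i).continuous_fst) ?_ ?_
  · intro i j hij
    have ci := (H i).continuous_fst
    have cj := (H j).continuous_fst
    -- The Wronskian of two eigenfunctions vanishes at both ends since the boundary conditions
    -- agree. Integrating its derivative gives orthogonality.
    have dW : ∀ t, HasDerivAt (fun t => (R i t * sin (θ (μ i) t)) * (R j t * cos (θ (μ j) t)) -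
        (R j t * sin (θ (μ j) t)) * (R i t * cos (θ (μ i) t)))
        ((μ i - μ j) * (w t * ρ t * ((R i t * sin (θ (μ i) t)) * (R j t * sin (θ (μ j) t))))) t :=
      fun t => ((((H i).deriv_fst t).mul ((H j).deriv_snd t)).sub
        (((H j).deriv_fst t).mul ((H i).deriv_snd t))).congr_deriv (by ring)
    have key := intervalIntegral.integral_eq_sub_of_hasDerivAt (fun t _ => dW t)
      (Continuous.intervalIntegrable (by fun_prop) 0 X)
    rw [intervalIntegral.integral_const_mul] at key
    have hz : ∀ t, (sin (θ (μ i) t)) * (cos (θ (μ j) t)) -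
        (sin (θ (μ j) t)) * (cos (θ (μ i) t)) = 0 →
        (R i t * sin (θ (μ i) t)) * (R j t * cos (θ (μ j) t)) -
        (R j t * sin (θ (μ j) t)) * (R i t * cos (θ (μ i) t)) = 0 := by
      intro t ht
      linear_combination (R i t * R j t) * ht
    rw [hz X, hz 0] at key
    · simpa [sub_eq_zero, hμinj.ne hij] using key
    · rw [h0, h0]; ring
    · rw [hμX, hμX]
      rcases he with ⟨rfl, -⟩ | ⟨rfl, -⟩ <;> simp [sin_add, cos_add, sin_nat_mul_pi]
  · intro i
    have ci := (H i).continuous_fst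
    refine (intervalIntegral.integral_pos D.X_pos (by fun_prop) ?_ ?_).ne'
    · intro t _
      have := D.w_pos t
      have := D.rho_pos t
      exact mul_nonneg (by positivity) (mul_self_nonneg _)
    · by_contra! hc
      have hs0 : ∀ t ∈ Icc 0 X, R i t * sin (θ (μ i) t) = 0 := by
        intro t ht
        have h1 := hc t ht
        have h2 := mul_pos (D.w_pos t) (D.rho_pos t)
        have h3 := mul_self_nonneg (R i t * sin (θ (μ i) t))
        have h4 : (R i t * sin (θ (μ i) t)) * (R i t * sin (θ (μ i) t)) = 0 :=
          le_antisymm (nonpos_of_mul_nonpos_right h1 h2) h3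
        exact mul_self_eq_zero.1 h4
      have hev : (fun t => R i t * sin (θ (μ i) t)) =ᶠ[nhds (X / 2)] fun _ => 0 := by
        have := D.X_pos
        filter_upwards [Icc_mem_nhds (show 0 < X / 2 by linarith) (show X / 2 < X by linarith)]
          with r hr using hs0 r hr
      have h4 := ((H i).deriv_fst (X / 2)).unique
        ((hasDerivAt_const (X / 2) (0 : ℝ)).congr_of_eventuallyEq hev)
      have h5 : R i (X / 2) * sin (θ (μ i) (X / 2)) = 0 := hev.eq_of_nhds
      have h6 := sin_sq_add_cos_sq (θ (μ i) (X / 2))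
      simp only [mul_eq_zero, (D.w_pos _).ne', (Rpos i _).ne', false_or] at h4 h5
      rw [h4, h5] at h6
      norm_num at h6

/-- The boundary condition at 0 makes an eigenfunction a multiple of the Prüfer solution, and the
one at X puts the angle there in e + ℤπ. For μ < M the angle is positive and below Θ X ≤ e + nπ,
which leaves n levels; strict monotonicity in μ allows one eigenvalue per level. -/
theorem exists_spanning (D : IsSLWeight w ρ X) {s e η η' : ℝ}
    (hs : s = 0 ∧ η = -1 ∨ s = π / 2 ∧ η = 1) (he : e = π ∧ η' = -1 ∨ e = π / 2 ∧ η' = 1)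
    {M : ℝ} {Θ : ℝ → ℝ} (hΘ0 : Θ 0 = s)
    (hΘ : IsPruferAngle w (fun t => M * ρ t - l) Θ)
    {n : ℕ} (hn : Θ X ≤ e + n * π) :
    ∃ g : Fin n → ℝ → ℝ, ∀ μ < M, ∀ h, IsSLEigenfunction w ρ X l η (η * η') μ h →
      h ∈ Submodule.span ℝ (range g) := by
  classical
  choose θ h0 hθ using D.exists_angle l s
  have hΘX : Θ X = θ M X := le_antisymm
    (hΘ.le_of_le D.continuous_w (D.continuous_potential M l) (hθ M) (by rw [h0, hΘ0]) D.X_pos.le)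
    ((hθ M).le_of_le D.continuous_w (D.continuous_potential M l) hΘ (by rw [h0, hΘ0]) D.X_pos.le)
  have smono := D.angle_strictMono h0 hθ
  choose R R0 Rpos H using fun μ =>
    (hθ μ).exists_solution D.continuous_w (D.continuous_potential μ l)
  -- A level that no μ attains contributes the zero function.
  refine ⟨fun i => if hi : ∃ μ, θ μ X = e + (i : ℕ) * π then
    fun t => R hi.choose t * sin (θ hi.choose t) else 0, fun μ hμ h E => ?_⟩
  obtain ⟨k, Hk⟩ := E.solution
  obtain ⟨b0, bX⟩ := E.boundary D hs he Hk
  -- The boundary condition at 0 says that (h 0, k 0) = c (sin s, cos s).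
  set c := h 0 * sin s + k 0 * cos s with hc
  have hsc := sin_sq_add_cos_sq s
  have heq : ∀ t, h t = c * (R μ t * sin (θ μ t)) ∧ k t = c * (R μ t * cos (θ μ t)) := by
    intro t
    refine Hk.eq_of_eq D.continuous_w (D.continuous_potential μ l) ((H μ).const_mul c) (t₀ := 0)
      ?_ ?_ t
    · rw [R0, h0, hc]
      linear_combination (-h 0) * hsc + cos s * b0
    · rw [R0, h0, hc]
      linear_combination (-k 0) * hsc - sin s * b0
  rcases eq_or_ne c 0 with hc0 | hc0
  · have : h = 0 := funext fun t => by rw [(heq t).1, hc0, zero_mul]; rfl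
    rw [this]; exact Submodule.zero_mem _
  have hsin : sin (θ μ X - e) = 0 := by
    rw [(heq X).1, (heq X).2] at bX
    have h1 : (c * R μ X) * sin (θ μ X - e) = 0 := by
      rw [sin_sub]; linear_combination bX
    exact (mul_eq_zero.1 h1).resolve_left (mul_ne_zero hc0 (Rpos μ X).ne')
  obtain ⟨j, hj⟩ := sin_eq_zero_iff.1 hsin
  have hpos : 0 < θ μ X := by
    refine (hθ μ).pos D.continuous_w D.w_pos (D.continuous_potential μ l) ?_ D.X_pos
    rw [h0]
    rcases hs with ⟨rfl, -⟩ | ⟨rfl, -⟩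
    · rfl
    · positivity
  have hlt : θ μ X < θ M X := smono hμ
  -- Since e ≤ π, a negative j would make the angle at X nonpositive.
  have hj0 : 0 ≤ j := by
    by_contra! hneg
    have h1 : (j : ℝ) ≤ -1 := by exact_mod_cast (by omega : j ≤ -1)
    have h2 : (j : ℝ) * π ≤ -1 * π := by
      have := pi_pos
      gcongr
    rcases he with ⟨rfl, -⟩ | ⟨rfl, -⟩ <;> linarith [pi_pos]
  obtain ⟨i, rfl⟩ := Int.eq_ofNat_of_zero_le hj0
  simp only [Int.cast_natCast] at hj
  have hin : i < n := by
    have h1 : (i : ℝ) * π < n * π := by linarith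
    exact_mod_cast lt_of_mul_lt_mul_right h1 pi_pos.le
  have hex : ∃ μ, θ μ X = e + (i : ℕ) * π := ⟨μ, by linarith⟩
  have hch : hex.choose = μ := smono.injective (by
    simp only [hex.choose_spec]; linarith)
  have hmem : (fun t => R μ t * sin (θ μ t)) ∈ range fun i : Fin n =>
      if hi : ∃ μ, θ μ X = e + (i : ℕ) * π then
        fun t => R hi.choose t * sin (θ hi.choose t) else (0 : ℝ → ℝ) := by
    refine ⟨⟨i, hin⟩, ?_⟩
    simp only [hex, dif_pos, hch]
  have : h = c • fun t => R μ t * sin (θ μ t) := funext fun t => (heq t).1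
  rw [this]
  exact Submodule.smul_mem _ _ (Submodule.subset_span hmem)

end IsSLWeight

/-! ### The profile curve, its phase and its symmetries. -/

/-- The arc length density `w = 1 / (2 π sin² ν)` along the profile curve. -/
def profileWeight (ν : ℝ → ℝ) (t : ℝ) : ℝ := 1 / (2 * π * sin (ν t) ^ 2)

/-- The conformal factor `sin² ν + A² / sin² ν` of the bipolar surface. -/
def profileRho (A : ℝ) (ν : ℝ → ℝ) (t : ℝ) : ℝ := sin (ν t) ^ 2 + A ^ 2 / sin (ν t) ^ 2

/-- First order form of the equations of a profile curve; `v` is the velocity of `ν` in the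
conformal time `∫ w`, and `Λ` is the angle `λ` normalized by `Λ 0 = 0` and `Λ' > 0`. -/
structure IsProfile (A : ℝ) (ν v Λ : ℝ → ℝ) : Prop where
  A_pos : 0 < A
  A_lt : A < 1 / 2
  contDiff_nu : ContDiff ℝ ∞ ν
  contDiff_v : ContDiff ℝ ∞ v
  contDiff_Lambda : ContDiff ℝ ∞ Λ
  mem : ∀ t, ν t ∈ Ioo 0 (π / 2)
  deriv_nu : ∀ t, HasDerivAt ν (profileWeight ν t * v t) t
  deriv_v : ∀ t, HasDerivAt v (profileWeight ν t *
    (sin (ν t) * cos (ν t) - A ^ 2 * sin (ν t) / cos (ν t) ^ 3)) t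
  deriv_Lambda : ∀ t, HasDerivAt Λ (profileWeight ν t * (A / cos (ν t) ^ 2)) t
  energy : ∀ t, v t ^ 2 = sin (ν t) ^ 2 - A ^ 2 / cos (ν t) ^ 2
  v_zero : v 0 = 0
  Lambda_zero : Λ 0 = 0
  start : sin (ν 0) ^ 2 < A

/-- Primitives of even periodic functions. -/
theorem primitive_of_even_periodic {f f' : ℝ → ℝ} {P : ℝ} (hf : ∀ t, HasDerivAt f (f' t) t)
    (heven : ∀ t, f' (-t) = f' t) (hper : ∀ t, f' (t + 2 * P) = f' t) (h0 : f 0 = 0) :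
    (∀ t, f (-t) = -f t) ∧ (∀ t, f (t + 2 * P) = f t + 2 * f P) ∧ ∀ j : ℤ, f (j * P) = j * f P := by
  have odd : ∀ t, f (-t) = -f t := by
    intro t
    have hd : ∀ t, HasDerivAt (fun t => f (-t) + f t) 0 t := fun t =>
      (((hf (-t)).comp t (hasDerivAt_neg t)).add (hf t)).congr_deriv (by rw [heven]; ring)
    have := is_const_of_deriv_eq_zero (fun t => (hd t).differentiableAt)
      (fun t => (hd t).deriv) t 0
    simp only [neg_zero, h0] at this
    linarith
  have per : ∀ t, f (t + 2 * P) = f t + 2 * f P := by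
    intro t
    have hd : ∀ t, HasDerivAt (fun t => f (t + 2 * P) - f t) 0 t := fun t =>
      (((hf (t + 2 * P)).comp_add_const t (2 * P)).sub (hf t)).congr_deriv (by rw [hper]; ring)
    have := is_const_of_deriv_eq_zero (fun t => (hd t).differentiableAt)
      (fun t => (hd t).deriv) t (-P)
    simp only [odd, show -P + 2 * P = P by ring] at this
    linarith
  have nat : ∀ j : ℕ, f (j * P) = j * f P ∧ f ((j + 1 : ℕ) * P) = (j + 1 : ℕ) * f P := by
    intro j
    induction j with
    | zero => simp [h0]
    | succ j ih =>
      refine ⟨ih.2, ?_⟩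
      have := per (j * P)
      rw [show (j : ℝ) * P + 2 * P = (j + 1 + 1 : ℕ) * P by push_cast; ring, ih.1] at this
      rw [this]; push_cast; ring
  refine ⟨odd, per, fun j => ?_⟩
  obtain ⟨n, rfl | rfl⟩ := j.eq_nat_or_neg
  · exact_mod_cast (nat n).1
  · have := odd (n * P)
    rw [(nat n).1] at this
    push_cast
    rw [neg_mul, this, neg_mul]

/-- Identification of a Prüfer angle at the end point by a curve that has never the opposite
direction. -/
theorem IsPruferAngle.eq_of_solution {w Q h k θ ψ r : ℝ → ℝ} {c X : ℝ} (hw : Continuous w)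
    (hQ : Continuous Q) (hθ : IsPruferAngle w Q θ) (H : IsSLSolution w Q h k) (hc : 0 < c)
    (h0 : h 0 = c * sin (θ 0)) (k0 : k 0 = c * cos (θ 0)) (hψ : Continuous ψ) (ψ0 : θ 0 = ψ 0)
    (hr : ∀ t, 0 < r t) (hh : ∀ t, h t = r t * sin (ψ t))
    (hk : ∀ t, sin (ψ t) = 0 → 0 < k t * cos (ψ t)) (hX : h X * cos (ψ X) = k X * sin (ψ X)) :
    θ X = ψ X := by
  obtain ⟨R, R0, Rpos, HR⟩ := hθ.exists_solution hw hQ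
  have heq : ∀ t, h t = c * (R t * sin (θ t)) ∧ k t = c * (R t * cos (θ t)) :=
    H.eq_of_eq hw hQ (HR.const_mul c) (t₀ := 0) (by rw [h0, R0, one_mul]) (by rw [k0, R0, one_mul])
  have cR : ∀ t, 0 < c * R t := fun t => mul_pos hc (Rpos t)
  refine eq_of_not_opposite hθ.continuous hψ ψ0 (fun t => ?_) (fun t ht => ?_) ?_
  · have h1 : (c * R t) * (sin (θ t) * sin (ψ t)) = r t * (sin (ψ t) * sin (ψ t)) := by
      have := (heq t).1
      rw [hh t] at this
      linear_combination (-sin (ψ t)) * this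
    have h2 : 0 ≤ (c * R t) * (sin (θ t) * sin (ψ t)) := by
      rw [h1]; exact mul_nonneg (hr t).le (mul_self_nonneg _)
    exact nonneg_of_mul_nonneg_right h2 (cR t)
  · have h1 := hk t ht
    rw [(heq t).2, show c * (R t * cos (θ t)) * cos (ψ t) = (c * R t) * (cos (θ t) * cos (ψ t)) by
      ring] at h1
    exact pos_of_mul_pos_right h1 (cR t).le
  · rw [(heq X).1, (heq X).2] at hX
    have h1 : (c * R X) * sin (θ X - ψ X) = 0 := by rw [sin_sub]; linear_combination hX
    exact (mul_eq_zero.1 h1).resolve_left (cR X).ne'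

namespace IsProfile

variable {A : ℝ} {ν v Λ : ℝ → ℝ}

theorem sin_pos (D : IsProfile A ν v Λ) (t : ℝ) : 0 < sin (ν t) :=
  sin_pos_of_pos_of_lt_pi (D.mem t).1 (by linarith [(D.mem t).2, pi_pos])

theorem cos_pos (D : IsProfile A ν v Λ) (t : ℝ) : 0 < cos (ν t) :=
  cos_pos_of_mem_Ioo ⟨by linarith [(D.mem t).1, pi_pos], (D.mem t).2⟩

theorem weight_pos (D : IsProfile A ν v Λ) (t : ℝ) : 0 < profileWeight ν t := by
  have := D.sin_pos t
  unfold profileWeight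
  positivity

theorem contDiff_sin (D : IsProfile A ν v Λ) : ContDiff ℝ ∞ fun t => sin (ν t) :=
  Real.contDiff_sin.comp D.contDiff_nu

theorem contDiff_cos (D : IsProfile A ν v Λ) : ContDiff ℝ ∞ fun t => cos (ν t) :=
  Real.contDiff_cos.comp D.contDiff_nu

theorem contDiff_weight (D : IsProfile A ν v Λ) : ContDiff ℝ ∞ (profileWeight ν) :=
  contDiff_const.div (contDiff_const.mul (D.contDiff_sin.pow 2)) fun t => by
    have := D.sin_pos t
    positivity

theorem contDiff_rho (D : IsProfile A ν v Λ) : ContDiff ℝ ∞ (profileRho A ν) :=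
  (D.contDiff_sin.pow 2).add (contDiff_const.div (D.contDiff_sin.pow 2) fun t => by
    have := D.sin_pos t
    positivity)

theorem rho_pos (D : IsProfile A ν v Λ) (t : ℝ) : 0 < profileRho A ν t := by
  have := D.sin_pos t
  unfold profileRho
  positivity

/-- From v² ≥ 0 the energy identity gives A²/sin² ν ≤ cos² ν. This bound is what excludes Fourier
modes of order ≥ 2 in α for eigenvalues up to 2. -/
theorem rho_le (D : IsProfile A ν v Λ) (t : ℝ) : profileRho A ν t ≤ 1 := by
  have hs := D.sin_pos t
  have hc := D.cos_pos t
  have h1 := D.energy t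
  have h2 : A ^ 2 / cos (ν t) ^ 2 ≤ sin (ν t) ^ 2 := by nlinarith [sq_nonneg (v t)]
  rw [div_le_iff₀ (by positivity)] at h2
  have h3 : A ^ 2 / sin (ν t) ^ 2 ≤ cos (ν t) ^ 2 := by
    rw [div_le_iff₀ (by positivity)]; linarith
  have := sin_sq_add_cos_sq (ν t)
  unfold profileRho
  linarith

theorem sq_le_sin_sq (D : IsProfile A ν v Λ) (t : ℝ) : A ^ 2 ≤ sin (ν t) ^ 2 := by
  have hs := D.sin_pos t
  have h1 := D.rho_le t
  unfold profileRho at h1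
  have h2 : A ^ 2 / sin (ν t) ^ 2 ≤ 1 := by nlinarith [sq_nonneg (sin (ν t))]
  rwa [div_le_one (by positivity)] at h2

theorem weight_le (D : IsProfile A ν v Λ) (t : ℝ) : profileWeight ν t ≤ 1 / (2 * π * A ^ 2) := by
  have := D.A_pos
  unfold profileWeight
  have := D.sq_le_sin_sq t
  gcongr

theorem weight_sin (D : IsProfile A ν v Λ) (t : ℝ) :
    profileWeight ν t * (2 * π * sin (ν t) ^ 2) = 1 := by
  have := D.sin_pos t
  unfold profileWeight
  field_simp

theorem deriv_sin (D : IsProfile A ν v Λ) (t : ℝ) :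
    HasDerivAt (fun t => sin (ν t)) (cos (ν t) * (profileWeight ν t * v t)) t := (D.deriv_nu t).sin

theorem deriv_cos (D : IsProfile A ν v Λ) (t : ℝ) :
    HasDerivAt (fun t => cos (ν t)) (-sin (ν t) * (profileWeight ν t * v t)) t := (D.deriv_nu t).cos

/-- The functions `g = A / sin ν - sin ν`, `f = v cot ν` and `y = A / sin ν + sin ν`; the vector
`(g, f)` rotates with angular velocity `w y`. -/
theorem deriv_g (D : IsProfile A ν v Λ) (t : ℝ) :
    HasDerivAt (fun t => A / sin (ν t) - sin (ν t)) (profileWeight ν t *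
      -(v t * cos (ν t) / sin (ν t) * (A / sin (ν t) + sin (ν t)))) t := by
  have hs := (D.sin_pos t).ne'
  refine (((hasDerivAt_const t A).div (D.deriv_sin t) hs).sub (D.deriv_sin t)).congr_deriv ?_
  field_simp
  ring

theorem deriv_y (D : IsProfile A ν v Λ) (t : ℝ) :
    HasDerivAt (fun t => A / sin (ν t) + sin (ν t)) (profileWeight ν t *
      -(v t * cos (ν t) / sin (ν t) * (A / sin (ν t) - sin (ν t)))) t := by
  have hs := (D.sin_pos t).ne'
  refine (((hasDerivAt_const t A).div (D.deriv_sin t) hs).add (D.deriv_sin t)).congr_deriv ?_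
  field_simp
  ring

theorem deriv_f (D : IsProfile A ν v Λ) (t : ℝ) :
    HasDerivAt (fun t => v t * cos (ν t) / sin (ν t)) (profileWeight ν t *
      ((A / sin (ν t) - sin (ν t)) * (A / sin (ν t) + sin (ν t)))) t := by
  have hs := (D.sin_pos t).ne'
  have hc := (D.cos_pos t).ne'
  refine (((D.deriv_v t).mul (D.deriv_cos t)).div (D.deriv_sin t) hs).congr_deriv ?_
  have he := D.energy t
  have hsc := cos_sq' (ν t)
  have h1 : v t ^ 2 * cos (ν t) ^ 2 = sin (ν t) ^ 2 * cos (ν t) ^ 2 - A ^ 2 := by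
    rw [he]; field_simp
  simp only [Pi.mul_apply]
  generalize sin (ν t) = s at *
  generalize cos (ν t) = c at *
  generalize v t = V at *
  generalize profileWeight ν t = W at *
  field_simp
  linear_combination (-W * (s ^ 2 + c ^ 2)) * h1

theorem v_sq_mul_cos_sq (D : IsProfile A ν v Λ) (t : ℝ) :
    v t ^ 2 * cos (ν t) ^ 2 = sin (ν t) ^ 2 * cos (ν t) ^ 2 - A ^ 2 := by
  have hc := (D.cos_pos t).ne'
  rw [D.energy]; field_simp

/-- A first integral: (g, f) stays on a circle of radius √(1 - 2A), so a single angle describes the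
motion. -/
theorem sq_g_add_sq_f (D : IsProfile A ν v Λ) (t : ℝ) :
    (A / sin (ν t) - sin (ν t)) ^ 2 + (v t * cos (ν t) / sin (ν t)) ^ 2 = 1 - 2 * A := by
  have hs := (D.sin_pos t).ne'
  have h1 := D.v_sq_mul_cos_sq t
  have hsc := sin_sq_add_cos_sq (ν t)
  field_simp
  linear_combination h1 + sin (ν t) ^ 2 * hsc

theorem y_pos (D : IsProfile A ν v Λ) (t : ℝ) : 0 < A / sin (ν t) + sin (ν t) := by
  have := D.sin_pos t
  have := D.A_pos
  positivity

/-- Up to sign f is the coordinate F of the bipolar surface, which does not depend on α: an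
eigenfunction with n = 0 and μ = 2. -/
theorem isSLSolution_f (D : IsProfile A ν v Λ) :
    IsSLSolution (profileWeight ν) (fun t => 2 * profileRho A ν t - 0)
      (fun t => v t * cos (ν t) / sin (ν t))
      (fun t => (A / sin (ν t) - sin (ν t)) * (A / sin (ν t) + sin (ν t))) where
  deriv_fst := D.deriv_f
  deriv_snd t := by
    refine ((D.deriv_g t).mul (D.deriv_y t)).congr_deriv ?_
    have hs := (D.sin_pos t).ne'
    unfold profileRho
    field_simp
    ring

/-- Here 0 < 1 - 2A < 1 is not a square n², so g does not come from the surface. It is a comparison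
solution for the even problem with n = 0. -/
theorem isSLSolution_g (D : IsProfile A ν v Λ) :
    IsSLSolution (profileWeight ν) (fun t => 2 * profileRho A ν t - (1 - 2 * A))
      (fun t => A / sin (ν t) - sin (ν t))
      (fun t => -(v t * cos (ν t) / sin (ν t) * (A / sin (ν t) + sin (ν t)))) where
  deriv_fst := D.deriv_g
  deriv_snd t := by
    refine ((D.deriv_f t).mul (D.deriv_y t)).neg.congr_deriv ?_
    have hs := (D.sin_pos t).ne'
    have h1 := D.sq_g_add_sq_f t
    have h2 : profileRho A ν t = (A / sin (ν t) - sin (ν t)) ^ 2 + 2 * A := by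
      unfold profileRho; field_simp; ring
    have h3 : (A / sin (ν t) + sin (ν t)) ^ 2 = (A / sin (ν t) - sin (ν t)) ^ 2 + 4 * A := by
      field_simp; ring
    rw [h2]
    linear_combination (-profileWeight ν t * (A / sin (ν t) - sin (ν t))) * (h3 - h1)

/-- The phase of the vector `(g, f)`. -/
def phase (_ : IsProfile A ν v Λ) (t : ℝ) : ℝ :=
  ∫ r in (0 : ℝ)..t, profileWeight ν r * (A / sin (ν r) + sin (ν r))

theorem deriv_phase (D : IsProfile A ν v Λ) (t : ℝ) :
    HasDerivAt D.phase (profileWeight ν t * (A / sin (ν t) + sin (ν t))) t := by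
  have c1 := D.contDiff_weight.continuous
  have c2 : Continuous fun t => A / sin (ν t) + sin (ν t) :=
    continuous_iff_continuousAt.2 fun t => (D.deriv_y t).continuousAt
  have c3 := c1.mul c2
  exact intervalIntegral.integral_hasDerivAt_right (c3.intervalIntegrable _ _)
      (c3.stronglyMeasurableAtFilter _ _) c3.continuousAt

theorem continuous_phase (D : IsProfile A ν v Λ) : Continuous D.phase :=
  continuous_iff_continuousAt.2 fun t => (D.deriv_phase t).continuousAt

@[simp] theorem phase_zero (D : IsProfile A ν v Λ) : D.phase 0 = 0 := by simp [phase]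

theorem phase_strictMono (D : IsProfile A ν v Λ) : StrictMono D.phase :=
  strictMono_of_hasDerivAt_pos D.deriv_phase fun t => mul_pos (D.weight_pos t) (D.y_pos t)

theorem sqrt_pos (D : IsProfile A ν v Λ) : 0 < √(1 - 2 * A) := Real.sqrt_pos.2 (by linarith [D.A_lt])

theorem g_zero (D : IsProfile A ν v Λ) : A / sin (ν 0) - sin (ν 0) = √(1 - 2 * A) := by
  have hs := D.sin_pos 0
  have h1 := D.sq_g_add_sq_f 0
  rw [D.v_zero, zero_mul, zero_div, zero_pow two_ne_zero, add_zero] at h1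
  have h2 : 0 ≤ A / sin (ν 0) - sin (ν 0) := by
    have := D.start
    rw [sub_nonneg, le_div_iff₀ hs]; nlinarith
  rw [← h1, sqrt_sq h2]

/-- Turning (g, f) back by the phase gives a vector with derivative zero. -/
theorem g_f_eq (D : IsProfile A ν v Λ) (t : ℝ) :
    A / sin (ν t) - sin (ν t) = √(1 - 2 * A) * cos (D.phase t) ∧
    v t * cos (ν t) / sin (ν t) = √(1 - 2 * A) * sin (D.phase t) := by
  set g : ℝ → ℝ := fun t => A / sin (ν t) - sin (ν t) with hg
  set f : ℝ → ℝ := fun t => v t * cos (ν t) / sin (ν t) with hf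
  have d1 : ∀ t, HasDerivAt (fun t => g t * cos (D.phase t) + f t * sin (D.phase t)) 0 t := fun t =>
    (((D.deriv_g t).mul (D.deriv_phase t).cos).add
      ((D.deriv_f t).mul (D.deriv_phase t).sin)).congr_deriv (by ring)
  have d2 : ∀ t, HasDerivAt (fun t => f t * cos (D.phase t) - g t * sin (D.phase t)) 0 t := fun t =>
    (((D.deriv_f t).mul (D.deriv_phase t).cos).sub
      ((D.deriv_g t).mul (D.deriv_phase t).sin)).congr_deriv (by ring)
  have e1 := is_const_of_deriv_eq_zero (fun t => (d1 t).differentiableAt)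
    (fun t => (d1 t).deriv) t 0
  have e2 := is_const_of_deriv_eq_zero (fun t => (d2 t).differentiableAt)
    (fun t => (d2 t).deriv) t 0
  have g0 : g 0 = √(1 - 2 * A) := D.g_zero
  have f0 : f 0 = 0 := by simp [hf, D.v_zero]
  simp only [D.phase_zero, g0, f0, cos_zero, sin_zero, mul_one, mul_zero, add_zero, sub_zero]
    at e1 e2
  have hsc := sin_sq_add_cos_sq (D.phase t)
  change g t = _ ∧ f t = _
  constructor
  · linear_combination cos (D.phase t) * e1 - sin (D.phase t) * e2 - g t * hsc
  · linear_combination sin (D.phase t) * e1 + cos (D.phase t) * e2 - f t * hsc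

/-- `y = A / sin ν + sin ν` as a function of the phase. -/
def phaseY (A x : ℝ) : ℝ := √((1 - 2 * A) * cos x ^ 2 + 4 * A)

/-- The derivative of the time with respect to the phase. -/
def phaseSpeedInv (A x : ℝ) : ℝ :=
  2 * π * ((phaseY A x - √(1 - 2 * A) * cos x) / 2) ^ 2 / phaseY A x

theorem y_eq (D : IsProfile A ν v Λ) (t : ℝ) :
    A / sin (ν t) + sin (ν t) = phaseY A (D.phase t) := by
  have hs := (D.sin_pos t).ne'
  have h1 := (D.g_f_eq t).1
  rw [phaseY, eq_comm, Real.sqrt_eq_iff_mul_self_eq_of_pos (D.y_pos t)]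
  have h2 : (1 - 2 * A) * cos (D.phase t) ^ 2 = (A / sin (ν t) - sin (ν t)) ^ 2 := by
    rw [h1, mul_pow, sq_sqrt (by linarith [D.A_lt])]
  rw [h2]
  field_simp
  ring

theorem sin_eq (D : IsProfile A ν v Λ) (t : ℝ) :
    sin (ν t) = (phaseY A (D.phase t) - √(1 - 2 * A) * cos (D.phase t)) / 2 := by
  rw [← D.y_eq, ← (D.g_f_eq t).1]; ring

theorem phaseY_pos (D : IsProfile A ν v Λ) (x : ℝ) : 0 < phaseY A x := by
  refine Real.sqrt_pos.2 ?_
  have := D.A_pos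
  have := D.A_lt
  have : 0 ≤ (1 - 2 * A) * cos x ^ 2 := mul_nonneg (by linarith) (sq_nonneg _)
  linarith

theorem phaseSpeedInv_pos (D : IsProfile A ν v Λ) (x : ℝ) : 0 < phaseSpeedInv A x := by
  have hy := D.phaseY_pos x
  have h1 : √(1 - 2 * A) * cos x < phaseY A x := by
    refine lt_of_le_of_lt (le_abs_self _) (abs_lt_of_sq_lt_sq ?_ hy.le)
    rw [mul_pow, sq_sqrt (by linarith [D.A_lt]), phaseY, sq_sqrt]
    · linarith [D.A_pos]
    · have := D.A_pos
      have : 0 ≤ (1 - 2 * A) * cos x ^ 2 := mul_nonneg (by linarith [D.A_lt]) (sq_nonneg _)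
      linarith
  have h2 : 0 < (phaseY A x - √(1 - 2 * A) * cos x) / 2 := by linarith
  unfold phaseSpeedInv
  positivity

theorem continuous_phaseSpeedInv (D : IsProfile A ν v Λ) : Continuous (phaseSpeedInv A) := by
  have c : Continuous (phaseY A) := by unfold phaseY; fun_prop
  unfold phaseSpeedInv
  exact Continuous.div (by fun_prop) c fun x => (D.phaseY_pos x).ne'

/-- The time as a function of the phase. -/
def time (_ : IsProfile A ν v Λ) (x : ℝ) : ℝ := ∫ r in (0 : ℝ)..x, phaseSpeedInv A r

theorem deriv_time (D : IsProfile A ν v Λ) (x : ℝ) : HasDerivAt D.time (phaseSpeedInv A x) x :=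
  intervalIntegral.integral_hasDerivAt_right (D.continuous_phaseSpeedInv.intervalIntegrable _ _)
      (D.continuous_phaseSpeedInv.stronglyMeasurableAtFilter _ _)
      D.continuous_phaseSpeedInv.continuousAt

theorem time_strictMono (D : IsProfile A ν v Λ) : StrictMono D.time :=
  strictMono_of_hasDerivAt_pos D.deriv_time D.phaseSpeedInv_pos

@[simp] theorem time_zero (D : IsProfile A ν v Λ) : D.time 0 = 0 := by simp [time]

/-- The derivative of the phase is w y, and its reciprocal 2π sin² ν / y is `phaseSpeedInv` at the
phase. Thus `time` inverts `phase`, and as the primitive of an explicit even periodic function it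
hands its symmetries over to the phase, to ν, v and Λ. -/
theorem time_phase (D : IsProfile A ν v Λ) (t : ℝ) : D.time (D.phase t) = t := by
  have hd : ∀ t, HasDerivAt (fun t => D.time (D.phase t) - t) 0 t := by
    intro t
    refine (((D.deriv_time (D.phase t)).comp t (D.deriv_phase t)).sub (hasDerivAt_id t)).congr_deriv
      ?_
    rw [phaseSpeedInv, ← D.sin_eq, ← D.y_eq]
    have h1 := D.weight_sin t
    have h2 := (D.y_pos t).ne'
    generalize A / sin (ν t) + sin (ν t) = Y at *
    field_simp
    linear_combination h1
  have := is_const_of_deriv_eq_zero (fun t => (hd t).differentiableAt)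
    (fun t => (hd t).deriv) t 0
  simp only [D.phase_zero, D.time_zero, sub_zero] at this
  linarith

/-- Half of the period of `ν`. -/
def halfPeriod (D : IsProfile A ν v Λ) : ℝ := D.time π

theorem halfPeriod_pos (D : IsProfile A ν v Λ) : 0 < D.halfPeriod := by
  rw [← D.time_zero]
  exact D.time_strictMono pi_pos

theorem time_symm (D : IsProfile A ν v Λ) : (∀ x, D.time (-x) = -D.time x) ∧
    (∀ x, D.time (x + 2 * π) = D.time x + 2 * D.halfPeriod) ∧
    ∀ j : ℤ, D.time (j * π) = j * D.halfPeriod :=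
  primitive_of_even_periodic D.deriv_time
    (fun x => by simp [phaseSpeedInv, phaseY]) (fun x => by simp [phaseSpeedInv, phaseY])
    D.time_zero

theorem phase_neg (D : IsProfile A ν v Λ) (t : ℝ) : D.phase (-t) = -D.phase t :=
  D.time_strictMono.injective (by rw [D.time_symm.1, D.time_phase, D.time_phase])

theorem phase_add (D : IsProfile A ν v Λ) (t : ℝ) :
    D.phase (t + 2 * D.halfPeriod) = D.phase t + 2 * π :=
  D.time_strictMono.injective (by rw [D.time_symm.2.1, D.time_phase, D.time_phase])

theorem phase_mul (D : IsProfile A ν v Λ) (j : ℤ) : D.phase (j * D.halfPeriod) = j * π :=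
  D.time_strictMono.injective (by rw [D.time_symm.2.2, D.time_phase])

theorem nu_eq_of_sin_eq (D : IsProfile A ν v Λ) {t r : ℝ} (h : sin (ν t) = sin (ν r)) :
    ν t = ν r :=
  injOn_sin ⟨by linarith [(D.mem t).1, pi_pos], (D.mem t).2.le⟩
    ⟨by linarith [(D.mem r).1, pi_pos], (D.mem r).2.le⟩ h

theorem nu_neg (D : IsProfile A ν v Λ) (t : ℝ) : ν (-t) = ν t :=
  D.nu_eq_of_sin_eq (by rw [D.sin_eq, D.sin_eq, D.phase_neg]; simp [phaseY])

theorem nu_add (D : IsProfile A ν v Λ) (t : ℝ) : ν (t + 2 * D.halfPeriod) = ν t :=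
  D.nu_eq_of_sin_eq (by rw [D.sin_eq, D.sin_eq, D.phase_add]; simp [phaseY])

theorem v_eq (D : IsProfile A ν v Λ) (t : ℝ) :
    v t = √(1 - 2 * A) * sin (D.phase t) * sin (ν t) / cos (ν t) := by
  have := (D.sin_pos t).ne'
  have := (D.cos_pos t).ne'
  rw [← (D.g_f_eq t).2]
  field_simp

theorem v_add (D : IsProfile A ν v Λ) (t : ℝ) : v (t + 2 * D.halfPeriod) = v t := by
  rw [D.v_eq, D.v_eq, D.phase_add, D.nu_add, sin_add_two_pi]

theorem v_mul (D : IsProfile A ν v Λ) (j : ℤ) : v (j * D.halfPeriod) = 0 := by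
  rw [D.v_eq, D.phase_mul, sin_int_mul_pi]; simp

theorem Lambda_symm (D : IsProfile A ν v Λ) : (∀ t, Λ (-t) = -Λ t) ∧
    (∀ t, Λ (t + 2 * D.halfPeriod) = Λ t + 2 * Λ D.halfPeriod) ∧
    ∀ j : ℤ, Λ (j * D.halfPeriod) = j * Λ D.halfPeriod :=
  primitive_of_even_periodic D.deriv_Lambda
    (fun x => by simp [profileWeight, D.nu_neg]) (fun x => by simp [profileWeight, D.nu_add])
    D.Lambda_zero

theorem nu_add_mul (D : IsProfile A ν v Λ) (m : ℕ) (t : ℝ) :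
    ν (t + 2 * (m * D.halfPeriod)) = ν t := by
  have hp : Function.Periodic ν (2 * D.halfPeriod) := D.nu_add
  have := hp.nat_mul m t
  rwa [show (m : ℝ) * (2 * D.halfPeriod) = 2 * (m * D.halfPeriod) by ring] at this

theorem isSLWeight (D : IsProfile A ν v Λ) {m : ℕ} (hm : 0 < m) :
    IsSLWeight (profileWeight ν) (profileRho A ν) (m * D.halfPeriod) where
  contDiff_w := D.contDiff_weight
  contDiff_rho := D.contDiff_rho
  w_pos := D.weight_pos
  rho_pos := D.rho_pos
  rho_le := D.rho_le
  w_bdd := ⟨_, D.weight_le⟩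
  w_even t := by simp [profileWeight, D.nu_neg]
  rho_even t := by simp [profileRho, D.nu_neg]
  w_per t := by simp [profileWeight, D.nu_add_mul]
  rho_per t := by simp [profileRho, D.nu_add_mul]
  X_pos := mul_pos (by exact_mod_cast hm) D.halfPeriod_pos

end IsProfile

/-! ### Solutions for μ = 2 and their Prüfer angles. -/

namespace IsProfile

variable {A : ℝ} {ν v Λ : ℝ → ℝ}

/-- The pair (A/(sin ν cos ν), v), turned by Λ, is the e^{iα} part of the bipolar surface. Its
derivatives are arranged so that the terms with A/cos² ν cancel against those from Λ' = w A/cos² ν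
once the pair is turned. -/
theorem deriv_horizontal (D : IsProfile A ν v Λ) (t : ℝ) :
    HasDerivAt (fun t => A / (sin (ν t) * cos (ν t))) (profileWeight ν t *
      (-(A * v t / sin (ν t) ^ 2) + v t * (A / cos (ν t) ^ 2))) t := by
  have hs := (D.sin_pos t).ne'
  have hc := (D.cos_pos t).ne'
  refine ((hasDerivAt_const t A).div ((D.deriv_sin t).mul (D.deriv_cos t))
    (mul_ne_zero hs hc)).congr_deriv ?_
  simp only [Pi.mul_apply]
  field_simp
  ring

theorem deriv_velocity_horizontal (D : IsProfile A ν v Λ) (t : ℝ) :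
    HasDerivAt (fun t => -(A * v t / sin (ν t) ^ 2)) (profileWeight ν t *
      ((1 - 2 * profileRho A ν t) * (A / (sin (ν t) * cos (ν t))) +
        (sin (ν t) * cos (ν t) + A ^ 2 / (sin (ν t) * cos (ν t))) * (A / cos (ν t) ^ 2))) t := by
  have hs := (D.sin_pos t).ne'
  have hc := (D.cos_pos t).ne'
  refine (((D.deriv_v t).const_mul A).div ((D.deriv_sin t).pow 2)
    (pow_ne_zero 2 hs)).neg.congr_deriv ?_
  have h1 := D.v_sq_mul_cos_sq t
  have hsc := sin_sq_add_cos_sq (ν t)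
  unfold profileRho
  simp only [Pi.pow_apply, Nat.cast_ofNat, Nat.add_one_sub_one, pow_one]
  generalize sin (ν t) = s at *
  generalize cos (ν t) = c at *
  generalize v t = V at *
  generalize profileWeight ν t = W at *
  field_simp
  linear_combination 2 * A * W * c ^ 2 * h1 + A * W * c ^ 2 * s ^ 2 * hsc

theorem deriv_velocity_vertical (D : IsProfile A ν v Λ) (t : ℝ) :
    HasDerivAt (fun t => sin (ν t) * cos (ν t) + A ^ 2 / (sin (ν t) * cos (ν t)))
      (profileWeight ν t * ((1 - 2 * profileRho A ν t) * v t +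
        (A * v t / sin (ν t) ^ 2) * (A / cos (ν t) ^ 2))) t := by
  have hs := (D.sin_pos t).ne'
  have hc := (D.cos_pos t).ne'
  refine (((D.deriv_sin t).mul (D.deriv_cos t)).add ((hasDerivAt_const t (A ^ 2)).div
    ((D.deriv_sin t).mul (D.deriv_cos t)) (mul_ne_zero hs hc))).congr_deriv ?_
  have hsc := sin_sq_add_cos_sq (ν t)
  unfold profileRho
  simp only [Pi.mul_apply]
  generalize sin (ν t) = s at *
  generalize cos (ν t) = c at *
  generalize v t = V at *
  generalize profileWeight ν t = W at *
  field_simp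
  linear_combination W * V * (c ^ 2 * s ^ 2 + A ^ 2) * hsc

theorem deriv_v' (D : IsProfile A ν v Λ) (t : ℝ) :
    HasDerivAt v (profileWeight ν t * (sin (ν t) * cos (ν t) +
      A ^ 2 / (sin (ν t) * cos (ν t)) - A / (sin (ν t) * cos (ν t)) * (A / cos (ν t) ^ 2))) t := by
  refine (D.deriv_v t).congr_deriv ?_
  have hs := (D.sin_pos t).ne'
  have hc := (D.cos_pos t).ne'
  have hsc := sin_sq_add_cos_sq (ν t)
  field_simp
  linear_combination (-A ^ 2 * profileWeight ν t) * hsc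

theorem isSLSolution_cos (D : IsProfile A ν v Λ) :
    IsSLSolution (profileWeight ν) (fun t => 2 * profileRho A ν t - 1)
      (fun t => A / (sin (ν t) * cos (ν t)) * cos (Λ t) - v t * sin (Λ t))
      (fun t => -(A * v t / sin (ν t) ^ 2) * cos (Λ t) -
        (sin (ν t) * cos (ν t) + A ^ 2 / (sin (ν t) * cos (ν t))) * sin (Λ t)) where
  deriv_fst t := (((D.deriv_horizontal t).mul (D.deriv_Lambda t).cos).sub
    ((D.deriv_v' t).mul (D.deriv_Lambda t).sin)).congr_deriv (by ring)
  deriv_snd t := (((D.deriv_velocity_horizontal t).mul (D.deriv_Lambda t).cos).sub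
    ((D.deriv_velocity_vertical t).mul (D.deriv_Lambda t).sin)).congr_deriv (by ring)

theorem isSLSolution_sin (D : IsProfile A ν v Λ) :
    IsSLSolution (profileWeight ν) (fun t => 2 * profileRho A ν t - 1)
      (fun t => A / (sin (ν t) * cos (ν t)) * sin (Λ t) + v t * cos (Λ t))
      (fun t => -(A * v t / sin (ν t) ^ 2) * sin (Λ t) +
        (sin (ν t) * cos (ν t) + A ^ 2 / (sin (ν t) * cos (ν t))) * cos (Λ t)) where
  deriv_fst t := (((D.deriv_horizontal t).mul (D.deriv_Lambda t).sin).add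
    ((D.deriv_v' t).mul (D.deriv_Lambda t).cos)).congr_deriv (by ring)
  deriv_snd t := (((D.deriv_velocity_horizontal t).mul (D.deriv_Lambda t).sin).add
    ((D.deriv_velocity_vertical t).mul (D.deriv_Lambda t).cos)).congr_deriv (by ring)

theorem continuous_potential (D : IsProfile A ν v Λ) (l : ℝ) :
    Continuous fun t => 2 * profileRho A ν t - l := by
  have := D.contDiff_rho.continuous
  fun_prop

/-- Here f = √(1 - 2A) sin(phase), and at zeros of f the companion g y has the sign of cos(phase).
So the phase is never opposite to the Prüfer angle, and both are equal at mT, where f = 0. -/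
theorem angle_f (D : IsProfile A ν v Λ) {θ : ℝ → ℝ} (h0 : θ 0 = 0)
    (hθ : IsPruferAngle (profileWeight ν) (fun t => 2 * profileRho A ν t - 0) θ) (m : ℕ) :
    θ (m * D.halfPeriod) = m * π := by
  have hm : D.phase (m * D.halfPeriod) = m * π := by exact_mod_cast D.phase_mul m
  have hs := D.sqrt_pos
  rw [← hm]
  refine hθ.eq_of_solution D.contDiff_weight.continuous (D.continuous_potential 0)
    D.isSLSolution_f (c := √(1 - 2 * A) * (A / sin (ν 0) + sin (ν 0)))
    (mul_pos hs (D.y_pos 0)) ?_ ?_ D.continuous_phase (by simp [h0]) (r := fun _ => √(1 - 2 * A))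
    (fun _ => hs) (fun t => (D.g_f_eq t).2) (fun t ht => ?_) ?_
  · simp [h0, D.v_zero]
  · simp only [h0, cos_zero, D.g_zero, mul_one]
  · rw [(D.g_f_eq t).1]
    have h1 : cos (D.phase t) ^ 2 = 1 := by have := sin_sq_add_cos_sq (D.phase t); rw [ht] at this; simpa using this
    have := mul_pos hs (D.y_pos t)
    nlinarith
  · rw [(D.g_f_eq _).2, hm, sin_nat_mul_pi]; simp

/-- The same comparison with the phase shifted by π/2, because g = √(1 - 2A) cos(phase). -/
theorem angle_g (D : IsProfile A ν v Λ) {θ : ℝ → ℝ} (h0 : θ 0 = π / 2)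
    (hθ : IsPruferAngle (profileWeight ν) (fun t => 2 * profileRho A ν t - (1 - 2 * A)) θ) (m : ℕ) :
    θ (m * D.halfPeriod) = m * π + π / 2 := by
  have hm : D.phase (m * D.halfPeriod) = m * π := by exact_mod_cast D.phase_mul m
  have hs := D.sqrt_pos
  rw [← hm]
  have cp := D.continuous_phase
  refine hθ.eq_of_solution (ψ := fun t => D.phase t + π / 2) D.contDiff_weight.continuous
    (D.continuous_potential _) D.isSLSolution_g (c := √(1 - 2 * A)) hs ?_ ?_ (by fun_prop)
    (by simp [h0]) (r := fun _ => √(1 - 2 * A)) (fun _ => hs)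
    (fun t => by rw [(D.g_f_eq t).1, sin_add_pi_div_two]) (fun t ht => ?_) ?_
  · simp only [h0, D.g_zero, sin_pi_div_two, mul_one]
  · simp [h0, D.v_zero]
  · rw [sin_add_pi_div_two] at ht
    rw [(D.g_f_eq t).2, cos_add_pi_div_two]
    have h1 : sin (D.phase t) ^ 2 = 1 := by have := sin_sq_add_cos_sq (D.phase t); rw [ht] at this; simpa using this
    have := mul_pos hs (D.y_pos t)
    nlinarith
  · simp only [(D.g_f_eq _).1, (D.g_f_eq _).2, hm, cos_add_pi_div_two, sin_nat_mul_pi]; simp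

theorem horizontal_pos (D : IsProfile A ν v Λ) (t : ℝ) : 0 < A / (sin (ν t) * cos (ν t)) :=
  div_pos D.A_pos (mul_pos (D.sin_pos t) (D.cos_pos t))

/-- The polar angle of the vector `(A / (sin ν cos ν), v)` turned by `Λ`. -/
def windingAngle (_ : IsProfile A ν v Λ) (t : ℝ) : ℝ :=
  Λ t + arctan (v t / (A / (sin (ν t) * cos (ν t))))

theorem continuous_windingAngle (D : IsProfile A ν v Λ) : Continuous D.windingAngle := by
  have c1 : Continuous fun t => A / (sin (ν t) * cos (ν t)) :=
    continuous_iff_continuousAt.2 fun t => (D.deriv_horizontal t).continuousAt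
  have c2 := D.contDiff_Lambda.continuous
  have c3 := D.contDiff_v.continuous
  have c4 : Continuous fun t => v t / (A / (sin (ν t) * cos (ν t))) :=
    c3.div c1 fun t => (D.horizontal_pos t).ne'
  exact c2.add (continuous_arctan.comp c4)

theorem windingAngle_zero (D : IsProfile A ν v Λ) : D.windingAngle 0 = 0 := by
  simp [windingAngle, D.v_zero, D.Lambda_zero]

theorem windingAngle_mul (D : IsProfile A ν v Λ) (m : ℕ) :
    D.windingAngle (m * D.halfPeriod) = Λ (m * D.halfPeriod) := by
  have : v (m * D.halfPeriod) = 0 := by exact_mod_cast D.v_mul m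
  simp [windingAngle, this]

theorem exists_radius (D : IsProfile A ν v Λ) (t : ℝ) : ∃ r > 0,
    A / (sin (ν t) * cos (ν t)) * cos (Λ t) - v t * sin (Λ t) = r * cos (D.windingAngle t) ∧
    A / (sin (ν t) * cos (ν t)) * sin (Λ t) + v t * cos (Λ t) = r * sin (D.windingAngle t) := by
  have hu := D.horizontal_pos t
  unfold windingAngle
  set u := A / (sin (ν t) * cos (ν t))
  have hr : 0 < √(1 + (v t / u) ^ 2) := Real.sqrt_pos.2 (by positivity)
  refine ⟨u * √(1 + (v t / u) ^ 2), by positivity, ?_, ?_⟩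
  · rw [cos_add, cos_arctan, sin_arctan]
    field_simp
  · rw [sin_add, cos_arctan, sin_arctan]
    field_simp

/-- The rotation by Λ drops out of this Wronskian and leaves a positive term plus A v²/sin² ν. At a
zero of one solution it fixes the sign of its companion against the other solution, which rules out
opposite directions. -/
theorem wronskian_pos (D : IsProfile A ν v Λ) (t : ℝ) :
    0 < (-(A * v t / sin (ν t) ^ 2) * sin (Λ t) +
        (sin (ν t) * cos (ν t) + A ^ 2 / (sin (ν t) * cos (ν t))) * cos (Λ t)) *
      (A / (sin (ν t) * cos (ν t)) * cos (Λ t) - v t * sin (Λ t)) -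
      (A / (sin (ν t) * cos (ν t)) * sin (Λ t) + v t * cos (Λ t)) *
      (-(A * v t / sin (ν t) ^ 2) * cos (Λ t) -
        (sin (ν t) * cos (ν t) + A ^ 2 / (sin (ν t) * cos (ν t))) * sin (Λ t)) := by
  have hu := D.horizontal_pos t
  have hs := D.sin_pos t
  have hc := D.cos_pos t
  have hA := D.A_pos
  set u := A / (sin (ν t) * cos (ν t))
  have hp : 0 < sin (ν t) * cos (ν t) + A ^ 2 / (sin (ν t) * cos (ν t)) := by positivity
  set p := sin (ν t) * cos (ν t) + A ^ 2 / (sin (ν t) * cos (ν t))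
  have h1 : 0 ≤ A * v t / sin (ν t) ^ 2 * v t := by
    rw [div_mul_eq_mul_div, mul_assoc]
    exact div_nonneg (mul_nonneg hA.le (mul_self_nonneg _)) (sq_nonneg _)
  have h2 := sin_sq_add_cos_sq (Λ t)
  have h3 : 0 < p * u + A * v t / sin (ν t) ^ 2 * v t := add_pos_of_pos_of_nonneg (mul_pos hp hu) h1
  generalize A * v t / sin (ν t) ^ 2 = z at *
  have h4 : (p * u + z * v t) * (sin (Λ t) ^ 2 + cos (Λ t) ^ 2) = p * u + z * v t := by
    rw [h2, mul_one]
  rw [← h4] at h3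
  linarith

theorem sin_mul_cos_eq_zero {x : ℝ} (hx : sin (2 * x) = 0) : sin x * cos x = 0 := by
  rw [sin_two_mul] at hx; linarith

/-- The winding angle of the turned pair is never opposite to the Prüfer angle. At mT one has v = 0,
and the two directions are parallel because sin Λ cos Λ = 0 there, that is, Λ is a multiple of π/2.
-/
theorem angle_sin (D : IsProfile A ν v Λ) {θ : ℝ → ℝ} (h0 : θ 0 = 0)
    (hθ : IsPruferAngle (profileWeight ν) (fun t => 2 * profileRho A ν t - 1) θ) (m : ℕ)
    (hΛ : sin (2 * Λ (m * D.halfPeriod)) = 0) :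
    θ (m * D.halfPeriod) = Λ (m * D.halfPeriod) := by
  have hv : v (m * D.halfPeriod) = 0 := by exact_mod_cast D.v_mul m
  rw [← D.windingAngle_mul]
  choose r rpos hr1 hr2 using D.exists_radius
  have hs := D.sin_pos 0
  have hc := D.cos_pos 0
  have hA := D.A_pos
  refine hθ.eq_of_solution D.contDiff_weight.continuous (D.continuous_potential 1)
    D.isSLSolution_sin (c := sin (ν 0) * cos (ν 0) + A ^ 2 / (sin (ν 0) * cos (ν 0)))
    (by positivity) (by simp [h0, D.v_zero, D.Lambda_zero])
    (by simp [h0, D.v_zero, D.Lambda_zero]) D.continuous_windingAngle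
    (by rw [h0, D.windingAngle_zero]) rpos hr2 (fun t ht => ?_) ?_
  · have h1 := D.wronskian_pos t
    rw [hr1, hr2, ht, mul_zero, zero_mul, sub_zero, mul_left_comm] at h1
    exact pos_of_mul_pos_right h1 (rpos t).le
  · rw [D.windingAngle_mul, hv]
    linear_combination (A / (sin (ν (m * D.halfPeriod)) * cos (ν (m * D.halfPeriod))) -
      (sin (ν (m * D.halfPeriod)) * cos (ν (m * D.halfPeriod)) +
      A ^ 2 / (sin (ν (m * D.halfPeriod)) * cos (ν (m * D.halfPeriod))))) *
      sin_mul_cos_eq_zero hΛ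

theorem angle_cos (D : IsProfile A ν v Λ) {θ : ℝ → ℝ} (h0 : θ 0 = π / 2)
    (hθ : IsPruferAngle (profileWeight ν) (fun t => 2 * profileRho A ν t - 1) θ) (m : ℕ)
    (hΛ : sin (2 * Λ (m * D.halfPeriod)) = 0) :
    θ (m * D.halfPeriod) = Λ (m * D.halfPeriod) + π / 2 := by
  have hv : v (m * D.halfPeriod) = 0 := by exact_mod_cast D.v_mul m
  rw [← D.windingAngle_mul]
  choose r rpos hr1 hr2 using D.exists_radius
  have hs := D.sin_pos 0
  have hc := D.cos_pos 0
  have hA := D.A_pos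
  have cw := D.continuous_windingAngle
  refine hθ.eq_of_solution (ψ := fun t => D.windingAngle t + π / 2) D.contDiff_weight.continuous
    (D.continuous_potential 1)
    D.isSLSolution_cos (c := A / (sin (ν 0) * cos (ν 0)))
    (by positivity) (by simp [h0, D.v_zero, D.Lambda_zero])
    (by simp [h0, D.v_zero, D.Lambda_zero]) (by fun_prop)
    (by rw [h0, D.windingAngle_zero, zero_add]) rpos
    (fun t => by rw [hr1, sin_add_pi_div_two]) (fun t ht => ?_) ?_
  · have h1 := D.wronskian_pos t
    rw [sin_add_pi_div_two] at ht
    rw [hr1, hr2, ht, mul_zero, mul_zero, zero_sub, mul_assoc, ← mul_neg] at h1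
    rw [cos_add_pi_div_two]
    have h2 := pos_of_mul_pos_right h1 (rpos t).le
    linarith
  · simp only [cos_add_pi_div_two, sin_add_pi_div_two]
    rw [D.windingAngle_mul, hv]
    linear_combination ((sin (ν (m * D.halfPeriod)) * cos (ν (m * D.halfPeriod)) +
      A ^ 2 / (sin (ν (m * D.halfPeriod)) * cos (ν (m * D.halfPeriod)))) -
      A / (sin (ν (m * D.halfPeriod)) * cos (ν (m * D.halfPeriod)))) *
      sin_mul_cos_eq_zero hΛ

end IsProfile

/-! ### The angle increment Ω, the area integral and its upper bound. -/

/-- Change of variables for a strictly increasing function, without conditions on the integrand. -/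
theorem intervalIntegral_comp_of_deriv_pos {f f' g : ℝ → ℝ} {a b : ℝ} (hab : a ≤ b)
    (hc : ContinuousOn f (Icc a b)) (hf : ∀ x ∈ Ioo a b, HasDerivAt f (f' x) x)
    (hpos : ∀ x ∈ Ioo a b, 0 < f' x) :
    ∫ u in f a..f b, g u = ∫ x in a..b, f' x * g (f x) := by
  have hmono : StrictMonoOn f (Icc a b) := strictMonoOn_of_deriv_pos (convex_Icc a b) hc
    fun x hx => by rw [interior_Icc] at hx; rw [(hf x hx).deriv]; exact hpos x hx
  have himg : f '' Ioo a b = Ioo (f a) (f b) := by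
    refine Subset.antisymm ?_ (intermediate_value_Ioo hab hc)
    rintro _ ⟨x, hx, rfl⟩
    exact ⟨hmono (left_mem_Icc.2 hab) (Ioo_subset_Icc_self hx) hx.1,
      hmono (Ioo_subset_Icc_self hx) (right_mem_Icc.2 hab) hx.2⟩
  have hle : f a ≤ f b := hmono.monotoneOn (left_mem_Icc.2 hab) (right_mem_Icc.2 hab) hab
  rw [intervalIntegral.integral_of_le hle, intervalIntegral.integral_of_le hab,
    integral_Ioc_eq_integral_Ioo, integral_Ioc_eq_integral_Ioo, ← himg,
    integral_image_eq_integral_abs_deriv_smul measurableSet_Ioo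
      (fun x hx => (hf x hx).hasDerivWithinAt) (hmono.injOn.mono Ioo_subset_Icc_self)]
  refine setIntegral_congr_fun measurableSet_Ioo fun x hx => ?_
  simp only [abs_of_pos (hpos x hx), smul_eq_mul]

namespace IsProfile

variable {A : ℝ} {ν v Λ : ℝ → ℝ}

theorem phase_halfPeriod (D : IsProfile A ν v Λ) : D.phase D.halfPeriod = π := by
  simpa using D.phase_mul 1

/-- On (0, T) the phase lies in (0, π), so v > 0 and ν increases from a to π/2 - a. Taking ν as
variable in the integral of Λ' gives Ω. -/
theorem Lambda_halfPeriod (D : IsProfile A ν v Λ) {a : ℝ} (ha : a ∈ Ioo 0 (π / 4))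
    (hA : A = sin a * cos a) (h0 : ν 0 = a) : Λ D.halfPeriod = otsukiOmega a := by
  have hs := D.sin_pos
  have hc := D.cos_pos
  -- From phase 0 to phase π the value y is the same while g changes sign, so sin ν passes from sin
  -- a to A/sin a = cos a.
  have hT : ν D.halfPeriod = π / 2 - a := by
    have h1 := D.sin_eq D.halfPeriod
    have h2 := D.sin_eq 0
    have h3 := D.y_eq 0
    have hsa := hs 0
    rw [D.phase_halfPeriod] at h1
    rw [D.phase_zero] at h2 h3
    rw [h0] at h2 h3 hsa
    have h4 : A / sin a = cos a := by rw [hA]; field_simp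
    have h5 : phaseY A π = phaseY A 0 := by simp [phaseY]
    rw [h5, cos_pi] at h1
    rw [cos_zero] at h2
    refine injOn_sin ⟨by linarith [(D.mem D.halfPeriod).1, pi_pos], (D.mem D.halfPeriod).2.le⟩
      ⟨by linarith [ha.2, pi_pos], by linarith [ha.1]⟩ ?_
    rw [sin_pi_div_two_sub]
    linarith
  have hvpos : ∀ t ∈ Ioo 0 D.halfPeriod, 0 < v t := by
    intro t ht
    rw [D.v_eq]
    have h1 := D.phase_strictMono ht.1
    have h2 := D.phase_strictMono ht.2
    rw [D.phase_zero] at h1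
    rw [D.phase_halfPeriod] at h2
    have := sin_pos_of_pos_of_lt_pi h1 h2
    have := D.sqrt_pos
    have := hs t
    have := hc t
    positivity
  have hL : Λ D.halfPeriod = ∫ t in (0 : ℝ)..D.halfPeriod,
      profileWeight ν t * (A / cos (ν t) ^ 2) := by
    have c1 := D.contDiff_weight.continuous
    have c2 := D.contDiff_cos.continuous
    rw [intervalIntegral.integral_eq_sub_of_hasDerivAt (fun t _ => D.deriv_Lambda t)
      (Continuous.intervalIntegrable (c1.mul (continuous_const.div (c2.pow 2)
        fun t => pow_ne_zero 2 (hc t).ne')) _ _), D.Lambda_zero, sub_zero]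
  have key := intervalIntegral_comp_of_deriv_pos (f' := fun t => profileWeight ν t * v t)
    (g := fun u => 1 / (cos u * √(sin u ^ 2 * cos u ^ 2 - sin a ^ 2 * cos a ^ 2)))
    D.halfPeriod_pos.le D.contDiff_nu.continuous.continuousOn (fun t _ => D.deriv_nu t)
    (fun t ht => mul_pos (D.weight_pos t) (hvpos t ht))
  rw [h0, hT] at key
  rw [hL, otsukiOmega, ← hA, key, ← intervalIntegral.integral_const_mul,
    intervalIntegral.integral_of_le D.halfPeriod_pos.le,
    intervalIntegral.integral_of_le D.halfPeriod_pos.le,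
    integral_Ioc_eq_integral_Ioo, integral_Ioc_eq_integral_Ioo]
  refine setIntegral_congr_fun measurableSet_Ioo fun t ht => ?_
  have hv := hvpos t ht
  have hct := hc t
  have h1 : √(sin (ν t) ^ 2 * cos (ν t) ^ 2 - sin a ^ 2 * cos a ^ 2) = v t * cos (ν t) := by
    rw [← mul_pow (sin a), ← hA, ← D.v_sq_mul_cos_sq, ← mul_pow, sqrt_sq (by positivity)]
  simp only [h1]
  field_simp

/-- The mass density of the bipolar surface with respect to the phase. -/
theorem rho_eq (D : IsProfile A ν v Λ) (t : ℝ) :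
    profileRho A ν t = phaseY A (D.phase t) ^ 2 - 2 * A := by
  rw [← D.y_eq, profileRho]
  have := (D.sin_pos t).ne'
  field_simp
  ring

theorem phaseY_sq (hA : 0 < A) (hA' : A < 1 / 2) (x : ℝ) :
    phaseY A x ^ 2 = (1 - 2 * A) * cos x ^ 2 + 4 * A := by
  have : 0 ≤ (1 - 2 * A) * cos x ^ 2 := mul_nonneg (by linarith) (sq_nonneg _)
  rw [phaseY, sq_sqrt (by linarith)]

theorem continuous_phaseY : Continuous (phaseY A) := by unfold phaseY; fun_prop

/-- The density of the area of the bipolar surface with respect to the phase. -/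
def phaseDensity (A x : ℝ) : ℝ := phaseY A x - 2 * A / phaseY A x

theorem continuous_phaseDensity (D : IsProfile A ν v Λ) : Continuous (phaseDensity A) :=
  continuous_phaseY.sub (continuous_const.div continuous_phaseY fun x => (D.phaseY_pos x).ne')

/-- With the phase x as variable, dx = w y dt and ρ = y² - 2A, so ρ w dt = (y - 2A/y) dx. The
density is π-periodic and the phase grows by 2mπ, which makes 2m periods. -/
theorem integral_rho_mul_weight (D : IsProfile A ν v Λ) (m : ℕ) :
    ∫ t in (0 : ℝ)..2 * (m * D.halfPeriod), profileRho A ν t * profileWeight ν t =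
      2 * m * ∫ x in -(π / 2)..(π / 2), phaseDensity A x := by
  have h1 : ∀ t, profileRho A ν t * profileWeight ν t = (phaseDensity A ∘ D.phase) t *
      (profileWeight ν t * (A / sin (ν t) + sin (ν t))) := by
    intro t
    have := (D.phaseY_pos (D.phase t)).ne'
    rw [D.rho_eq, D.y_eq, Function.comp, phaseDensity]
    field_simp
  have c1 := D.contDiff_weight.continuous
  have c2 : Continuous fun t => A / sin (ν t) + sin (ν t) :=
    continuous_iff_continuousAt.2 fun t => (D.deriv_y t).continuousAt
  simp only [h1]
  rw [intervalIntegral.integral_comp_mul_deriv (fun t _ => D.deriv_phase t)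
    (c1.mul c2).continuousOn D.continuous_phaseDensity]
  have h2 : D.phase (2 * (m * D.halfPeriod)) = 0 + (2 * m : ℤ) • π := by
    have := D.phase_mul (2 * m)
    push_cast at this ⊢
    rw [zero_add, zsmul_eq_mul, ← mul_assoc, this]
    push_cast
    ring
  have hp : Function.Periodic (phaseDensity A) π := fun x => by
    simp [phaseDensity, phaseY]
  rw [D.phase_zero, h2, hp.intervalIntegral_add_zsmul_eq (2 * m) 0
      (fun a b => D.continuous_phaseDensity.intervalIntegrable a b),
    hp.intervalIntegral_add_eq 0 (-(π / 2)), show -(π / 2) + π = π / 2 by ring, zsmul_eq_mul]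
  push_cast
  ring

/-- Substitute sin φ = sin b sin x, where cos² b = 2A and sin² b = 1 - 2A. Then cos² φ = Y² - 2A and
cos⁴ φ - cos⁴ b = (sin b cos x Y)², with Y = `phaseY A x`. -/
theorem integralI2_eq (hA : 0 < A) (hA' : A < 1 / 2) {b : ℝ} (hb : b ∈ Ioo 0 (π / 2))
    (hab : cos b ^ 4 = 4 * A ^ 2) :
    integralI2 b = ∫ x in -(π / 2)..(π / 2), phaseDensity A x := by
  have hcb : 0 < cos b := cos_pos_of_mem_Ioo ⟨by linarith [hb.1, pi_pos], hb.2⟩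
  have hsb : 0 < sin b := sin_pos_of_pos_of_lt_pi hb.1 (by linarith [hb.2, pi_pos])
  have hsb1 : sin b < 1 := by
    have := sin_sq_add_cos_sq b
    nlinarith
  have hcb2 : cos b ^ 2 = 2 * A := by
    have : (cos b ^ 2 - 2 * A) * (cos b ^ 2 + 2 * A) = 0 := by ring_nf; linarith
    rcases mul_eq_zero.1 this with h | h
    · linarith
    · nlinarith
  have hs2 : sin b ^ 2 = 1 - 2 * A := by
    have := sin_sq_add_cos_sq b
    linarith
  have e1 : arcsin (sin b * sin (π / 2)) = b := by
    rw [sin_pi_div_two, mul_one, arcsin_sin (by linarith [hb.1, pi_pos]) hb.2.le]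
  have e2 : arcsin (sin b * sin (-(π / 2))) = -b := by
    rw [sin_neg, mul_neg, arcsin_neg, e1]
  have hlt : ∀ x, |sin b * sin x| < 1 := by
    intro x
    rw [abs_mul, abs_of_pos hsb]
    calc sin b * |sin x| ≤ sin b * 1 := by
          gcongr
          exact abs_sin_le_one x
      _ < 1 := by linarith
  have hd : ∀ x, HasDerivAt (fun x => arcsin (sin b * sin x))
      (1 / √(1 - (sin b * sin x) ^ 2) * (sin b * cos x)) x := fun x =>
    HasDerivAt.comp x (h := fun x => sin b * sin x) (h₂ := arcsin)
      (hasDerivAt_arcsin (abs_lt.1 (hlt x)).1.ne' (abs_lt.1 (hlt x)).2.ne)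
      ((hasDerivAt_sin x).const_mul (sin b))
  have key := intervalIntegral_comp_of_deriv_pos (a := -(π / 2)) (b := π / 2)
      (f := fun x => arcsin (sin b * sin x)) (g := fun φ => cos φ ^ 3 / √(cos φ ^ 4 - cos b ^ 4))
      (by linarith [pi_pos])
      (fun x _ => (hd x).continuousAt.continuousWithinAt) (fun x _ => hd x)
  simp only [e1, e2] at key
  rw [integralI2, key,
    intervalIntegral.integral_of_le (by linarith [pi_pos]),
    intervalIntegral.integral_of_le (by linarith [pi_pos]),
    integral_Ioc_eq_integral_Ioo, integral_Ioc_eq_integral_Ioo]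
  · refine setIntegral_congr_fun measurableSet_Ioo fun x hx => ?_
    have hcx : 0 < cos x := cos_pos_of_mem_Ioo hx
    have hsc := sin_sq_add_cos_sq x
    have hY2 := phaseY_sq hA hA' x
    have hYpos : 0 < phaseY A x := Real.sqrt_pos.2 (by
      have : 0 ≤ (1 - 2 * A) * cos x ^ 2 := mul_nonneg (by linarith) (sq_nonneg _)
      linarith)
    have hr : 1 - (sin b * sin x) ^ 2 = phaseY A x ^ 2 - 2 * A := by
      rw [hY2, mul_pow, hs2]; linear_combination (2 * A - 1) * hsc
    have hrpos : 0 < phaseY A x ^ 2 - 2 * A := by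
      rw [hY2]
      have : 0 ≤ (1 - 2 * A) * cos x ^ 2 := mul_nonneg (by linarith) (sq_nonneg _)
      linarith
    have hroot : √(cos (arcsin (sin b * sin x)) ^ 4 - cos b ^ 4) =
        sin b * cos x * phaseY A x := by
      rw [cos_arcsin, hr, show √(phaseY A x ^ 2 - 2 * A) ^ 4 = (√(phaseY A x ^ 2 - 2 * A) ^ 2) ^ 2
        by ring, sq_sqrt hrpos.le, hab, ← sqrt_sq (show 0 ≤ sin b * cos x * phaseY A x by positivity)]
      congr 1
      rw [mul_pow, mul_pow, hs2, hY2]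
      ring
    have hq : 0 < √(phaseY A x ^ 2 - 2 * A) := Real.sqrt_pos.2 hrpos
    simp only [hroot]
    rw [cos_arcsin, hr, phaseDensity, show √(phaseY A x ^ 2 - 2 * A) ^ 3 =
      √(phaseY A x ^ 2 - 2 * A) ^ 2 * √(phaseY A x ^ 2 - 2 * A) by ring, sq_sqrt hrpos.le]
    field_simp
  · intro x hx
    have hcx : 0 < cos x := cos_pos_of_mem_Ioo hx
    have : 0 < √(1 - (sin b * sin x) ^ 2) := Real.sqrt_pos.2 (by
      have := (sq_lt_one_iff_abs_lt_one _).2 (hlt x)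
      linarith)
    positivity

/-- As a function of z = Y² the density √z - 2A/√z is concave. It lies below its tangent at the mean
of z, and the linear term integrates to zero. -/
theorem integral_phaseDensity_lt (hA : 0 < A) (hA' : A < 1 / 2) :
    ∫ x in -(π / 2)..(π / 2), phaseDensity A x < √2 / 2 * π := by
  -- m² is the mean of (1 - 2A) cos² x + 4A over a period.
  set m := √((1 + 6 * A) / 2) with hm
  have hm0 : 0 < m := Real.sqrt_pos.2 (by positivity)
  have hm2 : m ^ 2 = (1 + 6 * A) / 2 := sq_sqrt (by positivity)
  have hYpos : ∀ x, 0 < phaseY A x := fun x => Real.sqrt_pos.2 (by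
    have : 0 ≤ (1 - 2 * A) * cos x ^ 2 := mul_nonneg (by linarith) (sq_nonneg _)
    linarith)
  -- The slope of √z - 2A/√z at z = m².
  set C := 1 / (2 * m) + 2 * A / (2 * m ^ 3) with hC
  have hpt : ∀ x, phaseDensity A x ≤ (m - 2 * A / m) + C * ((1 - 2 * A) / 2 * cos (2 * x)) := by
    intro x
    have hY := hYpos x
    have hZ : phaseY A x ^ 2 - m ^ 2 = (1 - 2 * A) / 2 * cos (2 * x) := by
      rw [phaseY_sq hA hA', hm2, cos_two_mul]; ring
    rw [← hZ, phaseDensity]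
    set Y := phaseY A x
    have h1 : Y ≤ m + (Y ^ 2 - m ^ 2) / (2 * m) := by
      have : m + (Y ^ 2 - m ^ 2) / (2 * m) - Y = (Y - m) ^ 2 / (2 * m) := by field_simp; ring
      have h2 : 0 ≤ (Y - m) ^ 2 / (2 * m) := by positivity
      linarith
    have h2 : 1 / m - (Y ^ 2 - m ^ 2) / (2 * m ^ 3) ≤ 1 / Y := by
      have : 1 / Y - (1 / m - (Y ^ 2 - m ^ 2) / (2 * m ^ 3)) =
          (Y - m) ^ 2 * (Y + 2 * m) / (2 * m ^ 3 * Y) := by field_simp; ring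
      have h2 : 0 ≤ (Y - m) ^ 2 * (Y + 2 * m) / (2 * m ^ 3 * Y) := by positivity
      linarith
    have h3 := mul_le_mul_of_nonneg_left h2 (show 0 ≤ 2 * A by positivity)
    calc Y - 2 * A / Y = Y - 2 * A * (1 / Y) := by ring
      _ ≤ (m + (Y ^ 2 - m ^ 2) / (2 * m)) - 2 * A * (1 / m - (Y ^ 2 - m ^ 2) / (2 * m ^ 3)) := by
        linarith
      _ = _ := by rw [hC]; ring
  have hint : ∫ x in -(π / 2)..(π / 2), ((m - 2 * A / m) + C * ((1 - 2 * A) / 2 * cos (2 * x))) =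
      π * (m - 2 * A / m) := by
    rw [intervalIntegral.integral_add (by simp) (Continuous.intervalIntegrable (by fun_prop) _ _),
      intervalIntegral.integral_const, intervalIntegral.integral_const_mul,
      intervalIntegral.integral_const_mul,
      intervalIntegral.integral_comp_mul_left (fun x => cos x) two_ne_zero, integral_cos]
    simp
    ring_nf
    simp
  have hcont : Continuous (phaseDensity A) :=
    continuous_phaseY.sub (continuous_const.div continuous_phaseY fun x => (hYpos x).ne')
  calc _ ≤ _ := intervalIntegral.integral_mono_on (by linarith [pi_pos])
        (hcont.intervalIntegrable _ _) (Continuous.intervalIntegrable (by fun_prop) _ _)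
        fun x _ => hpt x
    _ = π * (m - 2 * A / m) := hint
    _ < √2 / 2 * π := by
      rw [mul_comm]
      refine mul_lt_mul_of_pos_right ?_ pi_pos
      refine lt_of_pow_lt_pow_left₀ 2 (by positivity) ?_
      rw [div_pow, sq_sqrt (by norm_num : (0 : ℝ) ≤ 2), show m - 2 * A / m = (m ^ 2 - 2 * A) / m by
        field_simp, div_pow, hm2, div_lt_iff₀ (by positivity)]
      -- What remains is (1 + 2A)² < 1 + 6A, that is 4A² < 2A, true for 0 < A < 1/2.
      nlinarith

end IsProfile

/-! ### Partial derivatives, and the profile data of an Otsuki geodesic. -/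

theorem partialDeriv_eq_of_hasDerivAt {E : Type*} [NormedAddCommGroup E] [NormedSpace ℝ E]
    {F : (Fin 2 → ℝ) → E} {x : Fin 2 → ℝ} {i : Fin 2} {F' : E} (hF : DifferentiableAt ℝ F x)
    (h : HasDerivAt (fun s => F (Function.update x i s)) F' (x i)) : partialDeriv i F x = F' := by
  have h1 : HasDerivAt (fun s => F (Function.update x i s)) (partialDeriv i F x) (x i) := by
    have h2 : HasFDerivAt F (fderiv ℝ F x) (Function.update x i (x i)) := by
      rw [Function.update_eq_self]; exact hF.hasFDerivAt
    exact h2.comp_hasDerivAt (x i) (hasDerivAt_update x i (x i))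
  exact h1.unique h

theorem differentiableAt_comp_apply {f : ℝ → ℝ} {f' : ℝ} {x : Fin 2 → ℝ} {j : Fin 2}
    (h : HasDerivAt f f' (x j)) : DifferentiableAt ℝ (fun y : Fin 2 → ℝ => f (y j)) x :=
  DifferentiableAt.comp x h.differentiableAt (differentiableAt_apply j x)

theorem partialDeriv_comp_apply {f : ℝ → ℝ} {f' : ℝ} {x : Fin 2 → ℝ} {i j : Fin 2}
    (h : HasDerivAt f f' (x j)) :
    partialDeriv i (fun y => f (y j)) x = if i = j then f' else 0 := by
  refine partialDeriv_eq_of_hasDerivAt (differentiableAt_comp_apply h) ?_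
  split_ifs with hij
  · subst hij; simpa using h
  · simp only [Function.update_of_ne (Ne.symm hij)]
    exact hasDerivAt_const _ _

theorem partialDeriv_const (i : Fin 2) (a : ℝ) (x : Fin 2 → ℝ) :
    partialDeriv i (fun _ => a) x = 0 := by simp [partialDeriv]

theorem orbitMetric_inv {x : Fin 2 → ℝ} (hs : sin (x 0) ≠ 0) (hc : cos (x 0) ≠ 0) :
    (orbitMetric x)⁻¹ = !![1 / (4 * π ^ 2 * sin (x 0) ^ 2), 0;
      0, 1 / (4 * π ^ 2 * sin (x 0) ^ 2 * cos (x 0) ^ 2)] := by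
  have := pi_ne_zero
  refine Matrix.inv_eq_right_inv ?_
  ext i j
  fin_cases i <;> fin_cases j <;> simp [orbitMetric, Matrix.mul_apply, Fin.sum_univ_two] <;>
    field_simp

theorem partialDeriv_orbitMetric (i : Fin 2) (x : Fin 2 → ℝ) :
    partialDeriv i (fun y => orbitMetric y 0 0) x =
      (if i = 0 then 8 * π ^ 2 * sin (x 0) * cos (x 0) else 0) ∧
    partialDeriv i (fun y => orbitMetric y 1 1) x =
      (if i = 0 then 8 * π ^ 2 * sin (x 0) * cos (x 0) * (cos (x 0) ^ 2 - sin (x 0) ^ 2) else 0) ∧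
    partialDeriv i (fun y => orbitMetric y 0 1) x = 0 ∧
    partialDeriv i (fun y => orbitMetric y 1 0) x = 0 := by
  have d1 : HasDerivAt (fun t => 4 * π ^ 2 * sin t ^ 2) (8 * π ^ 2 * sin (x 0) * cos (x 0)) (x 0) :=
    (((hasDerivAt_sin (x 0)).pow 2).const_mul (4 * π ^ 2)).congr_deriv (by simp; ring)
  have d2 : HasDerivAt (fun t => 4 * π ^ 2 * sin t ^ 2 * cos t ^ 2)
      (8 * π ^ 2 * sin (x 0) * cos (x 0) * (cos (x 0) ^ 2 - sin (x 0) ^ 2)) (x 0) :=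
    (d1.mul ((hasDerivAt_cos (x 0)).pow 2)).congr_deriv (by simp; ring)
  refine ⟨partialDeriv_comp_apply d1, partialDeriv_comp_apply d2, ?_, ?_⟩ <;>
    simp [orbitMetric, partialDeriv_const]

theorem geodesic_equations {c : ℝ → Fin 2 → ℝ} (H : IsUnitSpeedGeodesic orbitMetric c) {t : ℝ}
    (hs : sin (c t 0) ≠ 0) (hc : cos (c t 0) ≠ 0) :
    deriv (deriv fun s => c s 0) t = -(cos (c t 0) / sin (c t 0)) * deriv (fun s => c s 0) t ^ 2 +
      cos (c t 0) / sin (c t 0) * (cos (c t 0) ^ 2 - sin (c t 0) ^ 2) *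
        deriv (fun s => c s 1) t ^ 2 ∧
    deriv (deriv fun s => c s 1) t = -2 * ((cos (c t 0) ^ 2 - sin (c t 0) ^ 2) /
      (sin (c t 0) * cos (c t 0))) * deriv (fun s => c s 0) t * deriv (fun s => c s 1) t := by
  have hp := pi_ne_zero
  have h0 := H.geodesic_eq t 0
  have h1 := H.geodesic_eq t 1
  simp only [Fin.sum_univ_two, christoffel, orbitMetric_inv hs hc,
    (partialDeriv_orbitMetric _ _).1, (partialDeriv_orbitMetric _ _).2.1,
    (partialDeriv_orbitMetric _ _).2.2.1, (partialDeriv_orbitMetric _ _).2.2.2] at h0 h1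
  simp at h0 h1
  constructor
  · rw [← sub_eq_zero, ← h0]
    field_simp
    ring
  · rw [← sub_eq_zero, ← h1]
    field_simp
    ring

theorem unit_speed_equation {c : ℝ → Fin 2 → ℝ} (H : IsUnitSpeedGeodesic orbitMetric c) (t : ℝ) :
    4 * π ^ 2 * sin (c t 0) ^ 2 * (deriv (fun s => c s 0) t ^ 2 +
      cos (c t 0) ^ 2 * deriv (fun s => c s 1) t ^ 2) = 1 := by
  have := H.unit_speed t
  simp [Fin.sum_univ_two, orbitMetric] at this
  linear_combination this

/-- The profile data of an Otsuki torus. -/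
theorem IsOtsukiGeodesic.exists_profile {p q : ℕ} {a : ℝ} {c : ℝ → Fin 2 → ℝ}
    (H : IsOtsukiGeodesic p q a c) : ∃ σ : ℝ, (σ = 1 ∨ σ = -1) ∧ ∃ v Λ : ℝ → ℝ,
      IsProfile (sin a * cos a) (fun t => c t 0) v Λ ∧ ∀ t, c t 1 = c 0 1 + σ * Λ t := by
  set A := sin a * cos a with hA
  set ν : ℝ → ℝ := fun t => c t 0 with hν
  set l : ℝ → ℝ := fun t => c t 1 with hl
  have hcd := H.geodesic.smooth
  have cν : ContDiff ℝ ∞ ν := contDiff_pi.1 hcd 0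
  have cl : ContDiff ℝ ∞ l := contDiff_pi.1 hcd 1
  have dν : ∀ t, HasDerivAt ν (deriv ν t) t := fun t =>
    (cν.differentiable (by simp) t).hasDerivAt
  have dl : ∀ t, HasDerivAt l (deriv l t) t := fun t => (cl.differentiable (by simp) t).hasDerivAt
  have cν' : ContDiff ℝ ∞ (deriv ν) := (contDiff_infty_iff_deriv.1 cν).2
  have cl' : ContDiff ℝ ∞ (deriv l) := (contDiff_infty_iff_deriv.1 cl).2
  have ddν : ∀ t, HasDerivAt (deriv ν) (deriv (deriv ν) t) t := fun t =>
    (cν'.differentiable (by simp) t).hasDerivAt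
  have ddl : ∀ t, HasDerivAt (deriv l) (deriv (deriv l) t) t := fun t =>
    (cl'.differentiable (by simp) t).hasDerivAt
  have hs : ∀ t, 0 < sin (ν t) := fun t => sin_pos_of_pos_of_lt_pi (H.mem_chart t).1
    (by linarith [(H.mem_chart t).2, pi_pos])
  have hc : ∀ t, 0 < cos (ν t) := fun t =>
    cos_pos_of_mem_Ioo ⟨by linarith [(H.mem_chart t).1, pi_pos], (H.mem_chart t).2⟩
  have ha0 : 0 < a := H.a_mem.1
  have hsa : 0 < sin a := sin_pos_of_pos_of_lt_pi ha0 (by linarith [H.a_mem.2, pi_pos])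
  have hca : 0 < cos a := cos_pos_of_mem_Ioo ⟨by linarith [pi_pos], by linarith [H.a_mem.2, pi_pos]⟩
  have hA0 : 0 < A := mul_pos hsa hca
  have hsc_lt : sin a < cos a := by
    rw [← sin_pi_div_two_sub]
    exact sin_lt_sin_of_lt_of_le_pi_div_two (by linarith [pi_pos]) (by linarith)
      (by linarith [H.a_mem.2])
  have hpi := pi_pos
  have geo := fun t => geodesic_equations H.geodesic (hs t).ne' (hc t).ne'
  have unit := unit_speed_equation H.geodesic
  have ν0 : ν 0 = a := H.start
  have ν'0 : deriv ν 0 = 0 := by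
    refine IsLocalMin.deriv_eq_zero (Filter.Eventually.of_forall fun t => ?_)
    rw [ν0]; exact H.le_apply t
  -- Clairaut's integral for the Killing field ∂/∂λ, up to the factor 4π². Unit speed at t = 0,
  -- where ν' = 0, gives (2πJ)² = A².
  set J : ℝ → ℝ := fun t => sin (ν t) ^ 2 * cos (ν t) ^ 2 * deriv l t with hJ
  have dJ : ∀ t, HasDerivAt J 0 t := by
    intro t
    refine ((((dν t).sin.pow 2).mul ((dν t).cos.pow 2)).mul (ddl t)).congr_deriv ?_
    have h1 : deriv (deriv l) t = _ := (geo t).2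
    have := (hs t).ne'
    have := (hc t).ne'
    rw [h1]
    simp only [Pi.mul_apply, Pi.pow_apply, Nat.cast_ofNat, Nat.add_one_sub_one, pow_one]
    change _ + sin (ν t) ^ 2 * cos (ν t) ^ 2 * (-2 * ((cos (ν t) ^ 2 - sin (ν t) ^ 2) /
      (sin (ν t) * cos (ν t))) * deriv ν t * deriv l t) = 0
    field_simp
    ring
  have hJc : ∀ t, J t = J 0 := fun t =>
    is_const_of_deriv_eq_zero (fun t => (dJ t).differentiableAt) (fun t => (dJ t).deriv) t 0
  have hJ0 : (2 * π * J 0) ^ 2 = A ^ 2 := by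
    have h1 : 4 * π ^ 2 * sin (ν 0) ^ 2 * (deriv ν 0 ^ 2 + cos (ν 0) ^ 2 * deriv l 0 ^ 2) = 1 :=
      unit 0
    rw [ν0, ν'0] at h1
    simp only [hJ, ν0, hA]
    linear_combination (sin a ^ 2 * cos a ^ 2) * h1
  -- σ is the direction in which λ turns; Λ = σ (λ - λ(0)) is increasing in either case.
  obtain ⟨σ, hσ, hσJ⟩ : ∃ σ : ℝ, (σ = 1 ∨ σ = -1) ∧ 2 * π * J 0 = σ * A := by
    rcases sq_eq_sq_iff_eq_or_eq_neg.1 hJ0 with h | h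
    · exact ⟨1, Or.inl rfl, by rw [h, one_mul]⟩
    · exact ⟨-1, Or.inr rfl, by rw [h]; ring⟩
  have hσ2 : σ * σ = 1 := by rcases hσ with rfl | rfl <;> norm_num
  have hl' : ∀ t, deriv l t = σ * (profileWeight ν t * (A / cos (ν t) ^ 2)) := by
    intro t
    have h1 := hJc t
    have h2 := (hs t).ne'
    have h3 := (hc t).ne'
    have h4 : deriv l t = J 0 / (sin (ν t) ^ 2 * cos (ν t) ^ 2) := by
      rw [← h1, hJ]; field_simp
    have h5 : J 0 = σ * A / (2 * π) := by rw [← hσJ]; field_simp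
    rw [h4, h5, profileWeight]
    field_simp
  set v : ℝ → ℝ := fun t => 2 * π * sin (ν t) ^ 2 * deriv ν t with hv
  have hwv : ∀ t, deriv ν t = profileWeight ν t * v t := by
    intro t
    have h2 := (hs t).ne'
    simp only [hv, profileWeight]
    field_simp
  have energy : ∀ t, v t ^ 2 = sin (ν t) ^ 2 - A ^ 2 / cos (ν t) ^ 2 := by
    intro t
    have h1 : 4 * π ^ 2 * sin (ν t) ^ 2 * (deriv ν t ^ 2 + cos (ν t) ^ 2 * deriv l t ^ 2) = 1 :=
      unit t
    have h2 := (hs t).ne'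
    have h3 := (hc t).ne'
    rw [hwv, hl', mul_pow σ, sq σ, hσ2, profileWeight] at h1
    field_simp at h1 ⊢
    linear_combination h1 / 4
  have csin : ContDiff ℝ ∞ fun t => sin (ν t) := Real.contDiff_sin.comp cν
  refine ⟨σ, hσ, v, fun t => σ * (l t - l 0), ?_, fun t => ?_⟩
  · exact {
      A_pos := hA0
      A_lt := by
        have := sin_sq_add_cos_sq a
        nlinarith [mul_pos (sub_pos.2 hsc_lt) (sub_pos.2 hsc_lt)]
      contDiff_nu := cν
      contDiff_v := (contDiff_const.mul (csin.pow 2)).mul cν'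
      contDiff_Lambda := contDiff_const.mul (cl.sub contDiff_const)
      mem := H.mem_chart
      deriv_nu := fun t => (dν t).congr_deriv (hwv t)
      deriv_v := fun t => by
        refine ((((dν t).sin.pow 2).const_mul (2 * π)).mul (ddν t)).congr_deriv ?_
        have h1 : deriv (deriv ν) t = -(cos (ν t) / sin (ν t)) * deriv ν t ^ 2 +
          cos (ν t) / sin (ν t) * (cos (ν t) ^ 2 - sin (ν t) ^ 2) * deriv l t ^ 2 := (geo t).1
        have h2 := (hs t).ne'
        have h3 := (hc t).ne'
        have h4 := energy t
        rw [h1, hl', hwv, mul_pow σ, sq σ, hσ2, profileWeight]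
        simp only [Pi.pow_apply, Nat.cast_ofNat, Nat.add_one_sub_one, pow_one]
        have h5 : v t ^ 2 * cos (ν t) ^ 2 = sin (ν t) ^ 2 * cos (ν t) ^ 2 - A ^ 2 := by
          rw [h4]; field_simp
        field_simp
        linear_combination (cos (ν t) ^ 2) * h5
      deriv_Lambda := fun t => (((dl t).sub_const (l 0)).const_mul σ).congr_deriv (by
        rw [hl', ← mul_assoc, hσ2, one_mul])
      energy := energy
      v_zero := by simp [hv, ν'0]
      Lambda_zero := by simp
      start := by
        rw [ν0, hA, sq]
        exact mul_lt_mul_of_pos_left hsc_lt hsa }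
  · linear_combination (l 0 - l t) * hσ2

/-! ### The unit normal, the bipolar surface and its metric. -/

theorem hasDerivAt_mul_update {f g : ℝ → ℝ} {f' g' : ℝ} {x : Fin 2 → ℝ} (hf : HasDerivAt f f' (x 0))
    (hg : HasDerivAt g g' (x 1)) :
    partialDeriv 0 (fun y => f (y 0) * g (y 1)) x = f' * g (x 1) ∧
    partialDeriv 1 (fun y => f (y 0) * g (y 1)) x = f (x 0) * g' := by
  have hd : DifferentiableAt ℝ (fun y : Fin 2 → ℝ => f (y 0) * g (y 1)) x :=
    (differentiableAt_comp_apply hf).mul (differentiableAt_comp_apply hg)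
  constructor
  · refine partialDeriv_eq_of_hasDerivAt hd ?_
    simpa using hf.mul_const (g (x 1))
  · refine partialDeriv_eq_of_hasDerivAt hd ?_
    simpa using hg.const_mul (f (x 0))

theorem partialDeriv_euclidean {ι : Type*} [Fintype ι] {X : (Fin 2 → ℝ) → EuclideanSpace ℝ ι}
    {x : Fin 2 → ℝ} (hX : DifferentiableAt ℝ X x) (i : Fin 2) (k : ι) :
    partialDeriv i X x k = partialDeriv i (fun y => X y k) x := by
  have h : HasFDerivAt (fun y => X y k)
      ((EuclideanSpace.proj (𝕜 := ℝ) k : EuclideanSpace ℝ ι →L[ℝ] ℝ).comp (fderiv ℝ X x)) x :=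
    (EuclideanSpace.proj (𝕜 := ℝ) k : EuclideanSpace ℝ ι →L[ℝ] ℝ).hasFDerivAt.comp x
      hX.hasFDerivAt
  unfold partialDeriv
  rw [h.fderiv]
  rfl

theorem sum_pairs (F : Fin 4 → Fin 4 → ℝ) :
    ∑ ij : {ij : Fin 4 × Fin 4 // ij.1 < ij.2}, F ij.1.1 ij.1.2 =
      F 0 1 + F 0 2 + F 0 3 + F 1 2 + F 1 3 + F 2 3 := by
  have h : ∑ ij : {ij : Fin 4 × Fin 4 // ij.1 < ij.2}, F ij.1.1 ij.1.2 =
      ∑ ij ∈ (Finset.univ : Finset (Fin 4 × Fin 4)).filter (fun ij => ij.1 < ij.2),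
        F ij.1 ij.2 :=
    (Finset.sum_subtype _ (by simp) fun ij : Fin 4 × Fin 4 => F ij.1 ij.2).symm
  have h2 : (Finset.univ : Finset (Fin 4 × Fin 4)).filter (fun ij => ij.1 < ij.2) =
      {(0, 1), (0, 2), (0, 3), (1, 2), (1, 3), (2, 3)} := by decide
  rw [h, h2]
  simp
  ring

/-- Coordinates of a bipolar surface of revolution. -/
def bipolarEntry (Y Z F : ℝ → ℝ) (x : Fin 2 → ℝ) : Matrix (Fin 4) (Fin 4) ℝ :=
  !![0, 0, cos (x 0) * Y (x 1), cos (x 0) * Z (x 1);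
    0, 0, sin (x 0) * Y (x 1), sin (x 0) * Z (x 1);
    0, 0, 0, 1 * F (x 1);
    0, 0, 0, 0]

/-- The surface `(e^{iα} ⊗ (Y + i Z), F)` in `Λ²ℝ⁴`. -/
def bipolarModel (Y Z F : ℝ → ℝ) (x : Fin 2 → ℝ) :
    EuclideanSpace ℝ {ij : Fin 4 × Fin 4 // ij.1 < ij.2} :=
  WithLp.toLp 2 fun ij => bipolarEntry Y Z F x ij.1.1 ij.1.2

/-- Every nonzero entry is a function of α times a function of t (hence the factor 1 in front of F),
so the product rule for such functions settles all cases. -/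
theorem partialDeriv_bipolarEntry {Y Z F : ℝ → ℝ} {Y' Z' F' : ℝ} {x : Fin 2 → ℝ}
    (hY : HasDerivAt Y Y' (x 1)) (hZ : HasDerivAt Z Z' (x 1)) (hF : HasDerivAt F F' (x 1))
    (i j : Fin 4) :
    partialDeriv 0 (fun y => bipolarEntry Y Z F y i j) x =
      !![0, 0, -sin (x 0) * Y (x 1), -sin (x 0) * Z (x 1);
        0, 0, cos (x 0) * Y (x 1), cos (x 0) * Z (x 1);
        0, 0, 0, 0;
        0, 0, 0, 0] i j ∧
    partialDeriv 1 (fun y => bipolarEntry Y Z F y i j) x =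
      !![0, 0, cos (x 0) * Y', cos (x 0) * Z';
        0, 0, sin (x 0) * Y', sin (x 0) * Z';
        0, 0, 0, F';
        0, 0, 0, 0] i j := by
  have c1 := hasDerivAt_mul_update (hasDerivAt_cos (x 0)) hY
  have c2 := hasDerivAt_mul_update (hasDerivAt_cos (x 0)) hZ
  have c3 := hasDerivAt_mul_update (hasDerivAt_sin (x 0)) hY
  have c4 := hasDerivAt_mul_update (hasDerivAt_sin (x 0)) hZ
  have c5 := hasDerivAt_mul_update (hasDerivAt_const (x 0) (1 : ℝ)) hF
  rw [zero_mul, one_mul] at c5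
  fin_cases i <;> fin_cases j <;>
    first
    | exact c1
    | exact c2
    | exact c3
    | exact c4
    | exact c5
    | exact ⟨partialDeriv_const _ _ _, partialDeriv_const _ _ _⟩

theorem differentiableAt_bipolarModel {Y Z F : ℝ → ℝ} {Y' Z' F' : ℝ} {x : Fin 2 → ℝ}
    (hY : HasDerivAt Y Y' (x 1)) (hZ : HasDerivAt Z Z' (x 1)) (hF : HasDerivAt F F' (x 1)) :
    DifferentiableAt ℝ (bipolarModel Y Z F) x := by
  rw [differentiableAt_euclidean]
  rintro ⟨⟨i, j⟩, -⟩
  have m : ∀ {f g : ℝ → ℝ} {f' g' : ℝ}, HasDerivAt f f' (x 0) → HasDerivAt g g' (x 1) →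
      DifferentiableAt ℝ (fun y : Fin 2 → ℝ => f (y 0) * g (y 1)) x := fun hf hg =>
    (differentiableAt_comp_apply hf).mul (differentiableAt_comp_apply hg)
  change DifferentiableAt ℝ (fun y => bipolarEntry Y Z F y i j) x
  fin_cases i <;> fin_cases j <;>
    first
    | exact m (hasDerivAt_cos _) hY
    | exact m (hasDerivAt_cos _) hZ
    | exact m (hasDerivAt_sin _) hY
    | exact m (hasDerivAt_sin _) hZ
    | exact m (hasDerivAt_const _ (1 : ℝ)) hF
    | exact differentiableAt_const _

theorem inducedMetric_bipolarModel {Y Z F : ℝ → ℝ} {Y' Z' F' : ℝ} {x : Fin 2 → ℝ}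
    (hY : HasDerivAt Y Y' (x 1)) (hZ : HasDerivAt Z Z' (x 1)) (hF : HasDerivAt F F' (x 1)) :
    inducedMetric (bipolarModel Y Z F) x =
      !![Y (x 1) ^ 2 + Z (x 1) ^ 2, 0; 0, Y' ^ 2 + Z' ^ 2 + F' ^ 2] := by
  have hd := differentiableAt_bipolarModel hY hZ hF
  have key : ∀ i j, inducedMetric (bipolarModel Y Z F) x i j =
      ∑ k : {ij : Fin 4 × Fin 4 // ij.1 < ij.2},
        (fun a b => partialDeriv i (fun y => bipolarEntry Y Z F y a b) x *
          partialDeriv j (fun y => bipolarEntry Y Z F y a b) x) k.1.1 k.1.2 := by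
    intro i j
    rw [inducedMetric, Matrix.of_apply, PiLp.inner_apply]
    refine Finset.sum_congr rfl fun k _ => ?_
    rw [partialDeriv_euclidean hd, partialDeriv_euclidean hd]
    exact mul_comm _ _
  have p := fun a b => partialDeriv_bipolarEntry hY hZ hF a b
  have hsc := sin_sq_add_cos_sq (x 0)
  ext i j
  rw [key, sum_pairs (fun a b => partialDeriv i (fun y => bipolarEntry Y Z F y a b) x *
          partialDeriv j (fun y => bipolarEntry Y Z F y a b) x)]
  fin_cases i <;> fin_cases j <;> simp [(p _ _).1, (p _ _).2]
  · linear_combination (Y (x 1) ^ 2 + Z (x 1) ^ 2) * hsc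
  · ring
  · ring
  · linear_combination (Y' ^ 2 + Z' ^ 2) * hsc

theorem mem_periodGroup_bipolarModel {Y Z F : ℝ → ℝ} {γ : Fin 2 → ℝ} :
    γ ∈ periodGroup (bipolarModel Y Z F) ↔
      (∀ α t, cos (γ 0 + α) * Y (γ 1 + t) = cos α * Y t ∧
        cos (γ 0 + α) * Z (γ 1 + t) = cos α * Z t ∧ sin (γ 0 + α) * Y (γ 1 + t) = sin α * Y t ∧
        sin (γ 0 + α) * Z (γ 1 + t) = sin α * Z t) ∧ ∀ t, F (γ 1 + t) = F t := by
  constructor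
  · intro h
    have h' : ∀ α t (i j : Fin 4), i < j → bipolarEntry Y Z F (γ + ![α, t]) i j =
        bipolarEntry Y Z F ![α, t] i j := fun α t i j hij =>
      congrArg (fun u : EuclideanSpace ℝ {ij : Fin 4 × Fin 4 // ij.1 < ij.2} => u ⟨(i, j), hij⟩)
        (h ![α, t])
    refine ⟨fun α t => ⟨?_, ?_, ?_, ?_⟩, fun t => ?_⟩
    · simpa [bipolarEntry] using h' α t 0 2 (by decide)
    · simpa [bipolarEntry] using h' α t 0 3 (by decide)
    · simpa [bipolarEntry] using h' α t 1 2 (by decide)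
    · simpa [bipolarEntry] using h' α t 1 3 (by decide)
    · simpa [bipolarEntry] using h' 0 t 2 3 (by decide)
  · rintro ⟨h1, h2⟩ x
    obtain ⟨e1, e2, e3, e4⟩ := h1 (x 0) (x 1)
    have h3 : bipolarEntry Y Z F (γ + x) = bipolarEntry Y Z F x := by
      simp only [bipolarEntry, Pi.add_apply, e1, e2, e3, e4, h2]
    simp only [bipolarModel, h3]

/-- In the frame of radial and angular directions of the two coordinate planes of ℝ⁴, the
orthogonality conditions fix N up to a factor K. Unit length gives K² = 1, and K is continuous on
the connected plane, hence a constant sign. -/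
theorem IsUnitNormal.exists_components {A : ℝ} {v Λ : ℝ → ℝ} {c : ℝ → Fin 2 → ℝ} {σ : ℝ}
    (hσ : σ = 1 ∨ σ = -1) (D : IsProfile A (fun t => c t 0) v Λ)
    (hc : ∀ t, c t 1 = c 0 1 + σ * Λ t) {N : (Fin 2 → ℝ) → EuclideanSpace ℝ (Fin 4)}
    (hN : IsUnitNormal (otsukiImmersion c) N) : ∃ κ : ℝ, (κ = 1 ∨ κ = -1) ∧ ∀ x,
      N x 0 = cos (x 0) * -(κ * σ * A / sin (c (x 1) 0)) ∧
      N x 1 = sin (x 0) * -(κ * σ * A / sin (c (x 1) 0)) ∧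
      N x 2 = cos (c (x 1) 1) * (κ * σ * A / cos (c (x 1) 0)) -
        sin (c (x 1) 1) * (κ * v (x 1) / sin (c (x 1) 0)) ∧
      N x 3 = sin (c (x 1) 1) * (κ * σ * A / cos (c (x 1) 0)) +
        cos (c (x 1) 1) * (κ * v (x 1) / sin (c (x 1) 0)) := by
  have hA := D.A_pos
  have hσ2 : σ * σ = 1 := by rcases hσ with rfl | rfl <;> norm_num
  have hs : ∀ t, 0 < sin (c t 0) := D.sin_pos
  have hcos : ∀ t, 0 < cos (c t 0) := D.cos_pos
  have dl : ∀ t, HasDerivAt (fun t => c t 1)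
      (σ * (profileWeight (fun t => c t 0) t * (A / cos (c t 0) ^ 2))) t := by
    intro t
    rw [funext hc]
    exact ((D.deriv_Lambda t).const_mul σ).const_add _
  set X0 : (Fin 2 → ℝ) → Fin 4 → ℝ := fun x =>
    ![cos (x 0) * sin (c (x 1) 0), sin (x 0) * sin (c (x 1) 0),
    1 * (cos (c (x 1) 0) * cos (c (x 1) 1)), 1 * (cos (c (x 1) 0) * sin (c (x 1) 1))] with hX0
  have hXX : ∀ x k, otsukiImmersion c x k = X0 x k := by
    intro x k; fin_cases k <;> simp [otsukiImmersion, hX0]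
  have g1 : ∀ t, HasDerivAt (fun t => sin (c t 0)) _ t := D.deriv_sin
  have g2 : ∀ t, HasDerivAt (fun t => cos (c t 0) * cos (c t 1)) _ t := fun t =>
    (D.deriv_cos t).mul (dl t).cos
  have g3 : ∀ t, HasDerivAt (fun t => cos (c t 0) * sin (c t 1)) _ t := fun t =>
    (D.deriv_cos t).mul (dl t).sin
  have hdX : ∀ x, DifferentiableAt ℝ (otsukiImmersion c) x := by
    intro x
    rw [differentiableAt_euclidean]
    intro k
    simp only [hXX]
    fin_cases k
    · exact (differentiableAt_comp_apply (hasDerivAt_cos _)).mul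
        (differentiableAt_comp_apply (g1 _))
    · exact (differentiableAt_comp_apply (hasDerivAt_sin _)).mul
        (differentiableAt_comp_apply (g1 _))
    · exact (differentiableAt_const _).mul (differentiableAt_comp_apply (g2 _))
    · exact (differentiableAt_const _).mul (differentiableAt_comp_apply (g3 _))
  have e1 : ∀ x, cos (x 0) * sin (c (x 1) 0) * N x 0 + sin (x 0) * sin (c (x 1) 0) * N x 1 +
      cos (c (x 1) 0) * cos (c (x 1) 1) * N x 2 + cos (c (x 1) 0) * sin (c (x 1) 1) * N x 3 = 0 := by
    intro x
    have := hN.inner_position x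
    simp only [PiLp.inner_apply, Fin.sum_univ_four, otsukiImmersion] at this
    simp at this
    linear_combination this
  have e2 : ∀ x, -sin (x 0) * N x 0 + cos (x 0) * N x 1 = 0 := by
    intro x
    have := hN.inner_tangent x 0
    simp only [PiLp.inner_apply, Fin.sum_univ_four, partialDeriv_euclidean (hdX x), hXX] at this
    simp only [hX0, Matrix.cons_val] at this
    rw [(hasDerivAt_mul_update (hasDerivAt_cos (x 0)) (g1 (x 1))).1,
      (hasDerivAt_mul_update (hasDerivAt_sin (x 0)) (g1 (x 1))).1,
      (hasDerivAt_mul_update (hasDerivAt_const (x 0) (1 : ℝ)) (g2 (x 1))).1,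
      (hasDerivAt_mul_update (hasDerivAt_const (x 0) (1 : ℝ)) (g3 (x 1))).1] at this
    simp at this
    have h2 : sin (c (x 1) 0) * (-sin (x 0) * N x 0 + cos (x 0) * N x 1) = 0 := by
      linear_combination this
    exact (mul_eq_zero.1 h2).resolve_left (hs _).ne'
  have e3 : ∀ x, cos (c (x 1) 0) * v (x 1) * (cos (x 0) * N x 0 + sin (x 0) * N x 1) -
      sin (c (x 1) 0) * v (x 1) * (cos (c (x 1) 1) * N x 2 + sin (c (x 1) 1) * N x 3) +
      σ * (A / cos (c (x 1) 0)) * (-sin (c (x 1) 1) * N x 2 + cos (c (x 1) 1) * N x 3) = 0 := by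
    intro x
    have := hN.inner_tangent x 1
    simp only [PiLp.inner_apply, Fin.sum_univ_four, partialDeriv_euclidean (hdX x), hXX] at this
    simp only [hX0, Matrix.cons_val] at this
    rw [(hasDerivAt_mul_update (hasDerivAt_cos (x 0)) (g1 (x 1))).2,
      (hasDerivAt_mul_update (hasDerivAt_sin (x 0)) (g1 (x 1))).2,
      (hasDerivAt_mul_update (hasDerivAt_const (x 0) (1 : ℝ)) (g2 (x 1))).2,
      (hasDerivAt_mul_update (hasDerivAt_const (x 0) (1 : ℝ)) (g3 (x 1))).2] at this
    simp at this
    have hw := D.weight_pos (x 1)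
    have hcx := (hcos (x 1)).ne'
    refine (mul_eq_zero.1 (?_ : profileWeight (fun t => c t 0) (x 1) * _ = 0)).resolve_left hw.ne'
    rw [← this]
    field_simp
    ring
  have e4 : ∀ x, N x 0 ^ 2 + N x 1 ^ 2 + N x 2 ^ 2 + N x 3 ^ 2 = 1 := by
    intro x
    have h1 := hN.norm_eq_one x
    have h2 := EuclideanSpace.norm_sq_eq (N x)
    rw [h1] at h2
    simp only [Fin.sum_univ_four, norm_eq_abs, sq_abs] at h2
    linarith
  -- Orthogonality to the position makes the two radial components proportional to (-cos ν, sin ν).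
  -- K is the factor, scaled by σA/(sin ν cos ν) so that it becomes ±1.
  set K : (Fin 2 → ℝ) → ℝ := fun x => (sin (c (x 1) 0) * (cos (c (x 1) 1) * N x 2 +
    sin (c (x 1) 1) * N x 3) - cos (c (x 1) 0) * (cos (x 0) * N x 0 + sin (x 0) * N x 1)) /
    (σ * (A / (sin (c (x 1) 0) * cos (c (x 1) 0)))) with hK
  have hA' : A ≠ 0 := hA.ne'
  have hσ0 : σ ≠ 0 := by rintro rfl; simp at hσ2
  have fP : ∀ x, cos (x 0) * N x 0 + sin (x 0) * N x 1 = -(K x * σ * A / sin (c (x 1) 0)) := by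
    intro x
    have h1 := (hs (x 1)).ne'
    have h2 := (hcos (x 1)).ne'
    have h3 := sin_sq_add_cos_sq (c (x 1) 0)
    have h4 := e1 x
    simp only [hK]
    field_simp
    linear_combination (cos (x 0) * N x 0 + sin (x 0) * N x 1) * (-h3) + sin (c (x 1) 0) * h4
  have fQ : ∀ x, cos (c (x 1) 1) * N x 2 + sin (c (x 1) 1) * N x 3 =
      K x * σ * A / cos (c (x 1) 0) := by
    intro x
    have h1 := (hs (x 1)).ne'
    have h2 := (hcos (x 1)).ne'
    have h3 := sin_sq_add_cos_sq (c (x 1) 0)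
    have h4 := e1 x
    simp only [hK]
    field_simp
    linear_combination (cos (c (x 1) 1) * N x 2 + sin (c (x 1) 1) * N x 3) * (-h3) +
      cos (c (x 1) 0) * h4
  have fR : ∀ x, -sin (c (x 1) 1) * N x 2 + cos (c (x 1) 1) * N x 3 =
      K x * v (x 1) / sin (c (x 1) 0) := by
    intro x
    have h1 := (hs (x 1)).ne'
    have h2 := (hcos (x 1)).ne'
    have h4 := e3 x
    simp only [hK]
    field_simp at h4 ⊢
    linear_combination h4
  have n0 : ∀ x, N x 0 = cos (x 0) * -(K x * σ * A / sin (c (x 1) 0)) := by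
    intro x
    linear_combination (-N x 0) * sin_sq_add_cos_sq (x 0) - sin (x 0) * e2 x + cos (x 0) * fP x
  have n1 : ∀ x, N x 1 = sin (x 0) * -(K x * σ * A / sin (c (x 1) 0)) := by
    intro x
    linear_combination (-N x 1) * sin_sq_add_cos_sq (x 0) + cos (x 0) * e2 x + sin (x 0) * fP x
  have n2 : ∀ x, N x 2 = cos (c (x 1) 1) * (K x * σ * A / cos (c (x 1) 0)) -
      sin (c (x 1) 1) * (K x * v (x 1) / sin (c (x 1) 0)) := by
    intro x
    linear_combination (-N x 2) * sin_sq_add_cos_sq (c (x 1) 1) + cos (c (x 1) 1) * fQ x -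
      sin (c (x 1) 1) * fR x
  have n3 : ∀ x, N x 3 = sin (c (x 1) 1) * (K x * σ * A / cos (c (x 1) 0)) +
      cos (c (x 1) 1) * (K x * v (x 1) / sin (c (x 1) 0)) := by
    intro x
    linear_combination (-N x 3) * sin_sq_add_cos_sq (c (x 1) 1) + sin (c (x 1) 1) * fQ x +
      cos (c (x 1) 1) * fR x
  have K2 : ∀ x, K x ^ 2 = 1 := by
    intro x
    have h1 := (hs (x 1)).ne'
    have h2 := (hcos (x 1)).ne'
    have h3 : (K x * σ * A / sin (c (x 1) 0)) ^ 2 + (K x * σ * A / cos (c (x 1) 0)) ^ 2 +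
        (K x * v (x 1) / sin (c (x 1) 0)) ^ 2 = 1 := by
      rw [← neg_sq, ← fP, ← fQ, ← fR, ← e4 x]
      linear_combination (N x 0 ^ 2 + N x 1 ^ 2) * sin_sq_add_cos_sq (x 0) -
        (-sin (x 0) * N x 0 + cos (x 0) * N x 1) * e2 x +
        (N x 2 ^ 2 + N x 3 ^ 2) * sin_sq_add_cos_sq (c (x 1) 1)
    have h4 := D.v_sq_mul_cos_sq (x 1)
    have h5 := sin_sq_add_cos_sq (c (x 1) 0)
    field_simp at h3
    have h6 : sin (c (x 1) 0) ^ 2 * cos (c (x 1) 0) ^ 2 * (K x ^ 2 - 1) = 0 := by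
      linear_combination h3 - K x ^ 2 * h4 - K x ^ 2 * A ^ 2 * h5 -
        K x ^ 2 * A ^ 2 * (sin (c (x 1) 0) ^ 2 + cos (c (x 1) 0) ^ 2) * hσ2
    have h7 := (mul_eq_zero.1 h6).resolve_left (by positivity)
    linarith
  have hcν : Continuous fun t => c t 0 := D.contDiff_nu.continuous
  have hcl : Continuous fun t => c t 1 :=
    continuous_iff_continuousAt.2 fun t => (dl t).continuousAt
  have hNk : ∀ k, Continuous fun x => N x k := fun k =>
    (EuclideanSpace.proj (𝕜 := ℝ) k : EuclideanSpace ℝ (Fin 4) →L[ℝ] ℝ).continuous.comp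
      hN.continuous
  have hKc : Continuous K := by
    have a0 : Continuous fun x : Fin 2 → ℝ => c (x 1) 0 := hcν.comp (continuous_apply 1)
    have a1 : Continuous fun x : Fin 2 → ℝ => c (x 1) 1 := hcl.comp (continuous_apply 1)
    have b0 := hNk 0
    have b1 := hNk 1
    have b2 := hNk 2
    have b3 := hNk 3
    have s0 := continuous_sin.comp a0
    have c0 := continuous_cos.comp a0
    have s1 := continuous_sin.comp a1
    have c1 := continuous_cos.comp a1
    have sx := continuous_sin.comp (continuous_apply (A := fun _ : Fin 2 => ℝ) 0)
    have cx := continuous_cos.comp (continuous_apply (A := fun _ : Fin 2 => ℝ) 0)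
    exact ((s0.mul ((c1.mul b2).add (s1.mul b3))).sub (c0.mul ((cx.mul b0).add (sx.mul b1)))).div
      (continuous_const.mul (continuous_const.div (s0.mul c0)
        fun x => mul_ne_zero (hs _).ne' (hcos _).ne'))
      fun x => mul_ne_zero hσ0 (div_ne_zero hA' (mul_ne_zero (hs _).ne' (hcos _).ne'))
  obtain ⟨κ, hκ, hKκ⟩ : ∃ κ : ℝ, (κ = 1 ∨ κ = -1) ∧ ∀ x, K x = κ := by
    rcases isPreconnected_univ.eq_one_or_eq_neg_one_of_sq_eq hKc.continuousOn
      (fun x _ => K2 x) with h | h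
    · exact ⟨1, Or.inl rfl, fun x => h (mem_univ x)⟩
    · exact ⟨-1, Or.inr rfl, fun x => h (mem_univ x)⟩
  refine ⟨κ, hκ, fun x => ?_⟩
  rw [n0, n1, n2, n3, hKκ]
  exact ⟨rfl, rfl, rfl, rfl⟩

/-- The bipolar surface of a surface of revolution in explicit form. -/
theorem IsUnitNormal.exists_bipolar_eq {A : ℝ} {v Λ : ℝ → ℝ} {c : ℝ → Fin 2 → ℝ} {σ : ℝ}
    (hσ : σ = 1 ∨ σ = -1) (D : IsProfile A (fun t => c t 0) v Λ)
    (hc : ∀ t, c t 1 = c 0 1 + σ * Λ t) {N : (Fin 2 → ℝ) → EuclideanSpace ℝ (Fin 4)}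
    (hN : IsUnitNormal (otsukiImmersion c) N) : ∃ κ : ℝ, (κ = 1 ∨ κ = -1) ∧
      bipolar (otsukiImmersion c) N = bipolarModel
        (fun t => κ * (σ * (A / (sin (c t 0) * cos (c t 0))) * cos (c t 1) - v t * sin (c t 1)))
        (fun t => κ * (σ * (A / (sin (c t 0) * cos (c t 0))) * sin (c t 1) + v t * cos (c t 1)))
        (fun t => κ * (v t * cos (c t 0) / sin (c t 0))) := by
  obtain ⟨κ, hκ, hcomp⟩ := hN.exists_components hσ D hc
  refine ⟨κ, hκ, ?_⟩
  funext x
  obtain ⟨m0, m1, m2, m3⟩ := hcomp x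
  have h1 := (D.sin_pos (x 1)).ne'
  have h2 := (D.cos_pos (x 1)).ne'
  have h3 := sin_sq_add_cos_sq (c (x 1) 0)
  have h4 := sin_sq_add_cos_sq (c (x 1) 1)
  ext ⟨⟨i, j⟩, hij⟩
  simp only [bipolar, wedge, bipolarModel]
  fin_cases i <;> fin_cases j <;> (first | exact absurd hij (by decide) | skip) <;>
    simp [otsukiImmersion, bipolarEntry, m0, m1, m2, m3] <;> field_simp
  · ring
  · linear_combination (cos (x 0) * κ * cos (c (x 1) 1) * σ * A) * h3
  · linear_combination (cos (x 0) * κ * sin (c (x 1) 1) * σ * A) * h3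
  · linear_combination (sin (x 0) * κ * cos (c (x 1) 1) * σ * A) * h3
  · linear_combination (sin (x 0) * κ * sin (c (x 1) 1) * σ * A) * h3
  · linear_combination (cos (c (x 1) 0) * κ * v (x 1)) * h4

/-- The metric of the bipolar surface in the coordinates `(α, t)`. -/
def profileMetric (A : ℝ) (ν : ℝ → ℝ) (x : Fin 2 → ℝ) : Matrix (Fin 2) (Fin 2) ℝ :=
  !![profileRho A ν (x 1), 0; 0, profileWeight ν (x 1) ^ 2 * profileRho A ν (x 1)]

/-- The signs σ, κ and the rotation by λ disappear in the sums of squares. What is left is that both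
|∂_α|² and |∂_t|²/w² equal ρ, by the energy identity. -/
theorem inducedMetric_bipolar {A : ℝ} {v Λ : ℝ → ℝ} {c : ℝ → Fin 2 → ℝ} {σ κ : ℝ}
    (hσ : σ = 1 ∨ σ = -1) (hκ : κ = 1 ∨ κ = -1) (D : IsProfile A (fun t => c t 0) v Λ)
    (hc : ∀ t, c t 1 = c 0 1 + σ * Λ t) :
    inducedMetric (bipolarModel
        (fun t => κ * (σ * (A / (sin (c t 0) * cos (c t 0))) * cos (c t 1) - v t * sin (c t 1)))
        (fun t => κ * (σ * (A / (sin (c t 0) * cos (c t 0))) * sin (c t 1) + v t * cos (c t 1)))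
        (fun t => κ * (v t * cos (c t 0) / sin (c t 0)))) =
      profileMetric A fun t => c t 0 := by
  have hσ2 : σ * σ = 1 := by rcases hσ with rfl | rfl <;> norm_num
  have hκ2 : κ * κ = 1 := by rcases hκ with rfl | rfl <;> norm_num
  set ν : ℝ → ℝ := fun t => c t 0 with hν
  funext x
  set t := x 1
  have dl : HasDerivAt (fun t => c t 1) (σ * (profileWeight ν t * (A / cos (ν t) ^ 2))) t := by
    rw [funext hc]
    exact ((D.deriv_Lambda t).const_mul σ).const_add _
  have dY : HasDerivAt (fun t => κ * (σ * (A / (sin (ν t) * cos (ν t))) * cos (c t 1) -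
      v t * sin (c t 1))) (κ * (profileWeight ν t * (σ * -(A * v t / sin (ν t) ^ 2) * cos (c t 1) -
        (sin (ν t) * cos (ν t) + A ^ 2 / (sin (ν t) * cos (ν t))) * sin (c t 1)))) t := by
    refine (((((D.deriv_horizontal t).const_mul σ).mul dl.cos).sub
      ((D.deriv_v' t).mul dl.sin)).const_mul κ).congr_deriv ?_
    linear_combination (-κ * profileWeight ν t * (A / (sin (ν t) * cos (ν t))) *
      (A / cos (ν t) ^ 2) * sin (c t 1)) * hσ2
  have dZ : HasDerivAt (fun t => κ * (σ * (A / (sin (ν t) * cos (ν t))) * sin (c t 1) +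
      v t * cos (c t 1))) (κ * (profileWeight ν t * (σ * -(A * v t / sin (ν t) ^ 2) * sin (c t 1) +
        (sin (ν t) * cos (ν t) + A ^ 2 / (sin (ν t) * cos (ν t))) * cos (c t 1)))) t := by
    refine (((((D.deriv_horizontal t).const_mul σ).mul dl.sin).add
      ((D.deriv_v' t).mul dl.cos)).const_mul κ).congr_deriv ?_
    linear_combination (κ * profileWeight ν t * (A / (sin (ν t) * cos (ν t))) *
      (A / cos (ν t) ^ 2) * cos (c t 1)) * hσ2
  have dF := (D.deriv_f t).const_mul κ
  rw [inducedMetric_bipolarModel dY dZ dF, profileMetric]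
  have h1 := D.v_sq_mul_cos_sq t
  have h2 := sin_sq_add_cos_sq (ν t)
  have h3 := sin_sq_add_cos_sq (c t 1)
  have hs := (D.sin_pos t).ne'
  have hc := (D.cos_pos t).ne'
  have e1 : (A / (sin (ν t) * cos (ν t))) ^ 2 + v t ^ 2 = profileRho A ν t := by
    unfold profileRho
    field_simp
    linear_combination (sin (ν t) ^ 2) * h1 - A ^ 2 * h2
  have e2 : (A * v t / sin (ν t) ^ 2) ^ 2 +
      (sin (ν t) * cos (ν t) + A ^ 2 / (sin (ν t) * cos (ν t))) ^ 2 +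
      ((A / sin (ν t) - sin (ν t)) * (A / sin (ν t) + sin (ν t))) ^ 2 = profileRho A ν t := by
    unfold profileRho
    generalize sin (ν t) = s at *
    generalize cos (ν t) = q at *
    generalize v t = V at *
    field_simp
    linear_combination A ^ 2 * h1 + (A ^ 4 + s ^ 6 * q ^ 2) * h2
  have rot : ∀ u V : ℝ, (κ * (σ * u * cos (c t 1) - V * sin (c t 1))) ^ 2 +
      (κ * (σ * u * sin (c t 1) + V * cos (c t 1))) ^ 2 = u ^ 2 + V ^ 2 := fun u V => by
    linear_combination κ * κ * (σ * σ * u ^ 2 + V ^ 2) * h3 + κ * κ * u ^ 2 * hσ2 +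
      (u ^ 2 + V ^ 2) * hκ2
  refine congrArg₂ (fun r r' : ℝ => !![r, 0; 0, r']) ?_ ?_
  · exact (rot _ _).trans e1
  · linear_combination profileWeight ν t ^ 2 * e2 + profileWeight ν t ^ 2 *
      rot (-(A * v t / sin (ν t) ^ 2))
        (sin (ν t) * cos (ν t) + A ^ 2 / (sin (ν t) * cos (ν t))) +
      (profileWeight ν t * ((A / sin (ν t) - sin (ν t)) * (A / sin (ν t) + sin (ν t)))) ^ 2 * hκ2

/-! ### The period lattice and the area. -/

theorem add_zsmul_of_add {f : ℝ → ℝ} {P d : ℝ} (h : ∀ t, f (t + P) = f t + d) (n : ℤ) (t : ℝ) :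
    f (t + n * P) = f t + n * d := by
  induction n using Int.induction_on generalizing t with
  | zero => simp
  | succ n ih =>
    rw [show t + ((n + 1 : ℤ) : ℝ) * P = t + n * P + P by push_cast; ring, h]
    rw [show (t + (n : ℝ) * P) = t + ((n : ℤ) : ℝ) * P by norm_num, ih]
    push_cast; ring
  | pred n ih =>
    have h1 := h (t + ((-(n : ℤ) - 1 : ℤ) : ℝ) * P)
    rw [show t + ((-(n : ℤ) - 1 : ℤ) : ℝ) * P + P = t + ((-(n : ℤ) : ℤ) : ℝ) * P by
      push_cast; ring, ih] at h1
    push_cast at h1 ⊢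
    linarith

namespace IsProfile
variable {A : ℝ} {ν v Λ : ℝ → ℝ}

theorem nu_add_int (D : IsProfile A ν v Λ) (i : ℤ) (t : ℝ) :
    ν (t + i * (2 * D.halfPeriod)) = ν t := by
  simpa using add_zsmul_of_add (d := 0) (fun t => by rw [D.nu_add, add_zero]) i t

theorem v_add_int (D : IsProfile A ν v Λ) (i : ℤ) (t : ℝ) :
    v (t + i * (2 * D.halfPeriod)) = v t := by
  simpa using add_zsmul_of_add (d := 0) (fun t => by rw [D.v_add, add_zero]) i t

theorem Lambda_add_int (D : IsProfile A ν v Λ) (i : ℤ) (t : ℝ) :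
    Λ (t + i * (2 * D.halfPeriod)) = Λ t + i * (2 * Λ D.halfPeriod) :=
  add_zsmul_of_add D.Lambda_symm.2.1 i t

/-- The zeros of sin(phase) are the multiples of T, so a period is jT. For odd j the translation
sends -T/2 to a point where the sign is opposite. -/
theorem eq_zsmul_of_sin_phase_add (D : IsProfile A ν v Λ) {r : ℝ}
    (h : ∀ t, sin (D.phase (r + t)) = sin (D.phase t)) : ∃ i : ℤ, r = i * (2 * D.halfPeriod) := by
  have h0 := h 0
  rw [add_zero, D.phase_zero, Real.sin_zero, Real.sin_eq_zero_iff] at h0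
  obtain ⟨j, hj⟩ := h0
  have hr : r = j * D.halfPeriod := D.phase_strictMono.injective (by rw [← hj, D.phase_mul])
  obtain ⟨i, rfl | rfl⟩ := Int.even_or_odd' j
  · exact ⟨i, by rw [hr]; push_cast; ring⟩
  · have h1 := h (-(D.halfPeriod / 2))
    rw [show r + -(D.halfPeriod / 2) = D.halfPeriod / 2 + i * (2 * D.halfPeriod) by
      rw [hr]; push_cast; ring, add_zsmul_of_add D.phase_add, D.phase_neg, Real.sin_neg,
      Real.sin_add_int_mul_two_pi] at h1
    have hT := D.halfPeriod_pos
    have p0 : 0 < D.phase (D.halfPeriod / 2) := by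
      simpa using D.phase_strictMono (show (0 : ℝ) < D.halfPeriod / 2 by linarith)
    have p1 : D.phase (D.halfPeriod / 2) < π := by
      have := D.phase_mul 1
      simp only [Int.cast_one, one_mul] at this
      rw [← this]
      exact D.phase_strictMono (by linarith)
    linarith [Real.sin_pos_of_pos_of_lt_pi p0 p1]

end IsProfile

/-- The period lattice of the bipolar surface: generated by `(2π, 0)` and `(επ, 2X)`. -/
theorem mem_periodGroup_bipolar {A : ℝ} {v Λ : ℝ → ℝ} {c : ℝ → Fin 2 → ℝ} {σ κ : ℝ}
    (hσ : σ = 1 ∨ σ = -1) (hκ : κ = 1 ∨ κ = -1) (D : IsProfile A (fun t => c t 0) v Λ)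
    (hc : ∀ t, c t 1 = c 0 1 + σ * Λ t) {p q : ℕ} (hq : 0 < q)
    (hT : Λ D.halfPeriod = (p : ℝ) / q * π) {γ : Fin 2 → ℝ} :
    γ ∈ periodGroup (bipolarModel
        (fun t => κ * (σ * (A / (sin (c t 0) * cos (c t 0))) * cos (c t 1) - v t * sin (c t 1)))
        (fun t => κ * (σ * (A / (sin (c t 0) * cos (c t 0))) * sin (c t 1) + v t * cos (c t 1)))
        (fun t => κ * (v t * cos (c t 0) / sin (c t 0)))) ↔
      ∃ k i j : ℤ, γ 0 = k * π ∧ γ 1 = i * (2 * D.halfPeriod) ∧ 2 * i * p = q * j ∧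
        Even (k + j) := by
  rw [mem_periodGroup_bipolarModel]
  have hκ0 : κ ≠ 0 := by rcases hκ with rfl | rfl <;> norm_num
  have hσ0 : σ ≠ 0 := by rcases hσ with rfl | rfl <;> norm_num
  have hq0 : (q : ℝ) ≠ 0 := by positivity
  have hcosσ : ∀ x, cos (σ * x) = cos x := fun x => by rcases hσ with rfl | rfl <;> simp
  have hsinσ : ∀ x, sin (σ * x) = σ * sin x := fun x => by rcases hσ with rfl | rfl <;> simp
  constructor
  · rintro ⟨h, hF⟩
    have hF' : ∀ t, sin (D.phase (γ 1 + t)) = sin (D.phase t) := fun t => by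
      have h1 := mul_left_cancel₀ hκ0 (hF t)
      rw [(D.g_f_eq _).2, (D.g_f_eq _).2] at h1
      exact mul_left_cancel₀ D.sqrt_pos.ne' h1
    obtain ⟨i, hi⟩ := D.eq_zsmul_of_sin_phase_add hF'
    -- At t = 0 the vector (Y, Z) is nonzero. A period turns it by σβ and shifts α by γ 0; the two
    -- effects cancel only if both angles are multiples of π of equal parity.
    obtain ⟨h1, h2, h3, h4⟩ := h 0 0
    have hu : A / (sin (c 0 0) * cos (c 0 0)) ≠ 0 :=
      (div_pos D.A_pos (mul_pos (D.sin_pos 0) (D.cos_pos 0))).ne'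
    have hv : v (γ 1 + 0) = 0 := by rw [hi, add_comm, D.v_add_int, D.v_zero]
    have hn : c (γ 1 + 0) 0 = c 0 0 := by rw [hi, add_comm]; exact D.nu_add_int i 0
    have hl : c (γ 1 + 0) 1 = c 0 1 + σ * (i * (2 * (p / q * π))) := by
      rw [hc, hi, add_zero, ← zero_add ((i : ℝ) * (2 * D.halfPeriod)), D.Lambda_add_int,
        D.Lambda_zero, hT, zero_add]
    rw [hv, hn, hl, D.v_zero] at h1 h2 h3 h4
    simp only [zero_mul, sub_zero, add_zero, Real.cos_zero, Real.sin_zero, one_mul] at h1 h2 h3 h4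
    set β := (i : ℝ) * (2 * (p / q * π))
    set l := c 0 1
    have hC : κ * (σ * (A / (sin (c 0 0) * cos (c 0 0)))) ≠ 0 :=
      mul_ne_zero hκ0 (mul_ne_zero hσ0 hu)
    have k1 : cos (γ 0) * cos (l + σ * β) = cos l := mul_left_cancel₀ hC (by linear_combination h1)
    have k2 : cos (γ 0) * sin (l + σ * β) = sin l := mul_left_cancel₀ hC (by linear_combination h2)
    have k3 : sin (γ 0) * cos (l + σ * β) = 0 := mul_left_cancel₀ hC (by linear_combination h3)
    have k4 : sin (γ 0) * sin (l + σ * β) = 0 := mul_left_cancel₀ hC (by linear_combination h4)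
    have s1 := sin_sq_add_cos_sq (l + σ * β)
    have s2 := sin_sq_add_cos_sq l
    have hs : sin (γ 0) = 0 := by
      have : sin (γ 0) ^ 2 = 0 := by
        linear_combination sin (γ 0) * cos (l + σ * β) * k3 + sin (γ 0) * sin (l + σ * β) * k4 -
          sin (γ 0) ^ 2 * s1
      exact pow_eq_zero_iff two_ne_zero |>.1 this
    have e : σ * β = l + σ * β - l := by ring
    have c1 : cos (γ 0) * cos β = 1 := by
      rw [← hcosσ β, e, Real.cos_sub]
      linear_combination cos l * k1 + sin l * k2 + s2
    have c2 : cos (γ 0) * (σ * sin β) = 0 := by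
      rw [← hsinσ β, e, Real.sin_sub]
      linear_combination cos l * k2 - sin l * k1
    have hβ : sin β = 0 := by
      rcases mul_eq_zero.1 c2 with h | h
      · rw [h, zero_mul] at c1; exact absurd c1 zero_ne_one
      · exact (mul_eq_zero.1 h).resolve_left hσ0
    obtain ⟨k, hk⟩ := Real.sin_eq_zero_iff.1 hs
    obtain ⟨j, hj⟩ := Real.sin_eq_zero_iff.1 hβ
    refine ⟨k, i, j, hk.symm, hi, ?_, ?_⟩
    · have : (2 * i * p : ℝ) = q * j := by
        have h5 : (j : ℝ) * π = i * (2 * (p / q * π)) := hj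
        field_simp at h5
        linear_combination -h5
      exact_mod_cast this
    · rw [← hk, ← hj, Real.cos_int_mul_pi, Real.cos_int_mul_pi, ← zpow_add₀ (by norm_num)] at c1
      by_contra hodd
      rw [Int.not_even_iff_odd.1 hodd |>.neg_one_zpow] at c1
      norm_num at c1
  · rintro ⟨k, i, j, h0, h1, hij, hkj⟩
    have hv : ∀ t, v (γ 1 + t) = v t := fun t => by rw [h1, add_comm, D.v_add_int]
    have hn : ∀ t, c (γ 1 + t) 0 = c t 0 := fun t => by
      rw [h1, add_comm]; exact D.nu_add_int i t
    have hl : ∀ t, c (γ 1 + t) 1 = c t 1 + σ * (j * π) := fun t => by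
      have : (2 * i * p : ℝ) = q * j := by exact_mod_cast hij
      rw [hc, h1, add_comm _ t, D.Lambda_add_int, hT, hc t]
      field_simp
      linear_combination σ * π * this
    have hk := Real.cos_int_mul_pi k
    have hj := Real.cos_int_mul_pi j
    have hj' : cos (γ 0) * cos (j * π) = 1 := by
      rw [h0, hk, hj, ← zpow_add₀ (by norm_num), hkj.neg_one_zpow]
    have hs : sin (γ 0) = 0 := by rw [h0, Real.sin_int_mul_pi]
    refine ⟨fun α t => ?_, fun t => by rw [hv, hn]⟩
    rw [hv, hn, hl, Real.cos_add (γ 0), Real.sin_add (γ 0), Real.cos_add, Real.sin_add, hcosσ,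
      hsinσ, Real.sin_int_mul_pi, hs]
    refine ⟨?_, ?_, ?_, ?_⟩
    · linear_combination (cos α * (κ * (σ * (A / (sin (c t 0) * cos (c t 0))) * cos (c t 1) -
        v t * sin (c t 1)))) * hj'
    · linear_combination (cos α * (κ * (σ * (A / (sin (c t 0) * cos (c t 0))) * sin (c t 1) +
        v t * cos (c t 1)))) * hj'
    · linear_combination (sin α * (κ * (σ * (A / (sin (c t 0) * cos (c t 0))) * cos (c t 1) -
        v t * sin (c t 1)))) * hj'
    · linear_combination (sin α * (κ * (σ * (A / (sin (c t 0) * cos (c t 0))) * sin (c t 1) +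
        v t * cos (c t 1)))) * hj'

/-- Since q is coprime to 2p, it divides i. Then j = 2rp is even, and so is k. -/
theorem lattice_arith_odd {p q : ℕ} (hpq : Nat.Coprime p q) (hq : Odd q) (k i : ℤ) :
    (∃ j : ℤ, 2 * i * p = q * j ∧ Even (k + j)) ↔ ∃ n r : ℤ, k = 2 * n + 0 * r ∧ i = r * q := by
  have hq0 : (q : ℤ) ≠ 0 := by exact_mod_cast hq.pos.ne'
  constructor
  · rintro ⟨j, h, hk⟩
    have hc : IsCoprime (q : ℤ) (2 * p : ℤ) := by
      rw [show (2 * p : ℤ) = ((2 * p : ℕ) : ℤ) by push_cast; ring, Nat.isCoprime_iff_coprime]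
      exact Nat.Coprime.mul_right (Nat.coprime_two_right.2 hq) hpq.symm
    obtain ⟨r, rfl⟩ : (q : ℤ) ∣ i := hc.dvd_of_dvd_mul_right ⟨j, by rw [← h]; ring⟩
    have hj : j = 2 * (r * p) := mul_left_cancel₀ hq0 (by rw [← h]; ring)
    obtain ⟨n, hn⟩ := hk
    exact ⟨n - r * p, r, by omega, by ring⟩
  · rintro ⟨n, r, rfl, rfl⟩
    exact ⟨2 * (r * p), by ring, n + r * p, by ring⟩

/-- Here p is odd and m is coprime to p, so m divides i. Then j = rp has the parity of r, which k
must share: this is the half turn in the second generator. -/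
theorem lattice_arith_even {p m : ℕ} (hpq : Nat.Coprime p (2 * m)) (hm : 0 < m) (k i : ℤ) :
    (∃ j : ℤ, 2 * i * p = (2 * m : ℕ) * j ∧ Even (k + j)) ↔
      ∃ n r : ℤ, k = 2 * n + 1 * r ∧ i = r * m := by
  have hm0 : (2 * m : ℤ) ≠ 0 := by positivity
  have hc : IsCoprime (m : ℤ) (p : ℤ) :=
    Nat.isCoprime_iff_coprime.2 (hpq.coprime_dvd_right ⟨2, by ring⟩).symm
  obtain ⟨s, hs⟩ := Nat.coprime_two_right.1 (hpq.coprime_dvd_right ⟨m, rfl⟩)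
  have hs' : (p : ℤ) = 2 * s + 1 := by exact_mod_cast hs
  push_cast
  constructor
  · rintro ⟨j, h, hk⟩
    obtain ⟨r, rfl⟩ : (m : ℤ) ∣ i :=
      hc.dvd_of_dvd_mul_right ⟨j, mul_left_cancel₀ two_ne_zero (by rw [← mul_assoc, h]; ring)⟩
    have hj : j = 2 * (r * s) + r := mul_left_cancel₀ hm0 (by rw [← h, hs']; ring)
    obtain ⟨n, hn⟩ := hk
    exact ⟨n - r * s - r, r, by omega, by ring⟩
  · rintro ⟨n, r, rfl, rfl⟩
    exact ⟨r * p, by ring, n + r + r * s, by rw [hs']; ring⟩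

/-- The subgroup of the plane generated by `(2π, 0)` and `(επ, P)`. -/
def bipolarLattice (ε : ℤ) (P : ℝ) : AddSubgroup (Fin 2 → ℝ) :=
  AddSubgroup.closure {![2 * π, 0], ![ε * π, P]}

theorem mem_bipolarLattice {ε : ℤ} {P : ℝ} {γ : Fin 2 → ℝ} :
    γ ∈ bipolarLattice ε P ↔ ∃ n r : ℤ, γ 0 = (2 * n + ε * r : ℤ) * π ∧ γ 1 = r * P := by
  rw [bipolarLattice, AddSubgroup.mem_closure_pair]
  refine exists₂_congr fun n r => ?_
  rw [funext_iff, Fin.forall_fin_two]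
  simp only [Pi.add_apply, Pi.smul_apply, Matrix.cons_val_zero, Matrix.cons_val_one]
  simp only [zsmul_eq_mul]
  push_cast
  constructor <;> rintro ⟨h1, h2⟩ <;> constructor <;> linarith

instance countable_bipolarLattice (ε : ℤ) (P : ℝ) : Countable (bipolarLattice ε P) := by
  have : Function.Surjective (fun z : ℤ × ℤ =>
      (⟨z.1 • ![2 * π, 0] + z.2 • ![ε * π, P],
        AddSubgroup.mem_closure_pair.2 ⟨z.1, z.2, rfl⟩⟩ : bipolarLattice ε P)) := by
    rintro ⟨γ, hγ⟩
    obtain ⟨n, r, h⟩ := AddSubgroup.mem_closure_pair.1 hγ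
    exact ⟨(n, r), Subtype.ext h⟩
  exact this.countable

theorem isAddFundamentalDomain_bipolarLattice (ε : ℤ) {P : ℝ} (hP : 0 < P)
    (μ : Measure (Fin 2 → ℝ)) : IsAddFundamentalDomain (bipolarLattice ε P)
      (MeasurableEquiv.finTwoArrow ⁻¹' (Ico (0 : ℝ) (2 * π) ×ˢ Ico (0 : ℝ) P)) μ := by
  refine IsAddFundamentalDomain.mk' ?_ fun x => ?_
  · exact (MeasurableEquiv.finTwoArrow.measurable
      (measurableSet_Ico.prod measurableSet_Ico)).nullMeasurableSet
  · obtain ⟨r, hr, hr'⟩ := existsUnique_add_zsmul_mem_Ico hP (x 1) 0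
    obtain ⟨n, hn, hn'⟩ := existsUnique_add_zsmul_mem_Ico two_pi_pos (x 0 + r * (ε * π)) 0
    simp only [zsmul_eq_mul, zero_add] at hr hr' hn hn'
    refine ⟨⟨n • ![2 * π, 0] + r • ![ε * π, P], AddSubgroup.mem_closure_pair.2 ⟨n, r, rfl⟩⟩,
      ?_, ?_⟩
    · simp only [mem_preimage, MeasurableEquiv.finTwoArrow_apply, AddSubgroup.vadd_def,
        vadd_eq_add, mem_prod, Pi.add_apply, Pi.smul_apply, Matrix.cons_val_zero,
        Matrix.cons_val_one]
      simp only [zsmul_eq_mul]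
      constructor
      · convert hn using 1; ring
      · convert hr using 1; ring
    · rintro ⟨γ, hγ⟩ hmem
      obtain ⟨n', r', rfl⟩ := AddSubgroup.mem_closure_pair.1 hγ
      simp only [mem_preimage, MeasurableEquiv.finTwoArrow_apply, AddSubgroup.vadd_def,
        vadd_eq_add, mem_prod, Pi.add_apply, Pi.smul_apply, Matrix.cons_val_zero,
        Matrix.cons_val_one] at hmem
      simp only [zsmul_eq_mul] at hmem
      obtain ⟨h0, h1⟩ := hmem
      obtain rfl : r' = r := hr' r' (by convert h1 using 1; ring)
      obtain rfl : n' = n := hn' n' (by convert h0 using 1; ring)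
      rfl

theorem riemannianArea_bipolarLattice {ε : ℤ} {P : ℝ} (hP : 0 < P) {φ : ℝ → ℝ}
    (hφ : Continuous φ) (hφ0 : ∀ t, 0 ≤ φ t) (hper : ∀ t, φ (t + P) = φ t)
    {g : (Fin 2 → ℝ) → Matrix (Fin 2) (Fin 2) ℝ} (hg : ∀ x, √(g x).det = φ (x 1)) :
    riemannianArea (bipolarLattice ε P) g = 2 * π * ∫ t in (0)..P, φ t := by
  have hm : Measurable fun x : Fin 2 → ℝ => ENNReal.ofReal (φ (x 1)) := by
    fun_prop
  have : VAddInvariantMeasure (bipolarLattice ε P) (Fin 2 → ℝ)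
      (volume.withDensity fun x => ENNReal.ofReal (φ (x 1))) := by
    refine ⟨fun γ s hs => ?_⟩
    obtain ⟨γ, hγ⟩ := γ
    obtain ⟨n, r, -, h1⟩ := mem_bipolarLattice.1 hγ
    have hmp : MeasurePreserving (fun x : Fin 2 → ℝ => γ + x) volume volume :=
      measurePreserving_add_left volume γ
    have h2 : ∀ x : Fin 2 → ℝ, ENNReal.ofReal (φ (x 1)) = ENNReal.ofReal (φ ((γ + x) 1)) := by
      intro x
      rw [Pi.add_apply, h1, add_comm,
        add_zsmul_of_add (f := φ) (P := P) (d := 0) (by simpa using hper), mul_zero, add_zero]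
    change (volume.withDensity _) ((fun x : Fin 2 → ℝ => γ + x) ⁻¹' s) = _
    rw [withDensity_apply _ (hmp.measurable hs), withDensity_apply _ hs]
    rw [← hmp.setLIntegral_comp_preimage hs hm]
    exact lintegral_congr fun x => h2 x
  rw [riemannianArea, funext fun x => congrArg ENNReal.ofReal (hg x),
    (isAddFundamentalDomain_bipolarLattice ε hP _).covolume_eq_volume,
    withDensity_apply _ (MeasurableEquiv.finTwoArrow.measurable
      (measurableSet_Ico.prod measurableSet_Ico))]
  have h1 := (volume_preserving_finTwoArrow ℝ).setLIntegral_comp_preimage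
    (measurableSet_Ico.prod measurableSet_Ico : MeasurableSet
      (Ico (0 : ℝ) (2 * π) ×ˢ Ico (0 : ℝ) P))
    (f := fun z : ℝ × ℝ => ENNReal.ofReal (φ z.2)) (by fun_prop)
  refine (congrArg ENNReal.toReal h1).trans ?_
  rw [ Measure.volume_eq_prod, ← Measure.prod_restrict, lintegral_prod _ (by fun_prop)]
  simp only [lintegral_const, Measure.restrict_apply MeasurableSet.univ, univ_inter,
    Real.volume_Ico, sub_zero]
  rw [← ofReal_integral_eq_lintegral_ofReal _ (Filter.Eventually.of_forall hφ0),
    ENNReal.toReal_mul, ENNReal.toReal_ofReal (integral_nonneg hφ0),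
    ENNReal.toReal_ofReal two_pi_pos.le, integral_Ico_eq_integral_Ioc,
    ← intervalIntegral.integral_of_le hP.le, mul_comm]
  exact (hφ.integrableOn_Icc).mono_set Ico_subset_Icc_self

theorem sqrt_det_profileMetric {A : ℝ} {ν v Λ : ℝ → ℝ} (D : IsProfile A ν v Λ) (x : Fin 2 → ℝ) :
    √(profileMetric A ν x).det = profileRho A ν (x 1) * profileWeight ν (x 1) := by
  rw [profileMetric, Matrix.det_fin_two_of,
    show profileRho A ν (x 1) * (profileWeight ν (x 1) ^ 2 * profileRho A ν (x 1)) - 0 * 0 =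
      (profileRho A ν (x 1) * profileWeight ν (x 1)) ^ 2 by ring]
  exact Real.sqrt_sq (mul_pos (D.rho_pos _) (D.weight_pos _)).le

theorem riemannianArea_profileMetric {A : ℝ} {ν v Λ : ℝ → ℝ} (D : IsProfile A ν v Λ) {m : ℕ}
    (hm : 0 < m) (ε : ℤ) :
    riemannianArea (bipolarLattice ε (2 * (m * D.halfPeriod))) (profileMetric A ν) =
      4 * π * m * ∫ x in -(π / 2)..π / 2, IsProfile.phaseDensity A x := by
  have W := D.isSLWeight hm
  rw [riemannianArea_bipolarLattice (mul_pos two_pos W.X_pos)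
    (W.contDiff_rho.continuous.mul W.contDiff_w.continuous)
    (fun t => (mul_pos (W.rho_pos t) (W.w_pos t)).le)
    (fun t => by simp only [Pi.mul_apply, W.rho_per, W.w_per]) (sqrt_det_profileMetric D)]
  simp only [Pi.mul_apply]
  rw [D.integral_rho_mul_weight]
  ring

/-! ### Fourier series and separation of variables. -/

/-- A continuous `2π`-periodic function all of whose Fourier coefficients vanish is zero. -/
theorem eq_zero_of_integral_mul_cos_sin {f : ℝ → ℝ} (hf : Continuous f)
    (hp : Function.Periodic f (2 * π))
    (hc : ∀ n : ℕ, ∫ x in (0)..2 * π, f x * cos (n * x) = 0)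
    (hs : ∀ n : ℕ, ∫ x in (0)..2 * π, f x * sin (n * x) = 0) (x : ℝ) : f x = 0 := by
  have : Fact (0 < 2 * π) := ⟨two_pi_pos⟩
  have hc' : ∀ n : ℤ, ∫ x in (0)..2 * π, f x * cos (n * x) = 0 := fun n => by
    obtain ⟨k, rfl | rfl⟩ := n.eq_nat_or_neg
    · exact_mod_cast hc k
    · simpa using hc k
  have hs' : ∀ n : ℤ, ∫ x in (0)..2 * π, f x * sin (n * x) = 0 := fun n => by
    obtain ⟨k, rfl | rfl⟩ := n.eq_nat_or_neg
    · exact_mod_cast hs k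
    · simpa using hs k
  have hpC : Function.Periodic (fun x => (f x : ℂ)) (2 * π) := fun x => by simp only [hp x]
  let F : C(AddCircle (2 * π), ℂ) := ⟨hpC.lift, by
    refine continuous_coinduced_dom.2 ?_
    exact Complex.continuous_ofReal.comp hf⟩
  have hF : ∀ y : ℝ, F (y : AddCircle (2 * π)) = f y := fun y => hpC.lift_coe y
  have h0 : fourierCoeff F = 0 := by
    funext n
    rw [fourierCoeff_eq_intervalIntegral _ n 0, zero_add]
    have e : ∀ y : ℝ, fourier (-n) (y : AddCircle (2 * π)) • F y =
        ((f y * cos (n * y) : ℝ) : ℂ) - ((f y * sin (n * y) : ℝ) : ℂ) * Complex.I := fun y => by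
      have hpi : (π : ℂ) ≠ 0 := by exact_mod_cast pi_ne_zero
      rw [hF, fourier_coe_apply, show 2 * (π : ℂ) * Complex.I * ((-n : ℤ) : ℂ) * y /
        ((2 * π : ℝ) : ℂ) = ((-(n * y) : ℝ) : ℂ) * Complex.I by push_cast; field_simp,
        Complex.exp_mul_I, ← Complex.ofReal_cos, ← Complex.ofReal_sin, Real.cos_neg, Real.sin_neg,
        smul_eq_mul]
      push_cast
      ring
    simp only [e]
    rw [intervalIntegral.integral_sub, intervalIntegral.integral_mul_const,
      intervalIntegral.integral_ofReal, intervalIntegral.integral_ofReal, hc', hs']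
    · simp
    · exact (by fun_prop : Continuous fun y => ((f y * cos (n * y) : ℝ) : ℂ)).intervalIntegrable _ _
    · exact (by fun_prop : Continuous fun y =>
        ((f y * sin (n * y) : ℝ) : ℂ) * Complex.I).intervalIntegrable _ _
  have h1 := has_pointwise_sum_fourier_series_of_summable (f := F)
    (by rw [h0]; exact summable_zero) (x : AddCircle (2 * π))
  simp only [h0, Pi.zero_apply, zero_smul] at h1
  have h2 := h1.unique hasSum_zero
  rw [hF] at h2
  exact_mod_cast h2

theorem hasDerivAt_integral_param {G G' : ℝ → ℝ → ℝ} {b : ℝ}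
    (hG : Continuous (Function.uncurry G)) (hG' : Continuous (Function.uncurry G'))
    (hd : ∀ a t, HasDerivAt (fun t => G a t) (G' a t) t) (t : ℝ) :
    HasDerivAt (fun t => ∫ a in (0)..b, G a t) (∫ a in (0)..b, G' a t) t := by
  obtain ⟨C, hC⟩ := (isCompact_uIcc (a := (0 : ℝ)) (b := b) |>.prod
    (isCompact_closedBall t (1 : ℝ))).exists_bound_of_continuousOn hG'.continuousOn
  refine (intervalIntegral.hasDerivAt_integral_of_dominated_loc_of_deriv_le
    (F := fun t a => G a t) (F' := fun t a => G' a t) (bound := fun _ => C)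
    (Metric.ball_mem_nhds t one_pos) ?_ ?_ ?_ ?_ ?_ ?_).2
  · exact Filter.Eventually.of_forall fun r =>
      (hG.comp (by fun_prop : Continuous fun a : ℝ => (a, r))).aestronglyMeasurable
  · exact (hG.comp (by fun_prop : Continuous fun a : ℝ => (a, t))).intervalIntegrable _ _
  · exact (hG'.comp (by fun_prop : Continuous fun a : ℝ => (a, t))).aestronglyMeasurable
  · exact Filter.Eventually.of_forall fun a ha r hr =>
      hC (a, r) ⟨uIoc_subset_uIcc ha, Metric.ball_subset_closedBall hr⟩
  · exact intervalIntegrable_const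
  · exact Filter.Eventually.of_forall fun a _ r _ => hd a r

/-- Integrating by parts twice against a periodic function. -/
theorem integral_deriv_deriv_mul {u u' u'' e e' e'' : ℝ → ℝ} {b : ℝ}
    (hu : ∀ x, HasDerivAt u (u' x) x) (hu' : ∀ x, HasDerivAt u' (u'' x) x)
    (he : ∀ x, HasDerivAt e (e' x) x) (he' : ∀ x, HasDerivAt e' (e'' x) x)
    (hu'' : Continuous u'') (he'' : Continuous e'')
    (b1 : u b = u 0) (b2 : u' b = u' 0) (b3 : e b = e 0) (b4 : e' b = e' 0) :
    ∫ x in (0)..b, u'' x * e x = ∫ x in (0)..b, u x * e'' x := by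
  have cu : Continuous u := continuous_iff_continuousAt.2 fun x => (hu x).continuousAt
  have ce : Continuous e := continuous_iff_continuousAt.2 fun x => (he x).continuousAt
  have i1 : IntervalIntegrable (fun x => u'' x * e x) volume 0 b :=
    (hu''.mul ce).intervalIntegrable _ _
  have i2 : IntervalIntegrable (fun x => u x * e'' x) volume 0 b :=
    (cu.mul he'').intervalIntegrable _ _
  have h := intervalIntegral.integral_eq_sub_of_hasDerivAt (a := 0) (b := b)
    (f := fun x => u' x * e x - u x * e' x) (f' := fun x => u'' x * e x - u x * e'' x)
    (fun x _ => (((hu' x).mul (he x)).sub ((hu x).mul (he' x))).congr_deriv (by ring))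
    (i1.sub i2)
  rw [intervalIntegral.integral_sub i1 i2, b1, b2, b3, b4, sub_self] at h
  linarith

/-- The metric is conformal to dα² + w² dt², so ρ survives only in the prefactor. -/
theorem laplaceBeltrami_profileMetric {A : ℝ} {ν v Λ : ℝ → ℝ} (D : IsProfile A ν v Λ)
    (f : (Fin 2 → ℝ) → ℝ) (x : Fin 2 → ℝ) :
    laplaceBeltrami (profileMetric A ν) f x =
      -(1 / (profileRho A ν (x 1) * profileWeight ν (x 1))) *
        (partialDeriv 0 (fun y => profileWeight ν (y 1) * partialDeriv 0 f y) x +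
          partialDeriv 1 (fun y => partialDeriv 1 f y / profileWeight ν (y 1)) x) := by
  have hinv : ∀ y, (profileMetric A ν y)⁻¹ = !![1 / profileRho A ν (y 1), 0;
      0, 1 / (profileWeight ν (y 1) ^ 2 * profileRho A ν (y 1))] := fun y => by
    have h1 := (D.rho_pos (y 1)).ne'
    have h2 := (D.weight_pos (y 1)).ne'
    refine Matrix.inv_eq_right_inv ?_
    rw [profileMetric]
    ext i j
    fin_cases i <;> fin_cases j <;> simp [Matrix.mul_apply, h1]
    field_simp
  have e0 : (fun y => √(profileMetric A ν y).det * ∑ j, (profileMetric A ν y)⁻¹ 0 j *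
      partialDeriv j f y) = fun y => profileWeight ν (y 1) * partialDeriv 0 f y := by
    funext y
    have h1 := (D.rho_pos (y 1)).ne'
    rw [sqrt_det_profileMetric D, hinv]
    simp [Fin.sum_univ_two]
    field_simp
  have e1 : (fun y => √(profileMetric A ν y).det * ∑ j, (profileMetric A ν y)⁻¹ 1 j *
      partialDeriv j f y) = fun y => partialDeriv 1 f y / profileWeight ν (y 1) := by
    funext y
    have h1 := (D.rho_pos (y 1)).ne'
    have h2 := (D.weight_pos (y 1)).ne'
    rw [sqrt_det_profileMetric D, hinv]
    simp [Fin.sum_univ_two]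
    field_simp
  rw [laplaceBeltrami, Fin.sum_univ_two, e0, e1, sqrt_det_profileMetric D]

/-- Separated solutions of the eigenvalue equation. -/
theorem isLaplaceSolution_mul {A : ℝ} {ν v Λ : ℝ → ℝ} (D : IsProfile A ν v Λ) {ε : ℤ} {X μ l δ : ℝ}
    {C C' h k : ℝ → ℝ} (hC : ContDiff ℝ ∞ C) (dC : ∀ x, HasDerivAt C (C' x) x)
    (dC' : ∀ x, HasDerivAt C' (-l * C x) x) (pC : ∀ x, C (x + 2 * π) = C x)
    (mC : ∀ x, C (x + ε * π) = δ * C x) (hδ : δ * δ = 1)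
    (H : IsSLSolution (profileWeight ν) (fun t => μ * profileRho A ν t - l) h k)
    (mh : ∀ t, h (t + 2 * X) = δ * h t) :
    IsLaplaceSolution (bipolarLattice ε (2 * X)) (profileMetric A ν) μ
      fun x => C (x 0) * h (x 1) := by
  refine ⟨?_, ?_, fun x => ?_⟩
  · have hh := (H.contDiff D.contDiff_weight
      ((contDiff_const.mul D.contDiff_rho).sub contDiff_const)).1
    exact (hC.comp (contDiff_apply ℝ ℝ 0)).mul (hh.comp (contDiff_apply ℝ ℝ 1))
  · have : bipolarLattice ε (2 * X) ≤
        periodGroup fun x : Fin 2 → ℝ => WithLp.toLp 2 fun _ : Unit => C (x 0) * h (x 1) := by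
      rw [bipolarLattice, AddSubgroup.closure_le]
      rintro γ (rfl | rfl) x
      · simp only [Pi.add_apply, Matrix.cons_val_zero, Matrix.cons_val_one, zero_add]
        rw [add_comm, pC]
      · simp only [Pi.add_apply, Matrix.cons_val_zero, Matrix.cons_val_one]
        congr 1
        funext _
        rw [add_comm, mC, add_comm, mh]
        linear_combination C (x 0) * h (x 1) * hδ
    intro γ hγ x
    exact congrArg (fun u : EuclideanSpace ℝ Unit => u ()) (this hγ x)
  · have h1 := (D.rho_pos (x 1)).ne'
    have h2 := fun y => (D.weight_pos y).ne'
    have p0 : partialDeriv 0 (fun x : Fin 2 → ℝ => C (x 0) * h (x 1)) =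
        fun y => C' (y 0) * h (y 1) := by
      funext y
      exact (hasDerivAt_mul_update (dC _) (H.deriv_fst _)).1
    have p1 : partialDeriv 1 (fun x : Fin 2 → ℝ => C (x 0) * h (x 1)) =
        fun y => C (y 0) * (profileWeight ν (y 1) * k (y 1)) := by
      funext y
      exact (hasDerivAt_mul_update (dC _) (H.deriv_fst _)).2
    have e0 : (fun y : Fin 2 → ℝ => profileWeight ν (y 1) * (C' (y 0) * h (y 1))) =
        fun y => C' (y 0) * (profileWeight ν (y 1) * h (y 1)) := by
      funext y; ring
    have e1 : (fun y : Fin 2 → ℝ => C (y 0) * (profileWeight ν (y 1) * k (y 1)) /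
        profileWeight ν (y 1)) = fun y => C (y 0) * k (y 1) := by
      funext y
      have := h2 (y 1)
      field_simp
    have dw := (D.contDiff_weight.differentiable (by simp) (x 1)).hasDerivAt
    rw [laplaceBeltrami_profileMetric D, p0, p1, e0, e1,
      (hasDerivAt_mul_update (g := fun t => profileWeight ν t * h t) (dC' _)
        (dw.mul (H.deriv_fst _))).1,
      (hasDerivAt_mul_update (dC _) (H.deriv_snd _)).2]
    have := h2 (x 1)
    field_simp
    ring

theorem contDiff_partialDeriv {f : (Fin 2 → ℝ) → ℝ} (hf : ContDiff ℝ ∞ f) (i : Fin 2) :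
    ContDiff ℝ ∞ (partialDeriv i f) :=
  (hf.fderiv_right (m := ∞) (by simp)).clm_apply contDiff_const

theorem hasDerivAt_slice_fst {f : (Fin 2 → ℝ) → ℝ} (hf : ContDiff ℝ ∞ f) (a t : ℝ) :
    HasDerivAt (fun a => f ![a, t]) (partialDeriv 0 f ![a, t]) a := by
  refine (hf.differentiable (by simp) _).hasFDerivAt.comp_hasDerivAt a
    (f := fun a => ![a, t]) (hasDerivAt_pi.2 ?_)
  rw [Fin.forall_fin_two]
  exact ⟨by simpa using hasDerivAt_id' a, by simpa using hasDerivAt_const a t⟩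

theorem hasDerivAt_slice_snd {f : (Fin 2 → ℝ) → ℝ} (hf : ContDiff ℝ ∞ f) (a t : ℝ) :
    HasDerivAt (fun t => f ![a, t]) (partialDeriv 1 f ![a, t]) t := by
  refine (hf.differentiable (by simp) _).hasFDerivAt.comp_hasDerivAt t
    (f := fun t => ![a, t]) (hasDerivAt_pi.2 ?_)
  rw [Fin.forall_fin_two]
  exact ⟨by simpa using hasDerivAt_const t a, by simpa using hasDerivAt_id' t⟩

theorem continuous_slice {f : (Fin 2 → ℝ) → ℝ} (hf : Continuous f) {g : ℝ × ℝ → ℝ × ℝ}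
    (hg : Continuous g) : Continuous fun z : ℝ × ℝ => f ![(g z).1, (g z).2] :=
  hf.comp (continuous_pi (Fin.forall_fin_two.2 ⟨by simpa using hg.fst, by simpa using hg.snd⟩))

theorem continuous_slice_fst {f : (Fin 2 → ℝ) → ℝ} (hf : Continuous f) (t : ℝ) :
    Continuous fun a => f ![a, t] :=
  hf.comp (continuous_pi (Fin.forall_fin_two.2 ⟨by simpa using continuous_id',
    by simpa using continuous_const⟩))

theorem laplaceBeltrami_eq_iff {A : ℝ} {ν v Λ : ℝ → ℝ} (D : IsProfile A ν v Λ)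
    {f : (Fin 2 → ℝ) → ℝ} (hf : ContDiff ℝ ∞ f) {μ a t : ℝ}
    (h : laplaceBeltrami (profileMetric A ν) f ![a, t] = μ * f ![a, t]) :
    HasDerivAt (fun t => partialDeriv 1 f ![a, t] / profileWeight ν t)
      (-(profileWeight ν t * (μ * profileRho A ν t * f ![a, t] +
        partialDeriv 0 (partialDeriv 0 f) ![a, t]))) t := by
  rw [laplaceBeltrami_profileMetric D] at h
  have w0 : ∀ y, profileWeight ν y ≠ 0 := fun y => (D.weight_pos y).ne'
  have hw : ContDiff ℝ ∞ fun y : Fin 2 → ℝ => profileWeight ν (y 1) :=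
    D.contDiff_weight.comp (contDiff_apply ℝ ℝ 1)
  have c0 : ContDiff ℝ ∞ fun y => profileWeight ν (y 1) * partialDeriv 0 f y :=
    hw.mul (contDiff_partialDeriv hf 0)
  have c1 : ContDiff ℝ ∞ fun y => partialDeriv 1 f y / profileWeight ν (y 1) :=
    (contDiff_partialDeriv hf 1).div hw fun y => w0 _
  have h0 : partialDeriv 0 (fun y => profileWeight ν (y 1) * partialDeriv 0 f y) ![a, t] =
      profileWeight ν t * partialDeriv 0 (partialDeriv 0 f) ![a, t] :=
    (hasDerivAt_slice_fst c0 a t).unique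
      ((hasDerivAt_slice_fst (contDiff_partialDeriv hf 0) a t).const_mul (profileWeight ν t))
  refine (hasDerivAt_slice_snd c1 a t).congr_deriv ?_
  rw [h0] at h
  simp only [Matrix.cons_val_zero, Matrix.cons_val_one] at h
  have h1 := w0 t
  have h2 := (D.rho_pos t).ne'
  field_simp at h
  linear_combination -h

/-- Differentiate under the integral and use the eigenvalue equation to replace the second
t-derivative by the second α-derivative. Two integrations by parts move the latter onto e, the
boundary terms cancelling by periodicity. -/
theorem IsLaplaceSolution.coefficient {A : ℝ} {ν v Λ : ℝ → ℝ} (D : IsProfile A ν v Λ)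
    {Γ : AddSubgroup (Fin 2 → ℝ)} {μ l : ℝ} {f : (Fin 2 → ℝ) → ℝ} {e e' : ℝ → ℝ}
    (hf : IsLaplaceSolution Γ (profileMetric A ν) μ f) (hΓ : ![2 * π, 0] ∈ Γ)
    (he : ∀ x, HasDerivAt e (e' x) x) (he' : ∀ x, HasDerivAt e' (-l * e x) x)
    (b : e (2 * π) = e 0) (b' : e' (2 * π) = e' 0) :
    IsSLSolution (profileWeight ν) (fun t => μ * profileRho A ν t - l)
      (fun t => ∫ a in (0)..2 * π, f ![a, t] * e a)
      (fun t => ∫ a in (0)..2 * π, partialDeriv 1 f ![a, t] / profileWeight ν t * e a) := by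
  obtain ⟨hs, hp, hL⟩ := hf
  have w0 : ∀ y, profileWeight ν y ≠ 0 := fun y => (D.weight_pos y).ne'
  have ce : Continuous e := continuous_iff_continuousAt.2 fun x => (he x).continuousAt
  have cw := D.contDiff_weight.continuous
  have cρ := D.contDiff_rho.continuous
  have c1 := (contDiff_partialDeriv hs 1).continuous
  have c00 := (contDiff_partialDeriv (contDiff_partialDeriv hs 0) 0).continuous
  have s := continuous_slice hs.continuous continuous_id
  have s1 := continuous_slice c1 continuous_id
  have s00 := continuous_slice c00 continuous_id
  simp only [id] at s s1 s00
  have ce' : Continuous fun z : ℝ × ℝ => e z.1 := ce.comp continuous_fst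
  have cw' : Continuous fun z : ℝ × ℝ => profileWeight ν z.2 := cw.comp continuous_snd
  have cρ' : Continuous fun z : ℝ × ℝ => profileRho A ν z.2 := cρ.comp continuous_snd
  constructor
  · intro t
    refine (hasDerivAt_integral_param (G := fun a t => f ![a, t] * e a)
      (G' := fun a t => partialDeriv 1 f ![a, t] * e a) (s.mul ce') (s1.mul ce')
      (fun a t => (hasDerivAt_slice_snd hs a t).mul_const _) t).congr_deriv ?_
    rw [← intervalIntegral.integral_const_mul]
    refine intervalIntegral.integral_congr fun a _ => ?_
    have := w0 t
    field_simp
  · intro t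
    refine (hasDerivAt_integral_param
      (G := fun a t => partialDeriv 1 f ![a, t] / profileWeight ν t * e a)
      (G' := fun a t => -(profileWeight ν t * (μ * profileRho A ν t * f ![a, t] +
        partialDeriv 0 (partialDeriv 0 f) ![a, t])) * e a)
      ((s1.div cw' fun z => w0 _).mul ce')
      ((cw'.mul (((continuous_const.mul cρ').mul s).add s00)).neg.mul ce')
      (fun a t => (laplaceBeltrami_eq_iff D hs (hL _)).mul_const _) t).congr_deriv ?_
    have per : ∀ g : (Fin 2 → ℝ) → ℝ, (∀ x, g (![2 * π, 0] + x) = g x) →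
        g ![2 * π, t] = g ![0, t] := fun g hg => by
      rw [← hg ![0, t]]; congr 1; ext i; fin_cases i <;> simp
    have hp0 : ∀ x, partialDeriv 0 f (![2 * π, 0] + x) = partialDeriv 0 f x := fun x => by
      unfold partialDeriv
      rw [← fderiv_comp_add_left, funext (hp _ hΓ)]
    have parts := integral_deriv_deriv_mul (fun a => hasDerivAt_slice_fst hs a t)
      (fun a => hasDerivAt_slice_fst (contDiff_partialDeriv hs 0) a t) he he'
      (continuous_slice_fst c00 t) (continuous_const.mul ce) (per f (hp _ hΓ)) (per _ hp0) b b'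
    have i1 : IntervalIntegrable (fun a => f ![a, t] * e a) volume 0 (2 * π) :=
      ((continuous_slice_fst hs.continuous t).mul ce).intervalIntegrable _ _
    have i2 : IntervalIntegrable (fun a => partialDeriv 0 (partialDeriv 0 f) ![a, t] * e a)
        volume 0 (2 * π) := ((continuous_slice_fst c00 t).mul ce).intervalIntegrable _ _
    have e1 : (fun a => -(profileWeight ν t * (μ * profileRho A ν t * f ![a, t] +
        partialDeriv 0 (partialDeriv 0 f) ![a, t])) * e a) = fun a =>
        -(profileWeight ν t * (μ * profileRho A ν t)) * (f ![a, t] * e a) -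
        profileWeight ν t * (partialDeriv 0 (partialDeriv 0 f) ![a, t] * e a) := by
      funext a; ring
    have e2 : (fun a => f ![a, t] * (-l * e a)) = fun a => -l * (f ![a, t] * e a) := by
      funext a; ring
    rw [e2, intervalIntegral.integral_const_mul] at parts
    rw [e1, intervalIntegral.integral_sub (i1.const_mul _) (i2.const_mul _),
      intervalIntegral.integral_const_mul, intervalIntegral.integral_const_mul, parts]
    ring

/-- Translating t by P amounts to translating α by -β, and a change of variable passes the shift to
e. -/
theorem IsLaplaceSolution.coefficient_multiplier {Γ : AddSubgroup (Fin 2 → ℝ)}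
    {g : (Fin 2 → ℝ) → Matrix (Fin 2) (Fin 2) ℝ} {μ β P δ : ℝ} {f : (Fin 2 → ℝ) → ℝ} {e : ℝ → ℝ}
    (hf : IsLaplaceSolution Γ g μ f) (hΓ : ![2 * π, 0] ∈ Γ) (hΓ' : ![β, P] ∈ Γ)
    (he : Function.Periodic e (2 * π)) (hβ : ∀ x, e (x + β) = δ * e x) (t : ℝ) :
    ∫ a in (0)..2 * π, f ![a, t + P] * e a = δ * ∫ a in (0)..2 * π, f ![a, t] * e a := by
  obtain ⟨hs, hp, -⟩ := hf
  set G : ℝ → ℝ := fun a => f ![a, t] * e a with hG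
  have hper : Function.Periodic G (2 * π) := fun a => by
    simp only [hG, he a]
    rw [← hp _ hΓ ![a, t]]
    congr 2; ext i; fin_cases i <;> simp [add_comm]
  have h1 : ∀ a, f ![a, t + P] * e a = δ * G (a - β) := fun a => by
    have h2 : e a = δ * e (a - β) := by rw [← hβ, sub_add_cancel]
    have h3 : f ![a, t + P] = f ![a - β, t] := by
      rw [← hp _ hΓ' ![a - β, t]]
      congr 1; ext i; fin_cases i <;> simp [add_comm]
    rw [h2, h3]; simp only [hG]; ring
  simp only [h1]
  rw [intervalIntegral.integral_const_mul, intervalIntegral.integral_comp_sub_right G]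
  congr 1
  have := hper.intervalIntegral_add_eq (0 - β) 0
  rw [zero_add] at this
  rw [← this]
  congr 1; ring

/-- The derivative of h k is w (k² - Q h²) ≥ 0. A periodic monotone function is constant, so this
derivative is zero and h with it. -/
theorem IsSLSolution.eq_zero_of_neg {w Q h k : ℝ → ℝ} {P : ℝ} (H : IsSLSolution w Q h k)
    (hw : ∀ t, 0 < w t) (hQ : ∀ t, Q t < 0) (hP : 0 < P) (pw : ∀ t, w (t + P) = w t)
    (ph : ∀ t, h (t + P) = h t) (t : ℝ) : h t = 0 := by
  have pk : ∀ t, k (t + P) = k t := fun t => by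
    have h1 : HasDerivAt (fun t => h (t + P)) (w (t + P) * k (t + P)) t :=
      (H.deriv_fst (t + P)).comp_add_const t P
    rw [funext ph, pw] at h1
    exact mul_left_cancel₀ (hw t).ne' (h1.unique (H.deriv_fst t))
  have hd : ∀ t, HasDerivAt (fun t => h t * k t) (w t * (k t ^ 2 + -Q t * h t ^ 2)) t := fun t =>
    ((H.deriv_fst t).mul (H.deriv_snd t)).congr_deriv (by ring)
  have hm : Monotone fun t => h t * k t := monotone_of_hasDerivAt_nonneg hd fun t =>
    mul_nonneg (hw t).le (add_nonneg (sq_nonneg _) (mul_nonneg (neg_pos.2 (hQ t)).le (sq_nonneg _)))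
  have hp : Function.Periodic (fun t => h t * k t) P := fun t => by simp only [ph, pk]
  have hle : ∀ x y, h y * k y ≤ h x * k x := fun x y => by
    obtain ⟨z, hz, e⟩ := hp.exists_mem_Ico hP x y
    exact (hm hz.1).trans_eq e.symm
  have hc : (fun t => h t * k t) = fun _ => h 0 * k 0 :=
    funext fun x => le_antisymm (hle 0 x) (hle x 0)
  have h0 := hd t
  rw [hc] at h0
  have h1 := (h0.unique (hasDerivAt_const t _))
  rcases mul_eq_zero.1 h1 with h2 | h2
  · exact absurd h2 (hw t).ne'
  · by_contra hne
    have : 0 < -Q t * h t ^ 2 := mul_pos (neg_pos.2 (hQ t)) (by positivity)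
    nlinarith [sq_nonneg (k t)]

theorem integral_mul_eq_zero_of_deriv_deriv {u u' e e' : ℝ → ℝ} {l l' b : ℝ} (hl : l ≠ l')
    (hu : ∀ x, HasDerivAt u (u' x) x) (hu' : ∀ x, HasDerivAt u' (-l * u x) x)
    (he : ∀ x, HasDerivAt e (e' x) x) (he' : ∀ x, HasDerivAt e' (-l' * e x) x)
    (b1 : u b = u 0) (b2 : u' b = u' 0) (b3 : e b = e 0) (b4 : e' b = e' 0) :
    ∫ x in (0)..b, u x * e x = 0 := by
  have cu : Continuous u := continuous_iff_continuousAt.2 fun x => (hu x).continuousAt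
  have ce : Continuous e := continuous_iff_continuousAt.2 fun x => (he x).continuousAt
  have h := integral_deriv_deriv_mul hu hu' he he' (continuous_const.mul cu)
    (continuous_const.mul ce) b1 b2 b3 b4
  have e1 : (fun x => -l * u x * e x) = fun x => -l * (u x * e x) := by funext x; ring
  have e2 : (fun x => u x * (-l' * e x)) = fun x => -l' * (u x * e x) := by funext x; ring
  rw [e1, e2, intervalIntegral.integral_const_mul, intervalIntegral.integral_const_mul] at h
  have h2 : (l' - l) * ∫ x in (0)..b, u x * e x = 0 := by linear_combination h
  exact (mul_eq_zero.1 h2).resolve_left (sub_ne_zero.2 hl.symm)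

theorem hasDerivAt_cos_nat (n : ℕ) (x : ℝ) :
    HasDerivAt (fun x => cos (n * x)) (-(n * sin (n * x))) x :=
  (((hasDerivAt_id' x).const_mul (n : ℝ)).cos).congr_deriv (by ring)

theorem hasDerivAt_neg_sin_nat (n : ℕ) (x : ℝ) :
    HasDerivAt (fun x => -(n * sin (n * x))) (-(n ^ 2 : ℝ) * cos (n * x)) x :=
  ((((hasDerivAt_id' x).const_mul (n : ℝ)).sin).const_mul (n : ℝ)).neg.congr_deriv (by ring)

theorem hasDerivAt_sin_nat (n : ℕ) (x : ℝ) :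
    HasDerivAt (fun x => sin (n * x)) (n * cos (n * x)) x :=
  (((hasDerivAt_id' x).const_mul (n : ℝ)).sin).congr_deriv (by ring)

theorem hasDerivAt_mul_cos_nat (n : ℕ) (x : ℝ) :
    HasDerivAt (fun x => n * cos (n * x)) (-(n ^ 2 : ℝ) * sin (n * x)) x :=
  ((((hasDerivAt_id' x).const_mul (n : ℝ)).cos).const_mul (n : ℝ)).congr_deriv (by ring)

theorem cos_nat_periodic (n : ℕ) : Function.Periodic (fun x => cos (n * x)) (2 * π) := fun x => by
  simp only [mul_add, Real.cos_add_nat_mul_two_pi]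

theorem sin_nat_periodic (n : ℕ) : Function.Periodic (fun x => sin (n * x)) (2 * π) := fun x => by
  simp only [mul_add, Real.sin_add_nat_mul_two_pi]

theorem trig_orthogonality {i n : ℕ} (h : i ≠ n) :
    (∫ x in (0)..2 * π, cos (i * x) * cos (n * x)) = 0 ∧
    (∫ x in (0)..2 * π, sin (i * x) * cos (n * x)) = 0 ∧
    (∫ x in (0)..2 * π, cos (i * x) * sin (n * x)) = 0 ∧
    (∫ x in (0)..2 * π, sin (i * x) * sin (n * x)) = 0 := by
  have hl : (i ^ 2 : ℝ) ≠ n ^ 2 := by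
    exact_mod_cast fun h' => h (Nat.pow_left_injective two_ne_zero h')
  have c : ∀ j : ℕ, cos (j * (2 * π)) = cos (j * 0) := fun j => by simp
  have s : ∀ j : ℕ, sin (j * (2 * π)) = sin (j * 0) := fun j => by
    simpa using sin_nat_periodic j 0
  have c' : ∀ j : ℕ, (j : ℝ) * cos (j * (2 * π)) = j * cos (j * 0) := fun j => by rw [c]
  have s' : ∀ j : ℕ, -((j : ℝ) * sin (j * (2 * π))) = -(j * sin (j * 0)) := fun j => by rw [s]
  exact ⟨integral_mul_eq_zero_of_deriv_deriv hl (hasDerivAt_cos_nat i) (hasDerivAt_neg_sin_nat i)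
      (hasDerivAt_cos_nat n) (hasDerivAt_neg_sin_nat n) (c i) (s' i) (c n) (s' n),
    integral_mul_eq_zero_of_deriv_deriv hl (hasDerivAt_sin_nat i) (hasDerivAt_mul_cos_nat i)
      (hasDerivAt_cos_nat n) (hasDerivAt_neg_sin_nat n) (s i) (c' i) (c n) (s' n),
    integral_mul_eq_zero_of_deriv_deriv hl (hasDerivAt_cos_nat i) (hasDerivAt_neg_sin_nat i)
      (hasDerivAt_sin_nat n) (hasDerivAt_mul_cos_nat n) (c i) (s' i) (s n) (c' n),
    integral_mul_eq_zero_of_deriv_deriv hl (hasDerivAt_sin_nat i) (hasDerivAt_mul_cos_nat i)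
      (hasDerivAt_sin_nat n) (hasDerivAt_mul_cos_nat n) (s i) (c' i) (s n) (c' n)⟩

/-- A continuous `2π`-periodic function with no Fourier modes of order `≥ 2`. -/
theorem eq_trig_of_integral_eq_zero {f : ℝ → ℝ} (hf : Continuous f)
    (hp : Function.Periodic f (2 * π))
    (hc : ∀ n : ℕ, 2 ≤ n → ∫ x in (0)..2 * π, f x * cos (n * x) = 0)
    (hs : ∀ n : ℕ, 2 ≤ n → ∫ x in (0)..2 * π, f x * sin (n * x) = 0) (x : ℝ) :
    f x = 1 / (2 * π) * (∫ x in (0)..2 * π, f x * 1) +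
      cos x * (1 / π * ∫ x in (0)..2 * π, f x * cos x) +
      sin x * (1 / π * ∫ x in (0)..2 * π, f x * sin x) := by
  set a := 1 / (2 * π) * ∫ x in (0)..2 * π, f x * 1 with ha
  set b := 1 / π * ∫ x in (0)..2 * π, f x * cos x with hb
  set c := 1 / π * ∫ x in (0)..2 * π, f x * sin x with hc'
  have hπ := pi_ne_zero
  set r : ℝ → ℝ := fun x => f x - (a + cos x * b + sin x * c) with hr
  have key : ∀ e : ℝ → ℝ, Continuous e → ∫ x in (0)..2 * π, r x * e x =
      (∫ x in (0)..2 * π, f x * e x) - a * (∫ x in (0)..2 * π, e x) -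
        b * (∫ x in (0)..2 * π, cos x * e x) - c * ∫ x in (0)..2 * π, sin x * e x := by
    intro e he
    rw [← intervalIntegral.integral_const_mul, ← intervalIntegral.integral_const_mul,
      ← intervalIntegral.integral_const_mul, ← intervalIntegral.integral_sub,
      ← intervalIntegral.integral_sub, ← intervalIntegral.integral_sub]
    · refine intervalIntegral.integral_congr fun x _ => ?_
      simp only [hr]; ring
    all_goals exact (by fun_prop : Continuous _).intervalIntegrable _ _
  have hz : r x = 0 := by
    refine eq_zero_of_integral_mul_cos_sin (by fun_prop) (fun x => ?_) (fun n => ?_) (fun n => ?_) x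
    · simp only [hr, hp x, Real.cos_add_two_pi, Real.sin_add_two_pi]
    · rw [key _ (by fun_prop)]
      rcases Nat.lt_or_ge n 2 with hn | hn
      · interval_cases n
        · simp [ha]
          field_simp
          ring
        · simp [hb, ← sq, integral_sin_mul_cos₁]
          field_simp
          ring
      · have h0 := (trig_orthogonality (i := 0) (n := n) (by omega)).1
        have h1 := trig_orthogonality (i := 1) (n := n) (by omega)
        simp only [Nat.cast_zero, zero_mul, Real.cos_zero, one_mul, Nat.cast_one] at h0 h1
        rw [hc n hn, h0, h1.1, h1.2.1]; simp
    · rw [key _ (by fun_prop)]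
      rcases Nat.lt_or_ge n 2 with hn | hn
      · interval_cases n
        · simp
        · have hcs : ∫ x in (0)..2 * π, cos x * sin x = 0 := by
            simp only [mul_comm (cos _)]
            simp [integral_sin_mul_cos₁]
          simp [hc', ← sq, hcs]
          field_simp
          ring
      · have h0 := (trig_orthogonality (i := 0) (n := n) (by omega)).2.2.1
        have h1 := trig_orthogonality (i := 1) (n := n) (by omega)
        simp only [Nat.cast_zero, zero_mul, Real.cos_zero, one_mul, Nat.cast_one] at h0 h1
        rw [hs n hn, h0, h1.2.2.1, h1.2.2.2]; simp
  exact sub_eq_zero.1 hz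

theorem mem_bipolarLattice_fst (ε : ℤ) (P : ℝ) : ![2 * π, 0] ∈ bipolarLattice ε P :=
  AddSubgroup.subset_closure (by simp)

theorem mem_bipolarLattice_snd (ε : ℤ) (P : ℝ) : ![ε * π, P] ∈ bipolarLattice ε P :=
  AddSubgroup.subset_closure (by simp)

/-- Since 0 < ρ ≤ 1 and μ ≤ 2 < l, the potential μρ - l is negative. -/
theorem IsLaplaceSolution.coefficient_eq_zero {A : ℝ} {ν v Λ : ℝ → ℝ} (D : IsProfile A ν v Λ)
    {m : ℕ} (hm : 0 < m) {ε : ℤ} {μ l : ℝ} (hμ : μ ≤ 2) (hl : 2 < l) {f : (Fin 2 → ℝ) → ℝ}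
    (hf : IsLaplaceSolution (bipolarLattice ε (2 * (m * D.halfPeriod))) (profileMetric A ν) μ f)
    {e e' : ℝ → ℝ} (he : ∀ x, HasDerivAt e (e' x) x) (he' : ∀ x, HasDerivAt e' (-l * e x) x)
    (p : Function.Periodic e (2 * π)) (b' : e' (2 * π) = e' 0) (t : ℝ) :
    ∫ a in (0)..2 * π, f ![a, t] * e a = 0 := by
  have W := D.isSLWeight hm
  have H := hf.coefficient D (mem_bipolarLattice_fst _ _) he he' (by simpa using p 0) b'
  set P := 2 * (m * D.halfPeriod) with hP
  have hP0 : 0 < P := mul_pos two_pos W.X_pos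
  -- Twice the second generator moves α by a multiple of 2π, so the coefficient has period 2P
  -- whatever ε is.
  have hmem : ![2 * (ε * π), 2 * P] ∈ bipolarLattice ε P := by
    have := (bipolarLattice ε P).add_mem (mem_bipolarLattice_snd ε P) (mem_bipolarLattice_snd ε P)
    convert this using 1
    ext i; fin_cases i <;> simp <;> ring
  refine H.eq_zero_of_neg W.w_pos (fun t => ?_) (mul_pos two_pos hP0) (fun t => ?_) (fun t => ?_) t
  · have h1 := W.rho_pos t
    have h2 := W.rho_le t
    nlinarith
  · rw [two_mul P, ← add_assoc, W.w_per, W.w_per]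
  · have := hf.coefficient_multiplier (δ := 1) (mem_bipolarLattice_fst _ _) hmem p (fun x => by
      have := (p.int_mul ε) x
      rw [one_mul, ← this]; congr 1; ring) t
    rw [this, one_mul]

theorem IsLaplaceSolution.exists_decomposition {A : ℝ} {ν v Λ : ℝ → ℝ} (D : IsProfile A ν v Λ)
    {m : ℕ} (hm : 0 < m) {ε : ℤ} {μ δ : ℝ} (hμ : μ ≤ 2) (hc : ∀ x, cos (x + ε * π) = δ * cos x)
    (hs : ∀ x, sin (x + ε * π) = δ * sin x) {f : (Fin 2 → ℝ) → ℝ}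
    (hf : IsLaplaceSolution (bipolarLattice ε (2 * (m * D.halfPeriod))) (profileMetric A ν) μ f) :
    ∃ h₀ h₁ h₂ : ℝ → ℝ,
      ((∃ k, IsSLSolution (profileWeight ν) (fun t => μ * profileRho A ν t - 0) h₀ k) ∧
        ∀ t, h₀ (t + 2 * (m * D.halfPeriod)) = 1 * h₀ t) ∧
      ((∃ k, IsSLSolution (profileWeight ν) (fun t => μ * profileRho A ν t - 1) h₁ k) ∧
        ∀ t, h₁ (t + 2 * (m * D.halfPeriod)) = δ * h₁ t) ∧
      ((∃ k, IsSLSolution (profileWeight ν) (fun t => μ * profileRho A ν t - 1) h₂ k) ∧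
        ∀ t, h₂ (t + 2 * (m * D.halfPeriod)) = δ * h₂ t) ∧
      ∀ x, f x = h₀ (x 1) + cos (x 0) * h₁ (x 1) + sin (x 0) * h₂ (x 1) := by
  have m1 := mem_bipolarLattice_fst ε (2 * (m * D.halfPeriod))
  have m2 := mem_bipolarLattice_snd ε (2 * (m * D.halfPeriod))
  refine ⟨fun t => 1 / (2 * π) * ∫ a in (0)..2 * π, f ![a, t] * 1,
    fun t => 1 / π * ∫ a in (0)..2 * π, f ![a, t] * cos a,
    fun t => 1 / π * ∫ a in (0)..2 * π, f ![a, t] * sin a,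
    ⟨⟨_, (hf.coefficient D m1 (fun x => hasDerivAt_const x 1)
      (fun x => (hasDerivAt_const x (0 : ℝ)).congr_deriv (by simp)) rfl rfl).const_mul _⟩,
      fun t => ?_⟩,
    ⟨⟨_, (hf.coefficient D m1 hasDerivAt_cos
      (fun x => (hasDerivAt_sin x).neg.congr_deriv (by ring)) (by simp) (by simp)).const_mul _⟩,
      fun t => ?_⟩,
    ⟨⟨_, (hf.coefficient D m1 hasDerivAt_sin
      (fun x => (hasDerivAt_cos x).congr_deriv (by ring)) (by simp) (by simp)).const_mul _⟩,
      fun t => ?_⟩, fun x => ?_⟩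
  · simp only
    rw [hf.coefficient_multiplier m1 m2 (δ := 1) (e := fun _ => 1) (fun _ => rfl) (by simp)]
    ring
  · simp only
    rw [hf.coefficient_multiplier m1 m2 Real.cos_periodic hc]
    ring
  · simp only
    rw [hf.coefficient_multiplier m1 m2 Real.sin_periodic hs]
    ring
  · have hx : x = ![x 0, x 1] := by ext i; fin_cases i <;> rfl
    conv_lhs => rw [hx]
    have hl : ∀ n : ℕ, 2 ≤ n → (2 : ℝ) < (n : ℝ) ^ 2 := fun n hn => by
      have : (2 : ℝ) ≤ n := by exact_mod_cast hn
      nlinarith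
    refine eq_trig_of_integral_eq_zero (f := fun a => f ![a, x 1])
      (continuous_slice_fst hf.1.continuous _) (fun a => ?_) (fun n hn => ?_) (fun n hn => ?_) (x 0)
    · simp only
      rw [← hf.2.1 _ m1 ![a, x 1]]
      congr 1; ext i; fin_cases i <;> simp [add_comm]
    · exact hf.coefficient_eq_zero D hm hμ (hl n hn) (hasDerivAt_cos_nat n)
        (hasDerivAt_neg_sin_nat n) (cos_nat_periodic n)
        (by simpa using congrArg (fun y => (n : ℝ) * y) (sin_nat_periodic n 0)) _
    · exact hf.coefficient_eq_zero D hm hμ (hl n hn) (hasDerivAt_sin_nat n)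
        (hasDerivAt_mul_cos_nat n) (sin_nat_periodic n)
        (by simp) _

/-! ### From the Sturm-Liouville problems to the spectrum of the surface. -/

/-- A solution with multiplier `δ = ±1` is the sum of an odd and an even eigenfunction. -/
theorem IsSLWeight.exists_odd_add_even {w ρ : ℝ → ℝ} {X l μ δ : ℝ} (W : IsSLWeight w ρ X)
    (hδ : δ * δ = 1) {h : ℝ → ℝ} (H : ∃ k, IsSLSolution w (fun t => μ * ρ t - l) h k)
    (hm : ∀ t, h (t + 2 * X) = δ * h t) :
    ∃ h₁ h₂, IsSLEigenfunction w ρ X l (-1) δ μ h₁ ∧ IsSLEigenfunction w ρ X l 1 δ μ h₂ ∧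
      h = h₁ + h₂ := by
  obtain ⟨k, H⟩ := H
  have R := H.reflect (c := 0) (fun t => by rw [zero_sub, W.w_even])
    (fun t => by rw [zero_sub, W.rho_even])
  simp only [zero_sub] at R
  have hm' : ∀ t, h (-(t + 2 * X)) = δ * h (-t) := fun t => by
    have := hm (-(t + 2 * X))
    rw [show -(t + 2 * X) + 2 * X = -t by ring] at this
    rw [this]
    linear_combination -h (-(t + 2 * X)) * hδ
  refine ⟨fun t => 1 / 2 * (h t - h (-t)), fun t => 1 / 2 * (h t - -1 * h (-t)),
    ⟨⟨_, (H.sub R).const_mul (1 / 2)⟩, fun t => ?_, fun t => ?_⟩,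
    ⟨⟨_, (H.sub (R.const_mul (-1))).const_mul (1 / 2)⟩, fun t => ?_, fun t => ?_⟩, ?_⟩
  · rw [neg_neg]; ring
  · rw [hm, hm']; ring
  · rw [neg_neg]; ring
  · rw [hm, hm']; ring
  · funext t; simp only [Pi.add_apply]; ring

/-- Multiplication of a function of `t` by the function `C` of `α`. -/
def separatedMap (C : ℝ → ℝ) : (ℝ → ℝ) →ₗ[ℝ] ((Fin 2 → ℝ) → ℝ) where
  toFun h x := C (x 0) * h (x 1)
  map_add' h h' := by funext x; simp only [Pi.add_apply]; ring
  map_smul' r h := by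
    funext x; simp only [Pi.smul_apply, smul_eq_mul, RingHom.id_apply]; ring

theorem separatedMap_apply (C h : ℝ → ℝ) (x : Fin 2 → ℝ) :
    separatedMap C h x = C (x 0) * h (x 1) := rfl

theorem linearIndependent_separatedMap {ι κ : Type*} {u₀ : ι → ℝ → ℝ} {u₁ : κ → ℝ → ℝ}
    (h₀ : LinearIndependent ℝ u₀) (h₁ : LinearIndependent ℝ u₁) :
    LinearIndependent ℝ (Sum.elim (separatedMap (fun _ => 1) ∘ u₀)
      (Sum.elim (separatedMap cos ∘ u₁) (separatedMap sin ∘ u₁))) := by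
  set Φ := (separatedMap fun _ => 1).coprod ((separatedMap cos).coprod (separatedMap sin)) with hΦ
  have hker : LinearMap.ker Φ = ⊥ := by
    rw [LinearMap.ker_eq_bot']
    rintro ⟨a, b, c⟩ h
    have h' : ∀ α t, a t + (cos α * b t + sin α * c t) = 0 := fun α t => by
      have := congrFun h ![α, t]
      simpa [hΦ, separatedMap_apply] using this
    -- The values at α = 0, π, π/2 separate 1, cos and sin.
    have ht : ∀ t, a t = 0 ∧ b t = 0 ∧ c t = 0 := fun t => by
      have e0 := h' 0 t
      have e1 := h' π t
      have e2 := h' (π / 2) t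
      simp only [Real.cos_zero, Real.sin_zero, Real.cos_pi, Real.sin_pi, Real.cos_pi_div_two,
        Real.sin_pi_div_two] at e0 e1 e2
      refine ⟨by linarith, by linarith, by linarith⟩
    simp only [Prod.mk_eq_zero]
    exact ⟨funext fun t => (ht t).1, funext fun t => (ht t).2.1, funext fun t => (ht t).2.2⟩
  have h := (linearIndependent_inl_union_inr' h₀
    (linearIndependent_inl_union_inr' h₁ h₁)).map' Φ hker
  have e : Sum.elim (separatedMap (fun _ => 1) ∘ u₀)
      (Sum.elim (separatedMap cos ∘ u₁) (separatedMap sin ∘ u₁)) =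
      Φ ∘ Sum.elim (LinearMap.inl ℝ (ℝ → ℝ) ((ℝ → ℝ) × (ℝ → ℝ)) ∘ u₀)
        (LinearMap.inr ℝ (ℝ → ℝ) ((ℝ → ℝ) × (ℝ → ℝ)) ∘ Sum.elim (LinearMap.inl ℝ (ℝ → ℝ) (ℝ → ℝ) ∘ u₁)
          (LinearMap.inr ℝ (ℝ → ℝ) (ℝ → ℝ) ∘ u₁)) := by
    funext i
    rcases i with i | i | i <;> simp [hΦ]
  rw [e]
  exact h

theorem linearIndependent_odd_even {ι κ : Type*} {u : ι → ℝ → ℝ} {u' : κ → ℝ → ℝ}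
    (h : LinearIndependent ℝ u) (h' : LinearIndependent ℝ u') (ho : ∀ i t, u i (-t) = -1 * u i t)
    (he : ∀ i t, u' i (-t) = 1 * u' i t) : LinearIndependent ℝ (Sum.elim u u') := by
  let V : ℝ → Submodule ℝ (ℝ → ℝ) := fun η =>
    { carrier := {f | ∀ t, f (-t) = η * f t}
      add_mem' := fun {f g} hf hg t => by simp only [Pi.add_apply]; rw [hf, hg]; ring
      zero_mem' := fun t => by simp
      smul_mem' := fun r f hf t => by
        simp only [Pi.smul_apply, smul_eq_mul]; rw [hf]; ring }
  have h1 : Submodule.span ℝ (range u) ≤ V (-1) :=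
    Submodule.span_le.2 (by rintro _ ⟨i, rfl⟩; exact ho i)
  have h2 : Submodule.span ℝ (range u') ≤ V 1 :=
    Submodule.span_le.2 (by rintro _ ⟨i, rfl⟩; exact he i)
  refine h.sum_type h' (Submodule.disjoint_def.2 fun f hf hf' => ?_)
  funext t
  have e1 : f (-t) = -1 * f t := h1 hf t
  have e2 : f (-t) = 1 * f t := h2 hf' t
  simp only [Pi.zero_apply]
  linarith

/-- The Sturm-Liouville problem with the given symmetries has at most `n` eigenvalues `< 2` and at
least `n'` eigenvalues `≤ 2`. -/
structure SLCount (w ρ : ℝ → ℝ) (X l η δ : ℝ) (n n' : ℕ) : Prop where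
  exists_linearIndependent : ∃ u : Fin n' → ℝ → ℝ, LinearIndependent ℝ u ∧
    ∀ i, ∃ μ ≤ (2 : ℝ), IsSLEigenfunction w ρ X l η δ μ (u i)
  exists_spanning : ∃ g : Fin n → ℝ → ℝ, ∀ μ < (2 : ℝ), ∀ h,
    IsSLEigenfunction w ρ X l η δ μ h → h ∈ Submodule.span ℝ (range g)

section Count

variable {A : ℝ} {ν v Λ : ℝ → ℝ} {m : ℕ} {ε : ℤ} {δ : ℝ} {a a' b b' c c' d d' : ℕ}

theorem le_eigenvalueCount (D : IsProfile A ν v Λ) (hδ : δ * δ = 1)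
    (hc : ∀ x, cos (x + ε * π) = δ * cos x) (hs : ∀ x, sin (x + ε * π) = δ * sin x)
    (h₀ : SLCount (profileWeight ν) (profileRho A ν) (m * D.halfPeriod) 0 (-1) 1 a a')
    (h₀' : SLCount (profileWeight ν) (profileRho A ν) (m * D.halfPeriod) 0 1 1 b b')
    (h₁ : SLCount (profileWeight ν) (profileRho A ν) (m * D.halfPeriod) 1 (-1) δ c c')
    (h₁' : SLCount (profileWeight ν) (profileRho A ν) (m * D.halfPeriod) 1 1 δ d d') :
    ((a' + b' + 2 * (c' + d') : ℕ) : Cardinal) ≤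
      eigenvalueCount (bipolarLattice ε (2 * (m * D.halfPeriod))) (profileMetric A ν) 2 := by
  obtain ⟨u₀, l₀, e₀⟩ := h₀.exists_linearIndependent
  obtain ⟨u₀', l₀', e₀'⟩ := h₀'.exists_linearIndependent
  obtain ⟨u₁, l₁, e₁⟩ := h₁.exists_linearIndependent
  obtain ⟨u₁', l₁', e₁'⟩ := h₁'.exists_linearIndependent
  have L₀ := linearIndependent_odd_even l₀ l₀' (fun i => (e₀ i).choose_spec.2.parity)
    (fun i => (e₀' i).choose_spec.2.parity)
  have L₁ := linearIndependent_odd_even l₁ l₁' (fun i => (e₁ i).choose_spec.2.parity)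
    (fun i => (e₁' i).choose_spec.2.parity)
  have L := linearIndependent_separatedMap L₀ L₁
  have sol₀ : ∀ {η μ : ℝ} {h : ℝ → ℝ}, IsSLEigenfunction (profileWeight ν) (profileRho A ν)
      (m * D.halfPeriod) 0 η 1 μ h → IsLaplaceSolution (bipolarLattice ε (2 * (m * D.halfPeriod)))
        (profileMetric A ν) μ (separatedMap (fun _ => 1) h) := fun E => by
    obtain ⟨k, H⟩ := E.solution
    exact isLaplaceSolution_mul D (C' := fun _ => 0) (δ := 1) contDiff_const
      (fun x => hasDerivAt_const x 1)
      (fun x => (hasDerivAt_const x (0 : ℝ)).congr_deriv (by simp)) (by simp) (by simp) (by simp)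
      H E.multiplier
  have sol₁ : ∀ {η μ : ℝ} {h : ℝ → ℝ}, IsSLEigenfunction (profileWeight ν) (profileRho A ν)
      (m * D.halfPeriod) 1 η δ μ h → IsLaplaceSolution (bipolarLattice ε (2 * (m * D.halfPeriod)))
        (profileMetric A ν) μ (separatedMap cos h) := fun E => by
    obtain ⟨k, H⟩ := E.solution
    exact isLaplaceSolution_mul D contDiff_cos hasDerivAt_cos
      (fun x => (hasDerivAt_sin x).neg.congr_deriv (by ring)) Real.cos_add_two_pi hc hδ
      H E.multiplier
  have sol₂ : ∀ {η μ : ℝ} {h : ℝ → ℝ}, IsSLEigenfunction (profileWeight ν) (profileRho A ν)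
      (m * D.halfPeriod) 1 η δ μ h → IsLaplaceSolution (bipolarLattice ε (2 * (m * D.halfPeriod)))
        (profileMetric A ν) μ (separatedMap sin h) := fun E => by
    obtain ⟨k, H⟩ := E.solution
    exact isLaplaceSolution_mul D contDiff_sin hasDerivAt_sin
      (fun x => (hasDerivAt_cos x).congr_deriv (by ring)) Real.sin_add_two_pi hs hδ
      H E.multiplier
  have hsub : range (Sum.elim (separatedMap (fun _ => 1) ∘ Sum.elim u₀ u₀')
      (Sum.elim (separatedMap cos ∘ Sum.elim u₁ u₁') (separatedMap sin ∘ Sum.elim u₁ u₁'))) ⊆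
      {f | ∃ μ ≤ (2 : ℝ), IsLaplaceSolution (bipolarLattice ε (2 * (m * D.halfPeriod)))
        (profileMetric A ν) μ f} := by
    rintro _ ⟨(i | i) | (i | i) | i | i, rfl⟩
    · obtain ⟨μ, hμ, E⟩ := e₀ i
      exact ⟨μ, hμ, sol₀ E⟩
    · obtain ⟨μ, hμ, E⟩ := e₀' i
      exact ⟨μ, hμ, sol₀ E⟩
    · obtain ⟨μ, hμ, E⟩ := e₁ i
      exact ⟨μ, hμ, sol₁ E⟩
    · obtain ⟨μ, hμ, E⟩ := e₁' i
      exact ⟨μ, hμ, sol₁ E⟩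
    · obtain ⟨μ, hμ, E⟩ := e₁ i
      exact ⟨μ, hμ, sol₂ E⟩
    · obtain ⟨μ, hμ, E⟩ := e₁' i
      exact ⟨μ, hμ, sol₂ E⟩
  have hle := Submodule.rank_mono (Submodule.span_mono (R := ℝ) hsub)
  rw [rank_span L, Cardinal.mk_range_eq _ L.injective, Cardinal.mk_fintype] at hle
  refine le_trans (le_of_eq ?_) hle
  simp only [Fintype.card_sum, Fintype.card_fin]
  congr 1; ring

theorem eigenvalueCount_le (D : IsProfile A ν v Λ) (hm : 0 < m) (hδ : δ * δ = 1)
    (hc : ∀ x, cos (x + ε * π) = δ * cos x) (hs : ∀ x, sin (x + ε * π) = δ * sin x)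
    (h₀ : SLCount (profileWeight ν) (profileRho A ν) (m * D.halfPeriod) 0 (-1) 1 a a')
    (h₀' : SLCount (profileWeight ν) (profileRho A ν) (m * D.halfPeriod) 0 1 1 b b')
    (h₁ : SLCount (profileWeight ν) (profileRho A ν) (m * D.halfPeriod) 1 (-1) δ c c')
    (h₁' : SLCount (profileWeight ν) (profileRho A ν) (m * D.halfPeriod) 1 1 δ d d') {x : ℝ}
    (hx : x < 2) :
    eigenvalueCount (bipolarLattice ε (2 * (m * D.halfPeriod))) (profileMetric A ν) x ≤
      ((a + b + 2 * (c + d) : ℕ) : Cardinal) := by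
  obtain ⟨g₀, s₀⟩ := h₀.exists_spanning
  obtain ⟨g₀', s₀'⟩ := h₀'.exists_spanning
  obtain ⟨g₁, s₁⟩ := h₁.exists_spanning
  obtain ⟨g₁', s₁'⟩ := h₁'.exists_spanning
  have W := D.isSLWeight hm
  set F := Sum.elim (separatedMap (fun _ => 1) ∘ Sum.elim g₀ g₀')
      (Sum.elim (separatedMap cos ∘ Sum.elim g₁ g₁') (separatedMap sin ∘ Sum.elim g₁ g₁')) with hF
  have hmap : ∀ {n n' : ℕ} {g : Fin n → ℝ → ℝ} {g' : Fin n' → ℝ → ℝ} {h h' : ℝ → ℝ} (C : ℝ → ℝ),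
      h ∈ Submodule.span ℝ (range g) → h' ∈ Submodule.span ℝ (range g') →
      separatedMap C (h + h') ∈ Submodule.span ℝ (range (separatedMap C ∘ Sum.elim g g')) := by
    intro n n' g g' h h' C hh hh'
    rw [range_comp, Submodule.span_image, Sum.elim_range, Submodule.span_union]
    exact Submodule.mem_map_of_mem (Submodule.add_mem_sup hh hh')
  have hle : Submodule.span ℝ {f | ∃ μ ≤ x, IsLaplaceSolution
      (bipolarLattice ε (2 * (m * D.halfPeriod))) (profileMetric A ν) μ f} ≤
      Submodule.span ℝ (range F) := by
    refine Submodule.span_le.2 ?_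
    rintro f ⟨μ, hμ, hf⟩
    obtain ⟨f₀, f₁, f₂, ⟨H₀, M₀⟩, ⟨H₁, M₁⟩, ⟨H₂, M₂⟩, hsum⟩ :=
      hf.exists_decomposition D hm (hμ.trans hx.le) hc hs
    obtain ⟨p₀, q₀, P₀, Q₀, rfl⟩ := W.exists_odd_add_even (one_mul 1) H₀ M₀
    obtain ⟨p₁, q₁, P₁, Q₁, rfl⟩ := W.exists_odd_add_even hδ H₁ M₁
    obtain ⟨p₂, q₂, P₂, Q₂, rfl⟩ := W.exists_odd_add_even hδ H₂ M₂
    have hμ2 := hμ.trans_lt hx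
    have e : f = separatedMap (fun _ => 1) (p₀ + q₀) +
        (separatedMap cos (p₁ + q₁) + separatedMap sin (p₂ + q₂)) := by
      funext y
      simp only [hsum y, Pi.add_apply, separatedMap_apply]; ring
    rw [e, hF, Sum.elim_range, Sum.elim_range, Submodule.span_union, Submodule.span_union]
    exact Submodule.add_mem_sup (hmap _ (s₀ μ hμ2 _ P₀) (s₀' μ hμ2 _ Q₀))
      (Submodule.add_mem_sup (hmap _ (s₁ μ hμ2 _ P₁) (s₁' μ hμ2 _ Q₁))
        (hmap _ (s₁ μ hμ2 _ P₂) (s₁' μ hμ2 _ Q₂)))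
  refine (Submodule.rank_mono hle).trans ((rank_span_le _).trans (Cardinal.mk_range_le.trans ?_))
  rw [Cardinal.mk_fintype]
  simp only [Fintype.card_sum, Fintype.card_fin]
  exact le_of_eq (by congr 1; ring)

/-- For x < 2 the count is at most K, while at x = 2 it exceeds K, so 2 is the least element of the
set whose infimum defines λ_K. The problems with n = 1 count twice, for cos α and sin α. -/
theorem laplaceEigenvalue_eq_two (D : IsProfile A ν v Λ) (hm : 0 < m) (hδ : δ * δ = 1)
    (hc : ∀ x, cos (x + ε * π) = δ * cos x) (hs : ∀ x, sin (x + ε * π) = δ * sin x)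
    (h₀ : SLCount (profileWeight ν) (profileRho A ν) (m * D.halfPeriod) 0 (-1) 1 a a')
    (h₀' : SLCount (profileWeight ν) (profileRho A ν) (m * D.halfPeriod) 0 1 1 b b')
    (h₁ : SLCount (profileWeight ν) (profileRho A ν) (m * D.halfPeriod) 1 (-1) δ c c')
    (h₁' : SLCount (profileWeight ν) (profileRho A ν) (m * D.halfPeriod) 1 1 δ d d') {K : ℕ}
    (hK : a + b + 2 * (c + d) = K) (hK' : K < a' + b' + 2 * (c' + d')) :
    laplaceEigenvalue (bipolarLattice ε (2 * (m * D.halfPeriod))) (profileMetric A ν) K = 2 := by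
  refine IsLeast.csInf_eq ⟨?_, fun x hx => ?_⟩
  · exact lt_of_lt_of_le (by exact_mod_cast hK') (le_eigenvalueCount D hδ hc hs h₀ h₀' h₁ h₁')
  · by_contra! hlt
    have := eigenvalueCount_le D hm hδ hc hs h₀ h₀' h₁ h₁' hlt
    rw [hK] at this
    exact absurd hx (not_lt.2 this)

end Count

/-- The levels e + iπ, i ≥ 0, up to Θ X belong to eigenvalues ≤ 2, those strictly below Θ X to
eigenvalues < 2. -/
theorem IsSLWeight.slCount {w ρ : ℝ → ℝ} {X l : ℝ} (W : IsSLWeight w ρ X) (hl : 0 ≤ l)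
    {s e η η' δ : ℝ} (hs : s = 0 ∧ η = -1 ∨ s = π / 2 ∧ η = 1)
    (he : e = π ∧ η' = -1 ∨ e = π / 2 ∧ η' = 1) (hδ : η * η' = δ) {Θ : ℝ → ℝ} (hΘ0 : Θ 0 = s)
    (hΘ : IsPruferAngle w (fun t => 2 * ρ t - l) Θ) {n n' : ℕ} (hn : Θ X ≤ e + n * π)
    (hn' : e + n' * π ≤ Θ X + π) : SLCount w ρ X l η δ n n' := by
  subst hδ
  exact ⟨W.exists_linearIndependent hs he hl (by norm_num) hΘ0 hΘ hn',
    W.exists_spanning hs he hΘ0 hΘ hn⟩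

/-! ### The counts in each symmetry class and the conclusion. -/

namespace IsProfile

variable {A : ℝ} {ν v Λ : ℝ → ℝ} {m : ℕ}

theorem slCount_zero_odd (D : IsProfile A ν v Λ) (hm : 0 < m) :
    SLCount (profileWeight ν) (profileRho A ν) (m * D.halfPeriod) 0 (-1) 1 (m - 1) m := by
  have W := D.isSLWeight hm
  obtain ⟨θ, h0, hθ⟩ := W.exists_angle 0 0 2
  have h := D.angle_f h0 hθ m
  refine W.slCount le_rfl (Or.inl ⟨rfl, rfl⟩) (Or.inl ⟨rfl, rfl⟩) (by norm_num) h0 hθ ?_ ?_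
  · rw [h, Nat.cast_sub hm]
    exact le_of_eq (by push_cast; ring)
  · rw [h]; linarith

/-- No solution for μ = 2 is at hand, but mπ + π/2 < θ(mT) ≤ mπ + π. The level mπ + π/2 is strictly
passed and the next is not reached, so 2 is not an eigenvalue here and both counts are m + 1. -/
theorem slCount_zero_even (D : IsProfile A ν v Λ) (hm : 0 < m) :
    SLCount (profileWeight ν) (profileRho A ν) (m * D.halfPeriod) 0 1 1 (m + 1) (m + 1) := by
  have W := D.isSLWeight hm
  obtain ⟨θ, h0, hθ⟩ := W.exists_angle 0 (π / 2) 2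
  obtain ⟨ψ, g0, hψ⟩ := W.exists_angle (1 - 2 * A) (π / 2) 2
  obtain ⟨φ, f0, hφ⟩ := W.exists_angle 0 0 2
  have hg := D.angle_g g0 hψ m
  have hf := D.angle_f f0 hφ m
  -- Lower bound: replacing l = 1 - 2A by l = 0 increases the potential.
  have h1 : ψ (m * D.halfPeriod) < θ (m * D.halfPeriod) :=
    hψ.lt_of_lt W.continuous_w W.w_pos (W.continuous_potential _ _) hθ
      (fun t => by linarith [D.A_lt]) (by rw [g0, h0]) W.X_pos
  -- Upper bound: the angle of f plus π obeys the same equation and starts at π > π/2.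
  have hφ' : IsPruferAngle (profileWeight ν) (fun t => 2 * profileRho A ν t - 0)
      (fun t => φ t + π) := fun t => by
    have := (hφ t).add_const π
    simpa only [Real.cos_add_pi, Real.sin_add_pi, neg_sq] using this
  have h2 : θ (m * D.halfPeriod) ≤ φ (m * D.halfPeriod) + π :=
    hθ.le_of_le W.continuous_w (W.continuous_potential _ _) hφ'
      (by simp only [h0, f0]; linarith [pi_pos]) W.X_pos.le
  refine W.slCount le_rfl (Or.inr ⟨rfl, rfl⟩) (Or.inr ⟨rfl, rfl⟩) (by norm_num) h0 hθ ?_ ?_ <;>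
    push_cast <;> linarith [pi_pos]

theorem slCount_one_odd (D : IsProfile A ν v Λ) (hm : 0 < m) {i : ℕ} (hi : 0 < i)
    (hΛ : Λ (m * D.halfPeriod) = i * π) :
    SLCount (profileWeight ν) (profileRho A ν) (m * D.halfPeriod) 1 (-1) 1 (i - 1) i := by
  have W := D.isSLWeight hm
  obtain ⟨θ, h0, hθ⟩ := W.exists_angle 1 0 2
  have h := D.angle_sin h0 hθ m (by
    rw [hΛ, ← mul_assoc]; exact_mod_cast Real.sin_nat_mul_pi (2 * i))
  rw [hΛ] at h
  refine W.slCount zero_le_one (Or.inl ⟨rfl, rfl⟩) (Or.inl ⟨rfl, rfl⟩) (by norm_num) h0 hθ ?_ ?_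
  · rw [h, Nat.cast_sub hi]
    exact le_of_eq (by push_cast; ring)
  · rw [h]; linarith

theorem slCount_one_even (D : IsProfile A ν v Λ) (hm : 0 < m) {i : ℕ}
    (hΛ : Λ (m * D.halfPeriod) = i * π) :
    SLCount (profileWeight ν) (profileRho A ν) (m * D.halfPeriod) 1 1 1 i (i + 1) := by
  have W := D.isSLWeight hm
  obtain ⟨θ, h0, hθ⟩ := W.exists_angle 1 (π / 2) 2
  have h := D.angle_cos h0 hθ m (by
    rw [hΛ, ← mul_assoc]; exact_mod_cast Real.sin_nat_mul_pi (2 * i))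
  rw [hΛ] at h
  refine W.slCount zero_le_one (Or.inr ⟨rfl, rfl⟩) (Or.inr ⟨rfl, rfl⟩) (by norm_num) h0 hθ ?_ ?_
  · rw [h]; linarith
  · rw [h]; push_cast; linarith

/-- Multiplier -1 means different boundary conditions at the two ends: here Dirichlet at 0 and
Neumann at mT. The angle iπ + π/2 is exactly a level, so 2 is an eigenvalue. -/
theorem slCount_one_odd_antiperiodic (D : IsProfile A ν v Λ) (hm : 0 < m) {i : ℕ}
    (hΛ : Λ (m * D.halfPeriod) = i * π + π / 2) :
    SLCount (profileWeight ν) (profileRho A ν) (m * D.halfPeriod) 1 (-1) (-1) i (i + 1) := by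
  have W := D.isSLWeight hm
  obtain ⟨θ, h0, hθ⟩ := W.exists_angle 1 0 2
  have h := D.angle_sin h0 hθ m (by
    rw [hΛ, show 2 * (i * π + π / 2) = ((2 * i + 1 : ℕ) : ℝ) * π by push_cast; ring]
    exact Real.sin_nat_mul_pi _)
  rw [hΛ] at h
  refine W.slCount zero_le_one (Or.inl ⟨rfl, rfl⟩) (Or.inr ⟨rfl, rfl⟩) (by norm_num) h0 hθ ?_ ?_
  · rw [h]; linarith
  · rw [h]; push_cast; linarith

theorem slCount_one_even_antiperiodic (D : IsProfile A ν v Λ) (hm : 0 < m) {i : ℕ}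
    (hΛ : Λ (m * D.halfPeriod) = i * π + π / 2) :
    SLCount (profileWeight ν) (profileRho A ν) (m * D.halfPeriod) 1 1 (-1) i (i + 1) := by
  have W := D.isSLWeight hm
  obtain ⟨θ, h0, hθ⟩ := W.exists_angle 1 (π / 2) 2
  have h := D.angle_cos h0 hθ m (by
    rw [hΛ, show 2 * (i * π + π / 2) = ((2 * i + 1 : ℕ) : ℝ) * π by push_cast; ring]
    exact Real.sin_nat_mul_pi _)
  rw [hΛ] at h
  refine W.slCount zero_le_one (Or.inr ⟨rfl, rfl⟩) (Or.inl ⟨rfl, rfl⟩) (by norm_num) h0 hθ ?_ ?_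
  · rw [h]; linarith
  · rw [h]; push_cast; linarith

end IsProfile

theorem IsOtsukiGeodesic.exists_model {p q : ℕ} (hq : 0 < q) {a : ℝ} {c : ℝ → Fin 2 → ℝ}
    (hc : IsOtsukiGeodesic p q a c) {N : (Fin 2 → ℝ) → EuclideanSpace ℝ (Fin 4)}
    (hN : IsUnitNormal (otsukiImmersion c) N) :
    ∃ v Λ, ∃ D : IsProfile (sin a * cos a) (fun t => c t 0) v Λ,
      Λ D.halfPeriod = (p : ℝ) / q * π ∧
      inducedMetric (bipolar (otsukiImmersion c) N) =
        profileMetric (sin a * cos a) (fun t => c t 0) ∧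
      ∀ {m : ℕ} {ε : ℤ}, (∀ k i : ℤ, (∃ j : ℤ, 2 * i * p = q * j ∧ Even (k + j)) ↔
          ∃ n r : ℤ, k = 2 * n + ε * r ∧ i = r * m) →
        periodGroup (bipolar (otsukiImmersion c) N) =
          bipolarLattice ε (2 * (m * D.halfPeriod)) := by
  obtain ⟨σ, hσ, v, Λ, D, hcΛ⟩ := hc.exists_profile
  obtain ⟨κ, hκ, hb⟩ := hN.exists_bipolar_eq hσ D hcΛ
  have hT : Λ D.halfPeriod = (p : ℝ) / q * π :=
    (D.Lambda_halfPeriod hc.a_mem rfl hc.start).trans hc.closing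
  refine ⟨v, Λ, D, hT, ?_, fun {m ε} h => ?_⟩
  · rw [hb]; exact inducedMetric_bipolar hσ hκ D hcΛ
  · ext γ
    rw [hb, mem_periodGroup_bipolar hσ hκ D hcΛ hq hT, mem_bipolarLattice]
    constructor
    · rintro ⟨k, i, j, h0, h1, hij⟩
      obtain ⟨n, r, rfl, rfl⟩ := (h k i).1 ⟨j, hij⟩
      exact ⟨n, r, h0, by rw [h1]; push_cast; ring⟩
    · rintro ⟨n, r, h0, h1⟩
      obtain ⟨j, hj⟩ := (h (2 * n + ε * r) (r * m)).2 ⟨n, r, rfl, rfl⟩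
      exact ⟨_, _, j, h0, by rw [h1]; push_cast; ring, hj⟩

theorem proposition15 (p q : ℕ) (hp : 0 < p) (hq : 0 < q) (hpq : Nat.Coprime p q)
    (hlower : (1 : ℝ) / 2 < (p : ℝ) / q) (hupper : (p : ℝ) / q < √2 / 2)
    (a : ℝ) (c : ℝ → Fin 2 → ℝ) (hc : IsOtsukiGeodesic p q a c)
    (N : (Fin 2 → ℝ) → EuclideanSpace ℝ (Fin 4)) (hN : IsUnitNormal (otsukiImmersion c) N)
    (b : ℝ) (hb : b ∈ Ioo 0 (π / 2)) (hab : cos b ^ 4 = 4 * sin a ^ 2 * cos a ^ 2) :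
    (Odd q →
      eigenvalueFunctional (bipolar (otsukiImmersion c) N) (2 * q + 4 * p - 2)
          = 8 * q * π * integralI2 b ∧
        8 * q * π * integralI2 b < 4 * √2 * q * π ^ 2) ∧
    (Even q →
      eigenvalueFunctional (bipolar (otsukiImmersion c) N) (q + 2 * p - 2)
          = 4 * q * π * integralI2 b ∧
        4 * q * π * integralI2 b < 2 * √2 * q * π ^ 2) := by
  obtain ⟨v, Λ, D, hT, hmetric, hgroup⟩ := hc.exists_model hq hN
  have hI := IsProfile.integralI2_eq D.A_pos D.A_lt hb (by rw [hab]; ring)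
  have hlt := IsProfile.integral_phaseDensity_lt D.A_pos D.A_lt
  rw [← hI] at hlt
  have hq0 : (0 : ℝ) < q := by exact_mod_cast hq
  have hΛm : ∀ m : ℕ, Λ (m * D.halfPeriod) = m * ((p : ℝ) / q * π) := fun m => by
    rw [← hT]; exact_mod_cast D.Lambda_symm.2.2 m
  constructor
  · intro hodd
    refine ⟨?_, ?_⟩
    -- Here m = q. Below 2 the counts give (q - 1) + (q + 1) + 2 ((p - 1) + p) = 2q + 4p - 2, and up
    -- to 2 they give q + (q + 1) + 2 (p + (p + 1)) = 2q + 4p + 3.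
    · have hΛ : Λ (q * D.halfPeriod) = p * π := by rw [hΛm]; field_simp
      rw [eigenvalueFunctional, hmetric, hgroup (lattice_arith_odd hpq hodd),
        riemannianArea_profileMetric D hq, ← hI,
        laplaceEigenvalue_eq_two (ε := 0) (δ := 1) D hq (one_mul 1) (by simp) (by simp)
          (D.slCount_zero_odd hq) (D.slCount_zero_even hq) (D.slCount_one_odd hq hp hΛ)
          (D.slCount_one_even hq hΛ) (by omega) (by omega)]
      ring
    · have : 8 * q * π * integralI2 b < 8 * q * π * (√2 / 2 * π) :=
        mul_lt_mul_of_pos_left hlt (by positivity)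
      linarith
  · intro heven
    refine ⟨?_, ?_⟩
    · obtain ⟨m, rfl⟩ := heven.two_dvd
      have hm : 0 < m := by omega
      have hm0 : (m : ℝ) ≠ 0 := by positivity
      obtain ⟨s, rfl⟩ := Nat.coprime_two_right.1 (hpq.coprime_dvd_right ⟨m, rfl⟩)
      -- Here q = 2m and p = 2s + 1. Below 2 the counts give (m - 1) + (m + 1) + 2 (s + s) = q + 2p
      -- - 2, and up to 2 five more.
      have hΛ : Λ (m * D.halfPeriod) = s * π + π / 2 := by
        rw [hΛm]; push_cast; field_simp
      rw [eigenvalueFunctional, hmetric, hgroup (lattice_arith_even hpq hm),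
        riemannianArea_profileMetric D hm, ← hI,
        laplaceEigenvalue_eq_two (ε := 1) (δ := -1) D hm (by norm_num)
          (by simp [Real.cos_add_pi]) (by simp [Real.sin_add_pi])
          (D.slCount_zero_odd hm) (D.slCount_zero_even hm) (D.slCount_one_odd_antiperiodic hm hΛ)
          (D.slCount_one_even_antiperiodic hm hΛ) (by omega) (by omega)]
      push_cast
      ring
    · have : 4 * q * π * integralI2 b < 4 * q * π * (√2 / 2 * π) :=
        mul_lt_mul_of_pos_left hlt (by positivity)
      linarith

end
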